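/- **Setting.** Fix $T>0$, positive integers $d,k$, a Polish action space $A$, an index set $I$, $x_0\in\mathbb R^d$, $r_0\in\mathbb R\cup\{-\infty\}$, and write $\mathcal C=C([0,T],\mathbb R^d)$ with the sup norm. Let $\sigma:[0,T]\times\mathcal C\to\mathbb R^{d\times k}$, $\lambda:[0,T]\times\mathcal C\times A\to\mathbb R^k$, $f:[0,T]\times\mathcal C\times A\to\mathbb R$, $\kappa:[0,T]\times\mathcal C\to\mathbb R$, $U_a:\mathbb R\to\mathbb R$, $U_p:\mathcal C\times\mathbb R\to\mathbb R$, $g^i:\mathcal C\times\mathbb R\to\mathbb R\cup\{\infty\}$ ($i\in I$) be Borel measurable, with $U_a$ injective and $u\mapsto \kappa(u,x_{\cdot\wedge u})$ integrable on $[0,T]$ for every $x$. Let $\alpha:[0,T]\times\mathcal C\times\mathbb R^d\to A$ be Borel measurable and such that $\alpha(t,x,z)$ maximises $u\mapsto \sigma(t,x)\lambda(t,x,u)\cdot z-f(t,x,u)-\kappa(t,x)y$ over $A$ for all $(t,x,y,z)$. Put $K_t(x)=\int_0^t\kappa(u,x_{\cdot\wedge u})\,du$ and $$\bar\sigma(t,x,z)=\begin{pmatrix}\sigma(t,x)\\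 e^{-K_t(x)}z^\top\sigma(t,x)\end{pmatrix},\quad a=\bar\sigma\bar\sigma^\top,\quad b(t,x,z)=\begin{pmatrix}\sigma(t,x)\lambda(t,x,\alpha(t,x,z))\\ e^{-K_t(x)}f(t,x,\alpha(t,x,z))\end{pmatrix},$$ $$\mathscr L\phi(s,x_{\cdot\wedge s},y_s,z)=b(s,x_{\cdot\wedge s},z)\cdot D\phi(x_s,y_s)+\tfrac12\operatorname{Tr}\big(a(s,x_{\cdot\wedge s},z)D^2\phi(x_s,y_s)\big),\qquad \phi\in C^2_c(\mathbb R^{d+1}).$$ For $(x,y,u)\in\mathcal C\times\mathbb R\times\mathbb R$ let $w=e^{K_T(x)}(y+u)$; set $F(x,y,u)=U_p(x,U_a^{-1}(w))$ and $h^i(x,y,u)=g^i(x,U_a^{-1}(w))$ if $w\in U_a(\mathbb R)$, and $F=-\infty$, $h^i=+\infty$ otherwise. Assume: * $\sigma$ is bounded; $a(t,\cdot,\cdot)$ and $b(t,\cdot,\cdot)$ are continuous for every $t$; for some $C>0$, $\|a(t,x,z)\|\le C(1+\|x\|+\|z^\top\sigma(t,x)\|^2)$ and $\|b(t,x,z)\|\le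 C(1+\|x\|+\|z^\top\sigma(t,x)\|)$; * $F$ is upper semicontinuous, concave in $(y,u)$ for every $x$, and $F^+(x,y,u)\le C(1+\|x\|+|y|+|u|)$ for some $C>0$; * each $h^i$ is lower semicontinuous, convex in $u$ for every $(x,y)$, and $h^i(x,y,u)\ge -C_i(1+\|x\|+|y|+|u|)$ for some $C_i>0$. Let $\mathcal M$ be the set of measurable maps $m:[0,T]\to\mathcal P(\mathbb R^d)$, and let $\mathcal F^m_t$ be the $\sigma$-algebra on $\mathcal M$ generated by $m_0$ and by the integrals $\int_0^s\int\varphi(u,z)\,m_u(dz)\,du$, $s\le t$, $\varphi$ bounded Borel. Let $\Omega^c=C([0,T],\mathbb R^{d+1})\times\mathcal M$ carry the filtration $\mathcal F^c_t=\mathcal F^{X,\mathcal Y}_t\otimes\mathcal F^m_t$, where $(X,\mathcal Y)$ is the coordinate process on $C([0,T],\mathbb R^{d+1})$ and $\mathcal F^{X,\mathcal Y}_t=\sigma((X_s,\mathcal Y_s):s\le t)$, and let $(X,\mathcal Y,m,U)$ be the canonical element of $\Omega^c\times\mathbb R$. **Control conditions.** Let $q,q'\in\mathbb R$. Consider a probability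 space with a filtration $(\mathcal G_t)_{t\in[0,T]}$ (no usual conditions are assumed), an adapted $\mathbb R^{d+1}$-valued process $(X,\mathcal Y)$ with continuous paths, an $\mathcal M$-valued $m$ that is adapted (that is, $\mathcal G_t/\mathcal F^m_t$-measurable for all $t$), and a real random variable $U$. They satisfy the control conditions with constants $(q,q')$ if 1. $q>1$, $q'>1$, $\mathbb E\big[\big(\int_0^T\int\|z^\top\sigma(t,X_{\cdot\wedge t})\|^2m_t(dz)dt\big)^{q/2}\big]<\infty$ and $\mathbb E[|U|^{q'}]<\infty$; 2. for every $\phi\in C_c^2(\mathbb R^{d+1})$, $M^\phi_t=\phi(X_t,\mathcal Y_t)-\int_0^t\int\mathscr L\phi(s,X_{\cdot\wedge s},\mathcal Y_s,z)\,m_s(dz)\,ds$ is a martingale; 3. $(X_0,\mathcal Y_0,m_0)=(x_0,0,\delta_0)$ almost surely; 4. $\mathbb E[h^i(X,\mathcal Y_T,U)]\le 0$ for all $i\in I$; 5. for every $\phi\in C_c^2(\mathbb R^{d+1})$ the quadratic covariation $[M^\phi,\mathbb E[U\mid\mathcal G_\cdot]]$ vanishes identically (it is the limit in probability, uniform in time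 and normalised to start at $0$, of the sums of products of increments along deterministic partitions of $[0,T]$ with mesh tending to $0$), and $\mathbb E[U]\ge r_0$. Let $\mathcal R_{q,q'}$ be the set of probability measures $\mathbb P$ on $(\Omega^c\times\mathbb R,\mathcal F^c_T\otimes\mathcal B(\mathbb R))$ under which the canonical $(X,\mathcal Y,m,U)$ with the filtration $(\mathcal F^c_t)$ (lifted to $\Omega^c\times\mathbb R$) satisfies the control conditions with constants $(q,q')$. **Lemma.** Let $(\tilde\Omega,\tilde{\mathcal F},(\tilde{\mathcal F}_t)_{t\in[0,T]},\tilde{\mathbb P})$ be any filtered probability space with adapted continuous $(\tilde X,\tilde{\mathcal Y})$, adapted $\mathcal M$-valued $\tilde m$ and $\tilde{\mathcal F}_T$-measurable real $\tilde U$ that satisfy the control conditions with constants $(q,q')$. Then there are $\mathbb P\in\mathcal R_{q,q'}$ and an $\mathcal F^c_T$-measurable $\hat U:\Omega^c\to\mathbb R$ such that $U=\hat U$ $\mathbb P$-a.s. and $$\mathbb E^{\tilde{\mathbb P}}\big[F(\tilde X,\tilde{\mathcal Y}_T,\tilde U)\big]\le\mathbb E^{\mathbb P}\big[F(X,\mathcal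 Y_T,U)\big].$$ -/

import Mathlib

open MeasureTheory ProbabilityTheory
open scoped ENNReal Matrix

noncomputable section

namespace PrincipalAgent

/-! ### Time interval, paths, relaxed controls -/

/-- The time interval `[0,T]`. -/
abbrev Time (T : ℝ) : Type := Set.Icc (0 : ℝ) T

/-- `ℝ^d` with the Euclidean norm. -/
abbrev E (d : ℕ) : Type := EuclideanSpace ℝ (Fin d)

/-- Continuous paths `[0,T] → V`, with the topology of uniform convergence. -/
abbrev Path (T : ℝ) (V : Type) [TopologicalSpace V] : Type := C(Time T, V)

/-- The Borel σ-algebra on the path space. -/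
instance pathMeasurableSpace (T : ℝ) (V : Type) [TopologicalSpace V] :
    MeasurableSpace (Path T V) := borel _

instance pathBorelSpace (T : ℝ) (V : Type) [TopologicalSpace V] :
    BorelSpace (Path T V) := ⟨rfl⟩

/-- The initial time. -/
def t0 (T : ℝ) [hT : Fact (0 < T)] : Time T := ⟨0, Set.left_mem_Icc.2 hT.out.le⟩

/-- The terminal time. -/
def tT (T : ℝ) [hT : Fact (0 < T)] : Time T := ⟨T, Set.right_mem_Icc.2 hT.out.le⟩

/-- Lebesgue measure on `[0,T]`. -/
def leb (T : ℝ) : Measure (Time T) := Measure.comap Subtype.val volume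

instance lebFinite (T : ℝ) : IsFiniteMeasure (leb T) := by
  refine ⟨?_⟩
  have h : leb T Set.univ = volume (Set.Icc (0 : ℝ) T) := by
    rw [leb, (MeasurableEmbedding.subtype_coe measurableSet_Icc).comap_apply,
      Set.image_univ, Subtype.range_coe]
  rw [h]
  exact measure_Icc_lt_top

/-- The stopped path `x_{· ∧ t}`. -/
def stopPath {T : ℝ} {V : Type} [TopologicalSpace V] (t : Time T) (x : Path T V) : Path T V :=
  ⟨fun s => x (min s t), x.continuous.comp (continuous_id.min continuous_const)⟩

/-- Measurable maps `m : [0,T] → 𝒫(ℝ^d)`, as Markov kernels. -/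
structure RelaxedControl (T : ℝ) (d : ℕ) where
  ker : Kernel (Time T) (E d)
  markov : IsMarkovKernel ker

/-- The measure `m_s(dz) ds` on `[0,t] × ℝ^d`. -/
def RelaxedControl.meas {T : ℝ} {d : ℕ} (m : RelaxedControl T d) (t : Time T) :
    Measure (Time T × E d) :=
  ((leb T).restrict (Set.Iic t)) ⊗ₘ m.ker

/-- The σ-algebra of relaxed controls up to time `t`, generated by the integrals
`∫_0^s ∫ φ(u,z) m_u(dz) du`, `s ≤ t`, with `φ` bounded and Borel.  The value `m_0` at the single
time `0` is included so that the initial condition `m_0 = δ_0` is an event. -/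
abbrev relaxedSigma (T : ℝ) (d : ℕ) (t : Time T) : MeasurableSpace (RelaxedControl T d) :=
  (⨆ (s : Time T) (_ : s ≤ t) (φ : Time T × E d → ℝ) (_ : Measurable φ ∧ ∃ C, ∀ p, |φ p| ≤ C),
    MeasurableSpace.comap (fun m : RelaxedControl T d => ∫ p, φ p ∂(m.meas s)) inferInstance) ⊔
  (⨆ (s : Time T) (_ : (s : ℝ) = 0),
    MeasurableSpace.comap (fun m : RelaxedControl T d => m.ker s) inferInstance)

instance relaxedMeasurableSpace (T : ℝ) (d : ℕ) : MeasurableSpace (RelaxedControl T d) :=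
  ⨆ t : Time T, relaxedSigma T d t

/-- The σ-algebra generated by the path up to time `t`. -/
abbrev pathSigma (T : ℝ) (V : Type) [TopologicalSpace V] [MeasurableSpace V] (t : Time T) :
    MeasurableSpace (Path T V) :=
  ⨆ (s : Time T) (_ : s ≤ t), MeasurableSpace.comap (fun x : Path T V => x s) inferInstance

lemma pathSigma_mono (T : ℝ) (V : Type) [TopologicalSpace V] [MeasurableSpace V] :
    Monotone (pathSigma T V) := fun _ _ h =>
  iSup₂_le fun s hs => le_iSup₂_of_le s (hs.trans h) le_rfl

lemma pathSigma_le (T : ℝ) (V : Type) [TopologicalSpace V] [MeasurableSpace V] [BorelSpace V]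
    (t : Time T) : pathSigma T V t ≤ pathMeasurableSpace T V :=
  iSup₂_le fun s _ => (continuous_eval_const s).measurable.comap_le

lemma relaxedSigma_mono (T : ℝ) (d : ℕ) : Monotone (relaxedSigma T d) := fun _ _ h =>
  sup_le_sup (iSup₂_le fun s hs => le_iSup₂_of_le s (hs.trans h) le_rfl) le_rfl

lemma relaxedSigma_le (T : ℝ) (d : ℕ) (t : Time T) :
    relaxedSigma T d t ≤ relaxedMeasurableSpace T d := le_iSup (relaxedSigma T d) t

/-! ### The canonical space -/

/-- The canonical space `Ω^c`, with canonical element `(X, 𝒴, m^Z)`. -/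
abbrev Canon (T : ℝ) (d : ℕ) : Type := (Path T (E d) × Path T ℝ) × RelaxedControl T d

/-- The σ-algebra `ℱ^c_t`. -/
abbrev canonSigma (T : ℝ) (d : ℕ) (t : Time T) : MeasurableSpace (Canon T d) :=
  ((pathSigma T (E d) t).prod (pathSigma T ℝ t)).prod (relaxedSigma T d t)

lemma canonSigma_mono (T : ℝ) (d : ℕ) : Monotone (canonSigma T d) := fun _ _ h =>
  sup_le_sup
    (MeasurableSpace.comap_mono (sup_le_sup
      (MeasurableSpace.comap_mono (pathSigma_mono T (E d) h))
      (MeasurableSpace.comap_mono (pathSigma_mono T ℝ h))))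
    (MeasurableSpace.comap_mono (relaxedSigma_mono T d h))

lemma canonSigma_le (T : ℝ) (d : ℕ) (t : Time T) :
    canonSigma T d t ≤ (inferInstance : MeasurableSpace (Canon T d)) :=
  sup_le_sup
    (MeasurableSpace.comap_mono (sup_le_sup
      (MeasurableSpace.comap_mono (pathSigma_le T (E d) t))
      (MeasurableSpace.comap_mono (pathSigma_le T ℝ t))))
    (MeasurableSpace.comap_mono (relaxedSigma_le T d t))

/-- The filtration `𝔽^c`, seen on `Ω^c × ℝ`. -/
def canonFiltration (T : ℝ) (d : ℕ) :
    Filtration (Time T) (inferInstance : MeasurableSpace (Canon T d × ℝ)) where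
  seq t := (canonSigma T d t).comap Prod.fst
  mono' _ _ h := MeasurableSpace.comap_mono (canonSigma_mono T d h)
  le' t := (MeasurableSpace.comap_mono (canonSigma_le T d t)).trans measurable_fst.comap_le

/-! ### Expectations of extended real random variables, quadratic covariation -/

/-- Expectation of an extended real random variable, with the convention `∞ - ∞ = -∞`. -/
def lowerExp {Ω : Type*} [MeasurableSpace Ω] (P : Measure Ω) (f : Ω → EReal) : EReal :=
  ((∫⁻ ω, (f ω).toENNReal ∂P : ℝ≥0∞) : EReal) - ((∫⁻ ω, (-f ω).toENNReal ∂P : ℝ≥0∞) : EReal)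

/-- Expectation of an extended real random variable, with the convention `∞ - ∞ = ∞`. -/
def upperExp {Ω : Type*} [MeasurableSpace Ω] (P : Measure Ω) (f : Ω → EReal) : EReal :=
  -lowerExp P (fun ω => -f ω)

/-- `A` is the quadratic covariation `[M,N]`, normalised to start at `0`: along deterministic
partitions of `[0,T]`, the sums of products of increments converge to `A` in probability,
uniformly over the partition points, as the mesh tends to `0`.  Only finitely many times are used
for each partition, so the notion does not depend on the choice of versions and needs no
regularity of the filtration. -/
def IsQuadCovariation {Ω : Type*} [MeasurableSpace Ω] {T : ℝ} (P : Measure Ω)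
    (M N A : Time T → Ω → ℝ) : Prop :=
  ∀ ε : ℝ, 0 < ε → ∃ δ : ℝ, 0 < δ ∧
    ∀ (n : ℕ) (π : ℕ → Time T), Monotone π → (π 0 : ℝ) = 0 → (π n : ℝ) = T →
      (∀ i < n, (π (i + 1) : ℝ) - π i < δ) →
      P {ω | ∃ j ≤ n, ε ≤ |(∑ i ∈ Finset.range j,
          (M (π (i + 1)) ω - M (π i) ω) * (N (π (i + 1)) ω - N (π i) ω)) - A (π j) ω|}
        ≤ ENNReal.ofReal ε

/-! ### The model -/

/-- The data of the problem; `A` is the agent's action space, `I` indexes the constraints. -/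
structure Model (T : ℝ) (d k : ℕ) (A I : Type*) where
  /-- initial state -/
  x₀ : E d
  /-- volatility -/
  vol : Time T → Path T (E d) → Matrix (Fin d) (Fin k) ℝ
  /-- the controlled drift term `λ` -/
  lam : Time T → Path T (E d) → A → (Fin k → ℝ)
  /-- running cost of the agent -/
  cost : Time T → Path T (E d) → A → ℝ
  /-- discount rate of the agent (independent of the action) -/
  disc : Time T → Path T (E d) → ℝ
  /-- the fixed maximiser of the Hamiltonian -/
  act : Time T → Path T (E d) → E d → A
  /-- utility of the agent -/
  Ua : ℝ → ℝ
  /-- utility of the principal -/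
  Up : Path T (E d) → ℝ → ℝ
  /-- constraint functions, with values in `ℝ ∪ {∞}` -/
  g : I → Path T (E d) → ℝ → EReal
  /-- reservation utility, in `ℝ ∪ {-∞}` -/
  r₀ : EReal

namespace Model

variable {T : ℝ} {d k : ℕ} {A I : Type*} (𝓜 : Model T d k A I)

/-- The Hamiltonian before optimisation,
`σ(t,x) λ(t,x,u) · z - f(t,x,u) - k(t,x) y`. -/
def hamiltonian (t : Time T) (x : Path T (E d)) (y : ℝ) (z : E d) (u : A) : ℝ :=
  (𝓜.vol t x *ᵥ 𝓜.lam t x u) ⬝ᵥ (fun i => z i) - 𝓜.cost t x u - 𝓜.disc t x * y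

/-- `∫_0^t k(u, x_{· ∧ u}) du`. -/
def discInt (t : Time T) (x : Path T (E d)) : ℝ :=
  ∫ u in Set.Iic t, 𝓜.disc u (stopPath u x) ∂(leb T)

/-- The row vector `z^⊤ σ(t,x)`. -/
def zvol (t : Time T) (x : Path T (E d)) (z : E d) : Fin k → ℝ :=
  (fun i => z i) ᵥ* 𝓜.vol t x

/-- `‖z^⊤ σ(t,x)‖²` (Euclidean norm). -/
def zvolSq (t : Time T) (x : Path T (E d)) (z : E d) : ℝ :=
  𝓜.zvol t x z ⬝ᵥ 𝓜.zvol t x z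

/-- The `(d+1) × k` matrix with blocks `σ(t,x)` and `exp(-∫_0^t k) z^⊤ σ(t,x)`. -/
def volBar (t : Time T) (x : Path T (E d)) (z : E d) : Matrix (Fin d ⊕ Unit) (Fin k) ℝ :=
  Matrix.fromRows (𝓜.vol t x)
    (Matrix.replicateRow Unit (Real.exp (-𝓜.discInt t x) • 𝓜.zvol t x z))

/-- The diffusion matrix of `(X, 𝒴)`. -/
def diff (t : Time T) (x : Path T (E d)) (z : E d) : Matrix (Fin d ⊕ Unit) (Fin d ⊕ Unit) ℝ :=
  𝓜.volBar t x z * (𝓜.volBar t x z)ᵀ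

/-- The drift of `(X, 𝒴)`. -/
def drift (t : Time T) (x : Path T (E d)) (z : E d) : Fin d ⊕ Unit → ℝ :=
  Sum.elim (𝓜.vol t x *ᵥ 𝓜.lam t x (𝓜.act t x z))
    (fun _ => Real.exp (-𝓜.discInt t x) * 𝓜.cost t x (𝓜.act t x z))

end Model

/-- The standard basis of `ℝ^d × ℝ = ℝ^{d+1}`. -/
def stdVec (d : ℕ) : Fin d ⊕ Unit → E d × ℝ :=
  Sum.elim (fun i => (EuclideanSpace.single i 1, 0)) (fun _ => (0, 1))

/-- Gradient in coordinates. -/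
def grad {d : ℕ} (φ : E d × ℝ → ℝ) (p : E d × ℝ) : Fin d ⊕ Unit → ℝ :=
  fun i => fderiv ℝ φ p (stdVec d i)

/-- Hessian in coordinates. -/
def hess {d : ℕ} (φ : E d × ℝ → ℝ) (p : E d × ℝ) : Matrix (Fin d ⊕ Unit) (Fin d ⊕ Unit) ℝ :=
  fun i j => fderiv ℝ (fun p' => fderiv ℝ φ p' (stdVec d j)) p (stdVec d i)

namespace Model

variable {T : ℝ} {d k : ℕ} {A I : Type*} (𝓜 : Model T d k A I)

/-- The generator `ℒφ(s, x_{· ∧ s}, y_s, z)`. -/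
def gen (φ : E d × ℝ → ℝ) (s : Time T) (x : Path T (E d)) (y : Path T ℝ) (z : E d) : ℝ :=
  𝓜.drift s (stopPath s x) z ⬝ᵥ grad φ (x s, y s)
    + 1 / 2 * (𝓜.diff s (stopPath s x) z * hess φ (x s, y s)).trace

/-- `M^φ_t = φ(X_t,𝒴_t) - ∫_0^t ∫ ℒφ(s, X_{· ∧ s}, 𝒴_s, z) m_s(dz) ds`, for one trajectory. -/
def martFun (φ : E d × ℝ → ℝ) (t : Time T) (x : Path T (E d)) (y : Path T ℝ)
    (m : RelaxedControl T d) : ℝ :=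
  φ (x t, y t) - ∫ p, 𝓜.gen φ p.1 x y p.2 ∂(m.meas t)

open Classical in
/-- The principal's objective as a function of `(x, y, u)`. -/
def F [Fact (0 < T)] (x : Path T (E d)) (y u : ℝ) : EReal :=
  if Real.exp (𝓜.discInt (tT T) x) * (y + u) ∈ Set.range 𝓜.Ua then
    ((𝓜.Up x (Function.invFun 𝓜.Ua (Real.exp (𝓜.discInt (tT T) x) * (y + u))) : ℝ) : EReal)
  else ⊥

open Classical in
/-- The constraint functions of `(x, y, u)`. -/
def h [Fact (0 < T)] (i : I) (x : Path T (E d)) (y u : ℝ) : EReal :=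
  if Real.exp (𝓜.discInt (tT T) x) * (y + u) ∈ Set.range 𝓜.Ua then
    𝓜.g i x (Function.invFun 𝓜.Ua (Real.exp (𝓜.discInt (tT T) x) * (y + u)))
  else ⊤

/-- Standing assumptions.  The first group makes the data meaningful; the last ones are the
conditions on the coefficients, on `F` and on the `h i`.  Norms of finite-dimensional matrices and
vectors are bounded entrywise, the constants being free. -/
structure Standing [Fact (0 < T)] [MeasurableSpace A] : Prop where
  vol_meas : ∀ i j, Measurable fun p : Time T × Path T (E d) => 𝓜.vol p.1 p.2 i j
  lam_meas : ∀ i, Measurable fun p : Time T × Path T (E d) × A => 𝓜.lam p.1 p.2.1 p.2.2 i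
  cost_meas : Measurable fun p : Time T × Path T (E d) × A => 𝓜.cost p.1 p.2.1 p.2.2
  disc_meas : Measurable fun p : Time T × Path T (E d) => 𝓜.disc p.1 p.2
  /-- the discount factors `exp(± ∫ k)` make sense -/
  disc_int : ∀ x : Path T (E d), Integrable (fun u => 𝓜.disc u (stopPath u x)) (leb T)
  act_meas : Measurable fun p : Time T × Path T (E d) × E d => 𝓜.act p.1 p.2.1 p.2.2
  act_max : ∀ t x y z u, 𝓜.hamiltonian t x y z u ≤ 𝓜.hamiltonian t x y z (𝓜.act t x z)
  Ua_meas : Measurable 𝓜.Ua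
  Ua_inj : Function.Injective 𝓜.Ua
  Up_meas : Measurable fun p : Path T (E d) × ℝ => 𝓜.Up p.1 p.2
  g_meas : ∀ i, Measurable fun p : Path T (E d) × ℝ => 𝓜.g i p.1 p.2
  g_ne_bot : ∀ i x c, 𝓜.g i x c ≠ ⊥
  r₀_ne_top : 𝓜.r₀ ≠ ⊤
  vol_bdd : ∃ C : ℝ, ∀ t x i j, |𝓜.vol t x i j| ≤ C
  diff_cont : ∀ t, Continuous fun p : Path T (E d) × E d => 𝓜.diff t p.1 p.2
  drift_cont : ∀ t, Continuous fun p : Path T (E d) × E d => 𝓜.drift t p.1 p.2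
  growth : ∃ C : ℝ, 0 < C ∧ ∀ t x z,
    (∀ i j, |𝓜.diff t x z i j| ≤ C * (1 + ‖x‖ + 𝓜.zvolSq t x z)) ∧
    (∀ i, |𝓜.drift t x z i| ≤ C * (1 + ‖x‖ + Real.sqrt (𝓜.zvolSq t x z)))
  F_usc : UpperSemicontinuous fun p : Path T (E d) × ℝ × ℝ => 𝓜.F p.1 p.2.1 p.2.2
  F_concave : ∀ x y₁ u₁ y₂ u₂, ∀ α β : ℝ, 0 < α → 0 < β → α + β = 1 →
    (α : EReal) * 𝓜.F x y₁ u₁ + (β : EReal) * 𝓜.F x y₂ u₂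
      ≤ 𝓜.F x (α * y₁ + β * y₂) (α * u₁ + β * u₂)
  F_growth : ∃ C : ℝ, 0 < C ∧ ∀ x y u,
    max (𝓜.F x y u) 0 ≤ ((C * (1 + ‖x‖ + |y| + |u|) : ℝ) : EReal)
  h_lsc : ∀ i, LowerSemicontinuous fun p : Path T (E d) × ℝ × ℝ => 𝓜.h i p.1 p.2.1 p.2.2
  h_growth : ∀ i, ∃ C : ℝ, 0 < C ∧ ∀ x y u,
    ((-C * (1 + ‖x‖ + |y| + |u|) : ℝ) : EReal) ≤ 𝓜.h i x y u
  h_convex : ∀ i x y u₁ u₂, ∀ α β : ℝ, 0 < α → 0 < β → α + β = 1 →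
    𝓜.h i x y (α * u₁ + β * u₂) ≤ (α : EReal) * 𝓜.h i x y u₁ + (β : EReal) * 𝓜.h i x y u₂

/-- The control conditions with constants `(q, q')`, for `(X, 𝒴, m, U)` on a filtered probability
space. -/
structure ControlConditions [Fact (0 < T)] {Ω : Type*} [mΩ : MeasurableSpace Ω]
    (ℱ : Filtration (Time T) mΩ) (P : Measure Ω) (q q' : ℝ)
    (X : Ω → Path T (E d)) (Y : Ω → Path T ℝ) (m : Ω → RelaxedControl T d) (U : Ω → ℝ) :
    Prop where
  one_lt_q : 1 < q
  one_lt_q' : 1 < q'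
  moment_m : ∫⁻ ω, (∫⁻ p, ENNReal.ofReal (𝓜.zvolSq p.1 (stopPath p.1 (X ω)) p.2)
      ∂((m ω).meas (tT T))) ^ (q / 2) ∂P < ∞
  moment_U : ∫⁻ ω, ENNReal.ofReal |U ω| ^ q' ∂P < ∞
  martingale : ∀ φ : E d × ℝ → ℝ, ContDiff ℝ 2 φ → HasCompactSupport φ →
    Martingale (fun t ω => 𝓜.martFun φ t (X ω) (Y ω) (m ω)) ℱ P
  initial : ∀ᵐ ω ∂P, X ω (t0 T) = 𝓜.x₀ ∧ Y ω (t0 T) = 0 ∧ (m ω).ker (t0 T) = Measure.dirac 0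
  constraint : ∀ i, upperExp P (fun ω => 𝓜.h i (X ω) (Y ω (tT T)) (U ω)) ≤ 0
  orthogonal : ∀ φ : E d × ℝ → ℝ, ContDiff ℝ 2 φ → HasCompactSupport φ →
    IsQuadCovariation P (fun t ω => 𝓜.martFun φ t (X ω) (Y ω) (m ω)) (fun t => P[U | ℱ t])
      (fun _ _ => 0)
  participation : 𝓜.r₀ ≤ ((∫ ω, U ω ∂P : ℝ) : EReal)

/-- The set `ℛ_{q,q'}` of control rules of the principal. -/
def controlRules [Fact (0 < T)] (q q' : ℝ) : Set (Measure (Canon T d × ℝ)) :=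
  {P | IsProbabilityMeasure P ∧
    𝓜.ControlConditions (canonFiltration T d) P q q'
      (fun ω => ω.1.1.1) (fun ω => ω.1.1.2) (fun ω => ω.1.2) (fun ω => ω.2)}

end Model

end PrincipalAgent

end

noncomputable section

namespace PrincipalAgent

/-! ### Conditional expectations and truncation -/

section PullOut

variable {Ω : Type*} {𝒢 : MeasurableSpace Ω} {mΩ : MeasurableSpace Ω} {P : Measure Ω}

/-! Put `Φ = (X, Y, m)` and replace `U` by `V = E[U | Φ] = U'(Φ)`, where `U'` is the mean of the
regular conditional law of `U` given `Φ`. The control rule sought is the law of `(Φ, V)`.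
Conditioning keeps the law of `Φ` and the mean of `U`, contracts `L^{q'}`, and by conditional Jensen
neither lowers the objective (`F` is concave in `u`) nor raises the constraints (`h i` is convex in
`u`); see `lowerExp_neg_le_lowerExp_neg_condDistrib`. The processes `M^φ` are adapted to the
filtration `𝒢` generated by `Φ`, hence remain martingales for it.

The difficulty is the orthogonality condition, since `E[U | ℱ_t]` is replaced by a different
martingale `E[U | 𝒢_t]`. For a bounded continuous martingale `M`, vanishing of `[M, E[U | ℱ]]` is
equivalent to `E[a U (M_t - M_s)] = 0` for all `s ≤ t` and all bounded `ℱ_s`-measurable `a`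
(`integral_mul_increment_eq_zero_of_isQuadCovariation` and
`isQuadCovariation_zero_of_integral_mul_increment_eq_zero`). The second condition mentions the
filtration only through the test variables `a`, so it passes to any smaller filtration to which `M`
is adapted.

Both directions use only integrability of `U` and no path regularity of `E[U | ℱ]`, so they rest on
estimates along one finite partition: `abs_integral_mul_increment_le` and
`measureReal_le_abs_incSum_le`. There the sums of products are stopped at the exit from a region
where everything is bounded. The jump at the exit is not bounded, but it carries a factor at most
the largest increment of `M`, which is small in mean by continuity; truncation of `U` at a level `L`
makes this sufficient.

Finally `M^φ` need not be bounded. It is stopped when the total variation of its drift part reaches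
a level `K`, a time determined by `Φ`. Stopping preserves the martingale property and the vanishing
covariation (`martingale_stopped_levelTime`, `IsQuadCovariation.stopped`), and for large `K` it
changes `M^φ` only with small probability (`isQuadCovariation_zero_of_localized`). Together this
gives `isQuadCovariation_of_le`. -/

lemma integral_mul_condExp_of_bound [IsFiniteMeasure P] (h𝒢 : 𝒢 ≤ mΩ) {J V : Ω → ℝ}
    (hJ : StronglyMeasurable[𝒢] J) (hV : Integrable V P) (c : ℝ) (hc : ∀ᵐ ω ∂P, ‖J ω‖ ≤ c) :
    ∫ ω, J ω * (P[V | 𝒢]) ω ∂P = ∫ ω, J ω * V ω ∂P := by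
  have h := condExp_stronglyMeasurable_mul_of_bound h𝒢 hJ hV c hc
  have h2 := integral_condExp (μ := P) (f := J * V) h𝒢
  rw [integral_congr_ae h] at h2
  exact h2

/-- The part of `|U|` above the level `L`. -/
def excess (U : Ω → ℝ) (L : ℝ) (ω : Ω) : ℝ := max (|U ω| - L) 0

lemma excess_nonneg (U : Ω → ℝ) (L : ℝ) (ω : Ω) : 0 ≤ excess U L ω := le_max_right _ _

lemma abs_le_add_excess (U : Ω → ℝ) (L : ℝ) (ω : Ω) : |U ω| ≤ L + excess U L ω := by
  have := le_max_left (|U ω| - L) 0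
  unfold excess
  linarith

lemma integrable_excess [IsFiniteMeasure P] {U : Ω → ℝ} (hU : Integrable U P) (L : ℝ) :
    Integrable (excess U L) P :=
  (hU.abs.sub (integrable_const L)).pos_part

lemma integral_excess_nonneg (U : Ω → ℝ) (L : ℝ) : 0 ≤ ∫ ω, excess U L ω ∂P :=
  integral_nonneg fun _ => excess_nonneg _ _ _

lemma tendsto_integral_excess [IsFiniteMeasure P] {U : Ω → ℝ} (hU : Integrable U P) :
    Filter.Tendsto (fun n : ℕ => ∫ ω, excess U n ω ∂P) Filter.atTop (nhds 0) := by
  have h : Filter.Tendsto (fun n : ℕ => ∫ ω, excess U n ω ∂P) Filter.atTop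
      (nhds (∫ _, (0 : ℝ) ∂P)) := by
    refine tendsto_integral_of_dominated_convergence (fun ω => |U ω|)
      (fun n => (integrable_excess hU n).aestronglyMeasurable) hU.abs
      (fun n => Filter.Eventually.of_forall fun ω => ?_)
      (Filter.Eventually.of_forall fun ω => ?_)
    · rw [Real.norm_of_nonneg (excess_nonneg _ _ _)]
      refine max_le ?_ (abs_nonneg _)
      have : (0 : ℝ) ≤ n := Nat.cast_nonneg n
      linarith
    · obtain ⟨N, hN⟩ := exists_nat_ge |U ω|
      refine tendsto_const_nhds.congr' ?_
      filter_upwards [Filter.eventually_ge_atTop N] with n hn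
      have : (N : ℝ) ≤ n := Nat.cast_le.2 hn
      exact (max_eq_right (by linarith)).symm
  simpa using h

/-- Since `|U| ≤ L + excess U L`, each conditional expectation is a constant plus a part whose mean
is that of `excess U L`, whatever `𝒢` is. This plays the role of uniform integrability of the
conditional expectations of `U`. -/
lemma abs_condExp_le_add_excess [IsFiniteMeasure P] (h𝒢 : 𝒢 ≤ mΩ) {U : Ω → ℝ}
    (hU : Integrable U P) (L : ℝ) :
    ∀ᵐ ω ∂P, |(P[U | 𝒢]) ω| ≤ L + (P[excess U L | 𝒢]) ω := by
  have hi := integrable_excess hU L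
  have hs : Integrable (fun ω => L + excess U L ω) P := (integrable_const L).add hi
  have e : P[fun ω => L + excess U L ω | 𝒢] =ᵐ[P] fun ω => L + (P[excess U L | 𝒢]) ω := by
    refine (condExp_add (integrable_const L) hi 𝒢).trans ?_
    rw [condExp_const h𝒢]
    rfl
  have h1 : P[U | 𝒢] ≤ᵐ[P] P[fun ω => L + excess U L ω | 𝒢] :=
    condExp_mono hU hs (Filter.Eventually.of_forall fun ω =>
      (le_abs_self _).trans (abs_le_add_excess U L ω))
  have h2 : P[-U | 𝒢] ≤ᵐ[P] P[fun ω => L + excess U L ω | 𝒢] :=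
    condExp_mono hU.neg hs (Filter.Eventually.of_forall fun ω =>
      (neg_le_abs _).trans (abs_le_add_excess U L ω))
  filter_upwards [h1, h2, e, condExp_neg U 𝒢 (μ := P)] with ω a b c d
  rw [c] at a b
  rw [d] at b
  exact abs_le.2 ⟨by simp only [Pi.neg_apply] at b; linarith, a⟩

/-- A family of weights with sum at most one, measurable at the respective times, tests a closed
martingale like a stopping time does. -/
lemma integral_mul_sum_abs_condExp_le [IsProbabilityMeasure P] {ι : Type*} (s : Finset ι)
    {𝒢 : ι → MeasurableSpace Ω} (h𝒢 : ∀ i, 𝒢 i ≤ mΩ) {J : ι → Ω → ℝ}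
    (hJ : ∀ i, StronglyMeasurable[𝒢 i] (J i)) (hJ0 : ∀ i ω, 0 ≤ J i ω)
    (hJ1 : ∀ ω, ∑ i ∈ s, J i ω ≤ 1) {D : Ω → ℝ} (hD : AEStronglyMeasurable D P) {c : ℝ}
    (hD0 : ∀ ω, 0 ≤ D ω) (hDc : ∀ᵐ ω ∂P, D ω ≤ c) {U : Ω → ℝ} (hU : Integrable U P) {L : ℝ}
    (hL : 0 ≤ L) :
    Integrable (fun ω => D ω * ∑ i ∈ s, J i ω * |(P[U | 𝒢 i]) ω|) P ∧
    ∫ ω, D ω * ∑ i ∈ s, J i ω * |(P[U | 𝒢 i]) ω| ∂P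
      ≤ L * ∫ ω, D ω ∂P + c * ∫ ω, excess U L ω ∂P := by
  have hJle : ∀ i ∈ s, ∀ ω, J i ω ≤ 1 := fun i hi ω =>
    (Finset.single_le_sum (f := fun i => J i ω) (fun i _ => hJ0 i ω) hi).trans (hJ1 ω)
  have hJm : ∀ i, AEStronglyMeasurable (J i) P := fun i =>
    ((hJ i).mono (h𝒢 i)).aestronglyMeasurable
  have hJn : ∀ i ∈ s, ∀ᵐ ω ∂P, ‖J i ω‖ ≤ 1 := fun i hi => Filter.Eventually.of_forall fun ω => by
    rw [Real.norm_of_nonneg (hJ0 i ω)]; exact hJle i hi ω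
  have hDn : ∀ᵐ ω ∂P, ‖D ω‖ ≤ c := by
    filter_upwards [hDc] with ω h
    rwa [Real.norm_of_nonneg (hD0 ω)]
  have hc : 0 ≤ c := by
    obtain ⟨ω, h⟩ := hDc.exists
    exact (hD0 ω).trans h
  have hDi : Integrable D P := (integrable_const c).mono' hD hDn
  have hi1 : Integrable (fun ω => ∑ i ∈ s, J i ω * |(P[U | 𝒢 i]) ω|) P :=
    integrable_finsetSum s fun i hi => (integrable_condExp.abs).bdd_mul (hJm i) (hJn i hi)
  have hi2 : Integrable (fun ω => ∑ i ∈ s, J i ω * (P[excess U L | 𝒢 i]) ω) P :=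
    integrable_finsetSum s fun i hi => integrable_condExp.bdd_mul (hJm i) (hJn i hi)
  have hI : Integrable (fun ω => D ω * ∑ i ∈ s, J i ω * |(P[U | 𝒢 i]) ω|) P :=
    hi1.bdd_mul hD hDn
  refine ⟨hI, ?_⟩
  -- `D` is not measurable for the `𝒢 i`, so it cannot be moved through the conditional
  -- expectations. It is kept where it multiplies the constant `L` and replaced by its bound `c` on
  -- the excess; the weights can then be pulled inside.
  have key : ∀ᵐ ω ∂P, D ω * ∑ i ∈ s, J i ω * |(P[U | 𝒢 i]) ω| ≤
      L * D ω + c * ∑ i ∈ s, J i ω * (P[excess U L | 𝒢 i]) ω := by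
    have h1 : ∀ᵐ ω ∂P, ∀ i ∈ s, |(P[U | 𝒢 i]) ω| ≤ L + (P[excess U L | 𝒢 i]) ω :=
      (Filter.eventually_all_finset s).2 fun i _ => abs_condExp_le_add_excess (h𝒢 i) hU L
    have h2 : ∀ᵐ ω ∂P, ∀ i ∈ s, 0 ≤ (P[excess U L | 𝒢 i]) ω :=
      (Filter.eventually_all_finset s).2 fun i _ =>
        condExp_nonneg (Filter.Eventually.of_forall fun ω => excess_nonneg U L ω)
    filter_upwards [h1, h2, hDc] with ω h1 h2 h3
    have e1 : ∑ i ∈ s, J i ω * |(P[U | 𝒢 i]) ω| ≤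
        L + ∑ i ∈ s, J i ω * (P[excess U L | 𝒢 i]) ω := by
      calc ∑ i ∈ s, J i ω * |(P[U | 𝒢 i]) ω|
          ≤ ∑ i ∈ s, J i ω * (L + (P[excess U L | 𝒢 i]) ω) :=
            Finset.sum_le_sum fun i hi => mul_le_mul_of_nonneg_left (h1 i hi) (hJ0 i ω)
        _ = L * ∑ i ∈ s, J i ω + ∑ i ∈ s, J i ω * (P[excess U L | 𝒢 i]) ω := by
            rw [Finset.mul_sum, ← Finset.sum_add_distrib]
            exact Finset.sum_congr rfl fun i _ => by ring
        _ ≤ _ := by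
            have := mul_le_mul_of_nonneg_left (hJ1 ω) hL
            linarith
    have e2 : 0 ≤ ∑ i ∈ s, J i ω * (P[excess U L | 𝒢 i]) ω :=
      Finset.sum_nonneg fun i hi => mul_nonneg (hJ0 i ω) (h2 i hi)
    have e3 := mul_le_mul_of_nonneg_left e1 (hD0 ω)
    have e4 := mul_le_mul_of_nonneg_right h3 e2
    linarith
  calc ∫ ω, D ω * ∑ i ∈ s, J i ω * |(P[U | 𝒢 i]) ω| ∂P
      ≤ ∫ ω, (L * D ω + c * ∑ i ∈ s, J i ω * (P[excess U L | 𝒢 i]) ω) ∂P :=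
        integral_mono_ae hI ((hDi.const_mul L).add (hi2.const_mul c)) key
    _ = L * ∫ ω, D ω ∂P + c * ∫ ω, ∑ i ∈ s, J i ω * (P[excess U L | 𝒢 i]) ω ∂P := by
        rw [integral_add (hDi.const_mul L) (hi2.const_mul c), integral_const_mul,
          integral_const_mul]
    _ ≤ _ := by
        have hi3 : ∀ i ∈ s, Integrable (fun ω => J i ω * excess U L ω) P := fun i hi =>
          (integrable_excess hU L).bdd_mul (hJm i) (hJn i hi)
        have e : ∫ ω, ∑ i ∈ s, J i ω * (P[excess U L | 𝒢 i]) ω ∂P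
            = ∫ ω, (∑ i ∈ s, J i ω) * excess U L ω ∂P := by
          rw [integral_finsetSum s fun i hi => integrable_condExp.bdd_mul (hJm i) (hJn i hi)]
          simp_rw [Finset.sum_mul]
          rw [integral_finsetSum s hi3]
          exact Finset.sum_congr rfl fun i hi =>
            integral_mul_condExp_of_bound (h𝒢 i) (hJ i) (integrable_excess hU L) 1 (hJn i hi)
        rw [e]
        have : ∫ ω, (∑ i ∈ s, J i ω) * excess U L ω ∂P ≤ ∫ ω, excess U L ω ∂P := by
          refine integral_mono ?_ (integrable_excess hU L) fun ω => ?_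
          · simp_rw [Finset.sum_mul]
            exact integrable_finsetSum s hi3
          · have := mul_le_mul_of_nonneg_right (hJ1 ω) (excess_nonneg U L ω)
            simpa using this
        have := mul_le_mul_of_nonneg_left this hc
        linarith

end PullOut

/-! ### Stopping weights in discrete time -/

section Alive

variable {Ω : Type*} {mΩ : MeasurableSpace Ω} {𝓖 : Filtration ℕ mΩ}

/-- The indicator of having stayed in the sets `Q j` up to time `i`. -/
def alive (Q : ℕ → Set Ω) (i : ℕ) : Ω → ℝ := {ω | ∀ j ≤ i, ω ∈ Q j}.indicator 1

/-- The indicator of leaving the sets `Q j` at time `i + 1`. -/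
def exits (Q : ℕ → Set Ω) (i : ℕ) (ω : Ω) : ℝ := alive Q i ω - alive Q (i + 1) ω

variable (Q : ℕ → Set Ω)

lemma alive_eq_one {i : ℕ} {ω : Ω} (h : ∀ j ≤ i, ω ∈ Q j) : alive Q i ω = 1 :=
  Set.indicator_of_mem (s := {ω | ∀ j ≤ i, ω ∈ Q j}) h 1

lemma alive_eq_zero {i : ℕ} {ω : Ω} (h : ¬ ∀ j ≤ i, ω ∈ Q j) : alive Q i ω = 0 :=
  Set.indicator_of_notMem (s := {ω | ∀ j ≤ i, ω ∈ Q j}) h 1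

lemma alive_nonneg (i : ℕ) (ω : Ω) : 0 ≤ alive Q i ω :=
  Set.indicator_nonneg (fun _ _ => zero_le_one) _

lemma alive_le_one (i : ℕ) (ω : Ω) : alive Q i ω ≤ 1 :=
  Set.indicator_le_self' (fun _ _ => zero_le_one) _

lemma norm_alive_le_one (i : ℕ) (ω : Ω) : ‖alive Q i ω‖ ≤ 1 := by
  rw [Real.norm_of_nonneg (alive_nonneg Q i ω)]
  exact alive_le_one Q i ω

lemma alive_succ_le (i : ℕ) (ω : Ω) : alive Q (i + 1) ω ≤ alive Q i ω := by
  by_cases h : ∀ j ≤ i + 1, ω ∈ Q j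
  · rw [alive_eq_one Q h, alive_eq_one Q fun j hj => h j (hj.trans (Nat.le_succ i))]
  · rw [alive_eq_zero Q h]
    exact alive_nonneg Q i ω

lemma exits_nonneg (i : ℕ) (ω : Ω) : 0 ≤ exits Q i ω := sub_nonneg.2 (alive_succ_le Q i ω)

lemma norm_exits_le_one (i : ℕ) (ω : Ω) : ‖exits Q i ω‖ ≤ 1 := by
  rw [Real.norm_of_nonneg (exits_nonneg Q i ω), exits]
  linarith [alive_le_one Q i ω, alive_nonneg Q (i + 1) ω]

lemma sum_exits_le_one (n : ℕ) (ω : Ω) : ∑ i ∈ Finset.range n, exits Q i ω ≤ 1 := by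
  have : ∑ i ∈ Finset.range n, exits Q i ω = alive Q 0 ω - alive Q n ω :=
    Finset.sum_range_sub' (fun i => alive Q i ω) n
  rw [this]
  linarith [alive_le_one Q 0 ω, alive_nonneg Q n ω]

variable {Q}

lemma stronglyMeasurable_alive (hQ : ∀ i, MeasurableSet[𝓖 i] (Q i)) (i : ℕ) :
    StronglyMeasurable[𝓖 i] (alive Q i) := by
  refine StronglyMeasurable.indicator stronglyMeasurable_one ?_
  have : {ω | ∀ j ≤ i, ω ∈ Q j} = ⋂ j ∈ Set.Iic i, Q j := by ext; simp
  rw [this]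
  exact MeasurableSet.biInter (Set.to_countable _) fun j hj => 𝓖.mono hj _ (hQ j)

lemma stronglyMeasurable_exits (hQ : ∀ i, MeasurableSet[𝓖 i] (Q i)) (i : ℕ) :
    StronglyMeasurable[𝓖 (i + 1)] (exits Q i) :=
  ((stronglyMeasurable_alive hQ i).mono (𝓖.mono (Nat.le_succ i))).sub
    (stronglyMeasurable_alive hQ (i + 1))

end Alive

/-! ### Discrete time: small sums of products imply approximate orthogonality. -/

section Discrete

variable {Ω : Type*} {mΩ : MeasurableSpace Ω} {P : Measure Ω} {𝓖 : Filtration ℕ mΩ}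

/-- Sums of products of increments. -/
def incSum (M N : ℕ → Ω → ℝ) (j : ℕ) (ω : Ω) : ℝ :=
  ∑ i ∈ Finset.range j, (M (i + 1) ω - M i ω) * (N (i + 1) ω - N i ω)

lemma incSum_succ (M N : ℕ → Ω → ℝ) (j : ℕ) (ω : Ω) :
    incSum M N (j + 1) ω = incSum M N j ω + (M (j + 1) ω - M j ω) * (N (j + 1) ω - N j ω) :=
  Finset.sum_range_succ _ _

lemma measurable_incSum {M N : ℕ → Ω → ℝ} (hM : ∀ i, Measurable[𝓖 i] (M i))
    (hN : ∀ i, Measurable[𝓖 i] (N i)) (j : ℕ) : Measurable[𝓖 j] (incSum M N j) := by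
  refine Finset.measurable_fun_sum _ fun i hi => ?_
  have hi : i + 1 ≤ j := Finset.mem_range.1 hi
  have h1 := fun (V : ℕ → Ω → ℝ) (hV : ∀ i, Measurable[𝓖 i] (V i)) =>
    ((hV (i + 1)).mono (𝓖.mono hi) le_rfl).sub
      ((hV i).mono (𝓖.mono ((Nat.le_succ i).trans hi)) le_rfl)
  exact (h1 M hM).mul (h1 N hN)

/-- Overshoot bound: the jump at the exit time is small in mean. -/
lemma integral_overshoot_le [IsProbabilityMeasure P] {Q : ℕ → Set Ω}
    (hQ : ∀ i, MeasurableSet[𝓖 i] (Q i)) {U : Ω → ℝ} (hU : Integrable U P) (n : ℕ) {D : Ω → ℝ}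
    (hD : AEStronglyMeasurable D P) {c : ℝ} (hD0 : ∀ ω, 0 ≤ D ω) (hDc : ∀ᵐ ω ∂P, D ω ≤ c)
    {R L : ℝ} (hR : 0 ≤ R) (hL : 0 ≤ L) :
    Integrable (fun ω => D ω * ∑ i ∈ Finset.range n,
      exits Q i ω * (R + |(P[U | 𝓖 (i + 1)]) ω|)) P ∧
    ∫ ω, D ω * ∑ i ∈ Finset.range n, exits Q i ω * (R + |(P[U | 𝓖 (i + 1)]) ω|) ∂P
      ≤ (R + L) * ∫ ω, D ω ∂P + c * ∫ ω, excess U L ω ∂P := by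
  obtain ⟨h1, h2⟩ := integral_mul_sum_abs_condExp_le (P := P) (Finset.range n)
    (𝒢 := fun i => 𝓖 (i + 1)) (fun i => 𝓖.le _) (fun i => stronglyMeasurable_exits hQ i)
    (fun i ω => exits_nonneg Q i ω) (fun ω => sum_exits_le_one Q n ω) hD hD0 hDc hU hL
  have hDn : ∀ᵐ ω ∂P, ‖D ω‖ ≤ c := by
    filter_upwards [hDc] with ω h
    rwa [Real.norm_of_nonneg (hD0 ω)]
  have hDi : Integrable D P := (integrable_const c).mono' hD hDn
  have hi0 : Integrable (fun ω => D ω * ∑ i ∈ Finset.range n, exits Q i ω) P := by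
    refine (integrable_finsetSum _ fun i _ => ?_).bdd_mul hD hDn
    exact (integrable_const (1 : ℝ)).mono'
      ((stronglyMeasurable_exits hQ i).mono (𝓖.le _)).aestronglyMeasurable
      (Filter.Eventually.of_forall fun ω => norm_exits_le_one Q i ω)
  have e : (fun ω => D ω * ∑ i ∈ Finset.range n,
      exits Q i ω * (R + |(P[U | 𝓖 (i + 1)]) ω|)) = fun ω =>
      R * (D ω * ∑ i ∈ Finset.range n, exits Q i ω) +
        D ω * ∑ i ∈ Finset.range n, exits Q i ω * |(P[U | 𝓖 (i + 1)]) ω| := by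
    funext ω
    have : ∑ i ∈ Finset.range n, exits Q i ω * (R + |(P[U | 𝓖 (i + 1)]) ω|) =
        R * ∑ i ∈ Finset.range n, exits Q i ω +
          ∑ i ∈ Finset.range n, exits Q i ω * |(P[U | 𝓖 (i + 1)]) ω| := by
      rw [Finset.mul_sum, ← Finset.sum_add_distrib]
      exact Finset.sum_congr rfl fun i _ => by ring
    rw [this]
    ring
  rw [e]
  refine ⟨(hi0.const_mul R).add h1, ?_⟩
  rw [integral_add (hi0.const_mul R) h1, integral_const_mul]
  have h3 : ∫ ω, D ω * ∑ i ∈ Finset.range n, exits Q i ω ∂P ≤ ∫ ω, D ω ∂P :=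
    integral_mono hi0 hDi fun ω => by
      have := mul_le_mul_of_nonneg_left (sum_exits_le_one Q n ω) (hD0 ω)
      simpa using this
  have := mul_le_mul_of_nonneg_left h3 hR
  linarith

lemma integral_mul_increment_eq_zero [IsFiniteMeasure P] {M : ℕ → Ω → ℝ} (hM : Martingale M 𝓖 P)
    {i : ℕ} {w : Ω → ℝ} (hw : StronglyMeasurable[𝓖 i] w) {K : ℝ} (hK : ∀ᵐ ω ∂P, ‖w ω‖ ≤ K) :
    ∫ ω, w ω * (M (i + 1) ω - M i ω) ∂P = 0 := by
  have h := integral_mul_condExp_of_bound (P := P) (𝓖.le i) hw (hM.integrable (i + 1)) K hK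
  have h2 : ∫ ω, w ω * (P[M (i + 1) | 𝓖 i]) ω ∂P = ∫ ω, w ω * M i ω ∂P := by
    refine integral_congr_ae ?_
    filter_upwards [hM.condExp_ae_eq (Nat.le_succ i)] with ω hω
    rw [hω]
  have hi : ∀ j, Integrable (fun ω => w ω * M j ω) P := fun j =>
    (hM.integrable j).bdd_mul (hw.mono (𝓖.le i)).aestronglyMeasurable hK
  simp_rw [mul_sub]
  rw [integral_sub (hi _) (hi _), ← h, h2, sub_self]

/-- If the sums of products of increments of a bounded martingale `M` and of `E[U | 𝓖]` are small
along a fine partition, then `U` is almost orthogonal to the increments of `M`. -/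
lemma abs_integral_mul_increment_le [IsProbabilityMeasure P] {M : ℕ → Ω → ℝ}
    (hM : Martingale M 𝓖 P) {c : ℝ} (hc0 : 0 ≤ c) (hMc : ∀ᵐ ω ∂P, ∀ i, |M i ω| ≤ c) {U : Ω → ℝ}
    (hU : Integrable U P) {a : Ω → ℝ} (ha : StronglyMeasurable[𝓖 0] a) (ha1 : ∀ ω, |a ω| ≤ 1)
    (n : ℕ) {D : Ω → ℝ} (hD : AEStronglyMeasurable D P) (hD0 : ∀ ω, 0 ≤ D ω)
    (hDc : ∀ᵐ ω ∂P, D ω ≤ 2 * c)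
    (hMD : ∀ᵐ ω ∂P, ∀ i < n, |M (i + 1) ω - M i ω| ≤ D ω) {ε R L : ℝ} (hε : 0 ≤ ε)
    (hR : 0 ≤ R) (hL : 0 ≤ L) :
    |∫ ω, a ω * (U ω * (M n ω - M 0 ω)) ∂P| ≤
      ε + ((R + L) * ∫ ω, D ω ∂P + 2 * c * ∫ ω, excess U L ω ∂P)
        + 2 * c * (L * P.real {ω | ∃ j ≤ n, R ≤ |(P[U | 𝓖 j]) ω| ∨
            ε ≤ |incSum M (fun i => P[U | 𝓖 i]) j ω|} + ∫ ω, excess U L ω ∂P) := by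
  set N : ℕ → Ω → ℝ := fun i => P[U | 𝓖 i] with hN
  set bad : Set Ω := {ω | ∃ j ≤ n, R ≤ |(P[U | 𝓖 j]) ω| ∨ ε ≤ |incSum M N j ω|} with hbad
  have hNm : ∀ i, Measurable[𝓖 i] (N i) := fun i => stronglyMeasurable_condExp.measurable
  have hMm : ∀ i, Measurable[𝓖 i] (M i) := fun i => (hM.stronglyMeasurable i).measurable
  have hSm := measurable_incSum hMm hNm
  -- Exit occurs when `N` reaches `R` or the running sum reaches `ε` in absolute value. The event of
  -- no exit up to `n` is exactly the complement of `bad`.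
  set Q : ℕ → Set Ω := fun j => {ω | |N j ω| < R ∧ |incSum M N j ω| < ε} with hQ
  have hQm : ∀ i, MeasurableSet[𝓖 i] (Q i) := fun i =>
    (@measurableSet_lt _ _ _ _ _ (𝓖 i) _ _ _ _ _ (measurable_norm.comp (hNm i)) measurable_const).inter
      (@measurableSet_lt _ _ _ _ _ (𝓖 i) _ _ _ _ _ (measurable_norm.comp (hSm i)) measurable_const)
  have hbadm : MeasurableSet bad := by
    have : bad = ⋃ j ∈ Set.Iic n, ({ω | R ≤ |N j ω|} ∪ {ω | ε ≤ |incSum M N j ω|}) := by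
      ext ω; simp [hbad, hN]
    rw [this]
    exact MeasurableSet.biUnion (Set.to_countable _) fun j _ =>
      (measurableSet_le measurable_const (measurable_norm.comp ((hNm j).mono (𝓖.le j) le_rfl))).union
        (measurableSet_le measurable_const
          (measurable_norm.comp ((hSm j).mono (𝓖.le j) le_rfl)))
  have ha' : AEStronglyMeasurable a P := (ha.mono (𝓖.le 0)).aestronglyMeasurable
  have han : ∀ᵐ ω ∂P, ‖a ω‖ ≤ 1 := Filter.Eventually.of_forall ha1
  have hHm := fun i => stronglyMeasurable_alive hQm i
  -- the stopped sum
  set S' : Ω → ℝ := fun ω => ∑ i ∈ Finset.range n,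
    alive Q i ω * ((M (i + 1) ω - M i ω) * (N (i + 1) ω - N i ω)) with hS'
  set B : Ω → ℝ := fun ω => ∑ i ∈ Finset.range n, alive Q i ω * (M (i + 1) ω - M i ω) with hB
  have hΔ : ∀ᵐ ω ∂P, ∀ i, |M (i + 1) ω - M i ω| ≤ 2 * c := by
    filter_upwards [hMc] with ω h i
    have := abs_sub (M (i + 1) ω) (M i ω)
    linarith [h i, h (i + 1)]
  have hΔm : ∀ i, StronglyMeasurable[𝓖 (i + 1)] fun ω => M (i + 1) ω - M i ω := fun i =>
    (hM.stronglyMeasurable (i + 1)).sub ((hM.stronglyMeasurable i).mono (𝓖.mono (Nat.le_succ i)))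
  -- pointwise bound
  have hpt : ∀ᵐ ω ∂P, |S' ω| ≤ ε + D ω * ∑ i ∈ Finset.range n, exits Q i ω * (R + |N (i + 1) ω|) := by
    filter_upwards [hMD] with ω hω
    -- Two states: before the exit the stopped sum is `incSum`, hence below `ε`; after it the sum is
    -- frozen. The one transition adds a jump bounded by `D` times `R + |N|` at the exit time, which
    -- the exit weight selects.
    have : ∀ m ≤ n, ((∀ j ≤ m, ω ∈ Q j) ∧ ∑ i ∈ Finset.range m,
        alive Q i ω * ((M (i + 1) ω - M i ω) * (N (i + 1) ω - N i ω)) = incSum M N m ω) ∨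
        ((¬ ∀ j ≤ m, ω ∈ Q j) ∧ |∑ i ∈ Finset.range m,
        alive Q i ω * ((M (i + 1) ω - M i ω) * (N (i + 1) ω - N i ω))| ≤
          ε + D ω * ∑ i ∈ Finset.range m, exits Q i ω * (R + |N (i + 1) ω|)) := by
      intro m
      induction m with
      | zero =>
        intro _
        by_cases h : ∀ j ≤ 0, ω ∈ Q j
        · exact Or.inl ⟨h, by simp [incSum]⟩
        · exact Or.inr ⟨h, by simpa using hε⟩
      | succ m ih =>
        intro hm
        rcases ih (by omega) with ⟨h1, h2⟩ | ⟨h1, h2⟩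
        · by_cases h : ∀ j ≤ m + 1, ω ∈ Q j
          · refine Or.inl ⟨h, ?_⟩
            rw [Finset.sum_range_succ, h2, alive_eq_one Q h1, incSum_succ, one_mul]
          · refine Or.inr ⟨h, ?_⟩
            rw [Finset.sum_range_succ, h2, alive_eq_one Q h1, one_mul, Finset.sum_range_succ]
            have e1 : exits Q m ω = 1 := by
              rw [exits, alive_eq_one Q h1, alive_eq_zero Q h, sub_zero]
            have e2 := (h1 m le_rfl)
            have e3 : 0 ≤ ∑ i ∈ Finset.range m, exits Q i ω * (R + |N (i + 1) ω|) :=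
              Finset.sum_nonneg fun i _ => mul_nonneg (exits_nonneg Q i ω) (by positivity)
            have e4 : |N (m + 1) ω - N m ω| ≤ R + |N (m + 1) ω| := by
              have := abs_sub (N (m + 1) ω) (N m ω)
              linarith [e2.1.le]
            have e5 : |(M (m + 1) ω - M m ω) * (N (m + 1) ω - N m ω)| ≤
                D ω * (R + |N (m + 1) ω|) := by
              rw [abs_mul]
              exact mul_le_mul (hω m (by omega)) e4 (abs_nonneg _) (hD0 ω)
            have e6 := abs_add_le (incSum M N m ω) ((M (m + 1) ω - M m ω) * (N (m + 1) ω - N m ω))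
            have e7 := mul_nonneg (hD0 ω) e3
            rw [e1, one_mul, mul_add]
            linarith [e2.2.le]
        · have h3 : ¬ ∀ j ≤ m + 1, ω ∈ Q j := fun h => h1 fun j hj => h j (by omega)
          refine Or.inr ⟨h3, ?_⟩
          rw [Finset.sum_range_succ, alive_eq_zero Q h1, zero_mul, add_zero, Finset.sum_range_succ,
            exits, alive_eq_zero Q h1, alive_eq_zero Q h3, sub_zero, zero_mul, add_zero]
          exact h2
    rcases this n le_rfl with ⟨h1, h2⟩ | ⟨_, h2⟩
    · rw [hS']
      simp only
      rw [h2]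
      have e3 : 0 ≤ ∑ i ∈ Finset.range n, exits Q i ω * (R + |N (i + 1) ω|) :=
        Finset.sum_nonneg fun i _ => mul_nonneg (exits_nonneg Q i ω) (by positivity)
      have e7 := mul_nonneg (hD0 ω) e3
      linarith [(h1 n le_rfl).2.le]
    · exact h2
  -- `B` telescopes to `M k - M 0` with `k` the exit time capped at `n`, so it differs from `M n - M
  -- 0` only on `bad`, and there by at most `2 * c`.
  have hptB : ∀ᵐ ω ∂P, |(M n ω - M 0 ω) - B ω| ≤ 2 * c * bad.indicator 1 ω := by
    filter_upwards [hMc] with ω hω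
    have : ∀ m, (∀ j ≤ m, ω ∈ Q j) ∧ ∑ i ∈ Finset.range m, alive Q i ω * (M (i + 1) ω - M i ω)
          = M m ω - M 0 ω ∨ ((¬ ∀ j ≤ m, ω ∈ Q j) ∧ ∃ k,
        ∑ i ∈ Finset.range m, alive Q i ω * (M (i + 1) ω - M i ω) = M k ω - M 0 ω) := by
      intro m
      induction m with
      | zero =>
        by_cases h : ∀ j ≤ 0, ω ∈ Q j
        · exact Or.inl ⟨h, by simp⟩
        · exact Or.inr ⟨h, 0, by simp⟩
      | succ m ih =>
        rcases ih with ⟨h1, h2⟩ | ⟨h1, k, h2⟩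
        · have e : ∑ i ∈ Finset.range (m + 1), alive Q i ω * (M (i + 1) ω - M i ω)
              = M (m + 1) ω - M 0 ω := by
            rw [Finset.sum_range_succ, h2, alive_eq_one Q h1]; ring
          by_cases h : ∀ j ≤ m + 1, ω ∈ Q j
          · exact Or.inl ⟨h, e⟩
          · exact Or.inr ⟨h, m + 1, e⟩
        · refine Or.inr ⟨fun h => h1 fun j hj => h j (by omega), k, ?_⟩
          rw [Finset.sum_range_succ, alive_eq_zero Q h1, h2]; ring
    rcases this n with ⟨_, h2⟩ | ⟨h1, k, h2⟩
    · rw [hB]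
      simp only
      rw [h2, sub_self, abs_zero]
      exact mul_nonneg (by linarith) (Set.indicator_nonneg (fun _ _ => zero_le_one) _)
    · have hmem : ω ∈ bad := by
        by_contra hb
        refine h1 fun j hj => ?_
        simp only [hbad, Set.mem_ofPred_eq, not_exists, not_and, not_or, not_le] at hb
        exact hb j hj
      rw [Set.indicator_of_mem hmem, hB]
      simp only
      rw [h2]
      have := abs_sub (M n ω) (M k ω)
      have e : M n ω - M 0 ω - (M k ω - M 0 ω) = M n ω - M k ω := by ring
      rw [e, Pi.one_apply]
      linarith [hω n, hω k]
  -- the identity of expectations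
  have hΔN : ∀ i, Integrable (fun ω => N (i + 1) ω - N i ω) P := fun i =>
    integrable_condExp.sub integrable_condExp
  have hw : ∀ i, StronglyMeasurable[𝓖 i] fun ω => a ω * alive Q i ω := fun i =>
    (ha.mono (𝓖.mono (Nat.zero_le i))).mul (hHm i)
  have hw1 : ∀ i ω, ‖a ω * alive Q i ω‖ ≤ 1 := fun i ω => by
    rw [norm_mul]
    exact mul_le_one₀ (ha1 ω) (norm_nonneg _) (norm_alive_le_one Q i ω)
  have hwΔ : ∀ i, StronglyMeasurable[𝓖 (i + 1)]
      fun ω => a ω * alive Q i ω * (M (i + 1) ω - M i ω) := fun i =>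
    ((hw i).mono (𝓖.mono (Nat.le_succ i))).mul (hΔm i)
  have hwΔ1 : ∀ i, ∀ᵐ ω ∂P, ‖a ω * alive Q i ω * (M (i + 1) ω - M i ω)‖ ≤ 2 * c := fun i => by
    filter_upwards [hΔ] with ω h
    rw [norm_mul]
    calc _ ≤ 1 * (2 * c) := mul_le_mul (hw1 i ω) (h i) (abs_nonneg _) zero_le_one
      _ = _ := one_mul _
  -- Conditioning on `𝓖 (i + 1)` turns `N (i + 1)` into `U`. The term with `N i` has mean zero
  -- because `a * alive * N i` is known at time `i` and bounded by `R`: this is why the exit region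
  -- bounds `N`.
  have hterm : ∀ i, ∫ ω, a ω * alive Q i ω * (M (i + 1) ω - M i ω) * (N (i + 1) ω - N i ω) ∂P
      = ∫ ω, a ω * alive Q i ω * (M (i + 1) ω - M i ω) * U ω ∂P := by
    intro i
    have hb := fun j => (integrable_condExp (m := 𝓖 j) (μ := P) (f := U)).bdd_mul
      ((hwΔ i).mono (𝓖.le _)).aestronglyMeasurable (hwΔ1 i)
    simp_rw [mul_sub _ (N (i + 1) _) (N i _)]
    rw [integral_sub (hb (i + 1)) (hb i)]
    have h1 := integral_mul_condExp_of_bound (P := P) (𝓖.le (i + 1)) (hwΔ i) hU (2 * c) (hwΔ1 i)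
    have h2 : ∫ ω, a ω * alive Q i ω * (M (i + 1) ω - M i ω) * N i ω ∂P = 0 := by
      have := integral_mul_increment_eq_zero (P := P) hM (i := i)
        (w := fun ω => a ω * alive Q i ω * N i ω) (K := R)
        ((hw i).mul stronglyMeasurable_condExp) (Filter.Eventually.of_forall fun ω => ?_)
      · rw [← this]
        exact integral_congr_ae (Filter.Eventually.of_forall fun ω => by ring)
      · by_cases h : ∀ j ≤ i, ω ∈ Q j
        · rw [norm_mul]
          calc _ ≤ 1 * R := mul_le_mul (hw1 i ω) (h i le_rfl).1.le (abs_nonneg _) zero_le_one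
            _ = R := one_mul _
        · rw [alive_eq_zero Q h]; simpa using hR
    rw [h2, sub_zero]
    exact h1
  have hi1 : ∀ i, Integrable
      (fun ω => a ω * alive Q i ω * (M (i + 1) ω - M i ω) * (N (i + 1) ω - N i ω)) P := fun i =>
    (hΔN i).bdd_mul ((hwΔ i).mono (𝓖.le _)).aestronglyMeasurable (hwΔ1 i)
  have hi2 : ∀ i, Integrable (fun ω => a ω * alive Q i ω * (M (i + 1) ω - M i ω) * U ω) P :=
    fun i => hU.bdd_mul ((hwΔ i).mono (𝓖.le _)).aestronglyMeasurable (hwΔ1 i)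
  have eS : (fun ω => a ω * S' ω) = fun ω => ∑ i ∈ Finset.range n,
      a ω * alive Q i ω * (M (i + 1) ω - M i ω) * (N (i + 1) ω - N i ω) := by
    funext ω
    rw [hS', Finset.mul_sum]
    exact Finset.sum_congr rfl fun i _ => by ring
  have eB : (fun ω => a ω * (U ω * B ω)) = fun ω => ∑ i ∈ Finset.range n,
      a ω * alive Q i ω * (M (i + 1) ω - M i ω) * U ω := by
    funext ω
    rw [hB, Finset.mul_sum, Finset.mul_sum]
    exact Finset.sum_congr rfl fun i _ => by ring
  have hid : ∫ ω, a ω * S' ω ∂P = ∫ ω, a ω * (U ω * B ω) ∂P := by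
    rw [eS, eB, integral_finsetSum _ fun i _ => hi1 i, integral_finsetSum _ fun i _ => hi2 i]
    exact Finset.sum_congr rfl fun i _ => hterm i
  have hBi : Integrable (fun ω => a ω * (U ω * B ω)) P := by
    rw [eB]; exact integrable_finsetSum _ fun i _ => hi2 i
  have hMi : Integrable (fun ω => a ω * (U ω * (M n ω - M 0 ω))) P := by
    have : Integrable (fun ω => (M n ω - M 0 ω) * U ω) P := by
      refine hU.bdd_mul (c := 2 * c)
        ((hM.integrable n).aestronglyMeasurable.sub (hM.integrable 0).aestronglyMeasurable) ?_
      filter_upwards [hMc] with ω h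
      have := abs_sub (M n ω) (M 0 ω)
      rw [Real.norm_eq_abs]
      linarith [h n, h 0]
    simp_rw [mul_comm (U _)]
    exact this.bdd_mul ha' han
  obtain ⟨hoi, hol⟩ := integral_overshoot_le (P := P) hQm hU n hD hD0 hDc hR hL
  have hEi := integrable_excess (P := P) hU L
  have b1 : |∫ ω, a ω * S' ω ∂P| ≤
      ε + ((R + L) * ∫ ω, D ω ∂P + 2 * c * ∫ ω, excess U L ω ∂P) := by
    calc |∫ ω, a ω * S' ω ∂P| ≤ ∫ ω, |a ω * S' ω| ∂P := abs_integral_le_integral_abs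
      _ ≤ ∫ ω, (ε + D ω * ∑ i ∈ Finset.range n, exits Q i ω * (R + |N (i + 1) ω|)) ∂P := by
        refine integral_mono_of_nonneg (Filter.Eventually.of_forall fun _ => abs_nonneg _)
          ((integrable_const ε).add hoi) ?_
        filter_upwards [hpt] with ω h
        rw [abs_mul]
        calc _ ≤ 1 * |S' ω| := mul_le_mul_of_nonneg_right (ha1 ω) (abs_nonneg _)
          _ ≤ _ := by rw [one_mul]; exact h
      _ ≤ _ := by
        rw [integral_add (integrable_const ε) hoi, integral_const]
        simp only [probReal_univ, one_smul]
        linarith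
  have b2 : |∫ ω, a ω * (U ω * (M n ω - M 0 ω)) ∂P - ∫ ω, a ω * (U ω * B ω) ∂P| ≤
      2 * c * (L * P.real bad + ∫ ω, excess U L ω ∂P) := by
    rw [← integral_sub hMi hBi]
    have hbi : Integrable (bad.indicator (1 : Ω → ℝ)) P :=
      (integrable_const (1 : ℝ)).indicator hbadm
    calc _ ≤ ∫ ω, |a ω * (U ω * (M n ω - M 0 ω)) - a ω * (U ω * B ω)| ∂P :=
          abs_integral_le_integral_abs
      _ ≤ ∫ ω, 2 * c * (L * bad.indicator 1 ω + excess U L ω) ∂P := by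
        refine integral_mono_of_nonneg (Filter.Eventually.of_forall fun _ => abs_nonneg _)
          (((hbi.const_mul L).add hEi).const_mul _) ?_
        filter_upwards [hptB] with ω h
        have e : a ω * (U ω * (M n ω - M 0 ω)) - a ω * (U ω * B ω)
            = a ω * (U ω * (M n ω - M 0 ω - B ω)) := by ring
        rw [e, abs_mul, abs_mul]
        have k1 : |U ω| * |M n ω - M 0 ω - B ω| ≤ 2 * c * (L * bad.indicator 1 ω + excess U L ω) := by
          by_cases hb : ω ∈ bad
          · rw [Set.indicator_of_mem hb, Pi.one_apply] at h ⊢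
            rw [mul_one] at h ⊢
            rw [mul_comm]
            exact mul_le_mul h (abs_le_add_excess U L ω) (abs_nonneg _) (by linarith)
          · rw [Set.indicator_of_notMem hb] at h ⊢
            have : |M n ω - M 0 ω - B ω| = 0 := le_antisymm (by linarith) (abs_nonneg _)
            rw [this, mul_zero, mul_zero, zero_add]
            exact mul_nonneg (by linarith) (excess_nonneg U L ω)
        calc _ ≤ 1 * (|U ω| * |M n ω - M 0 ω - B ω|) :=
              mul_le_mul_of_nonneg_right (ha1 ω) (by positivity)
          _ ≤ _ := by rw [one_mul]; exact k1
      _ = _ := by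
        rw [integral_const_mul, integral_add (hbi.const_mul L) hEi, integral_const_mul,
          integral_indicator_one hbadm]
  have b3 := abs_add_le (∫ ω, a ω * (U ω * (M n ω - M 0 ω)) ∂P - ∫ ω, a ω * (U ω * B ω) ∂P)
    (∫ ω, a ω * (U ω * B ω) ∂P)
  rw [sub_add_cancel, ← hid] at b3
  rw [← hid] at b2
  linarith

end Discrete

/-! ### Discrete time: maximal inequality and stopped quadratic variation. -/

section Discrete

variable {Ω : Type*} {mΩ : MeasurableSpace Ω} {P : Measure Ω} {𝓖 : Filtration ℕ mΩ}

/-- Weak type maximal inequality for closed martingales. -/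
lemma measureReal_exists_le_abs_condExp_le [IsProbabilityMeasure P] (𝓖 : Filtration ℕ mΩ)
    (V : Ω → ℝ) (n : ℕ) {R : ℝ} (hR : 0 < R) :
    P.real {ω | ∃ j ≤ n, R ≤ |(P[V | 𝓖 j]) ω|} ≤ (∫ ω, |V ω| ∂P) / R := by
  lift R to NNReal using hR.le
  have hm := martingale_condExp V 𝓖 P
  have hs : Submartingale (fun i ω => |(P[V | 𝓖 i]) ω|) 𝓖 P :=
    hm.submartingale.sup hm.neg.submartingale
  have h := maximal_ineq hs (fun i ω => abs_nonneg _) (ε := R) n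
  set A : Set Ω := {ω | (R : ℝ) ≤ (Finset.range (n + 1)).sup'
    Finset.nonempty_range_add_one fun k => |(P[V | 𝓖 k]) ω|} with hA
  have e : {ω | ∃ j ≤ n, (R : ℝ) ≤ |(P[V | 𝓖 j]) ω|} = A := by
    ext ω
    simp only [hA, Set.mem_ofPred_eq, Finset.le_sup'_iff, Finset.mem_range, Nat.lt_succ_iff]
  rw [e, le_div_iff₀ hR, mul_comm]
  have h1 : ∫ ω in A, |(P[V | 𝓖 n]) ω| ∂P ≤ ∫ ω, |V ω| ∂P :=
    (setIntegral_le_integral integrable_condExp.abs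
      (Filter.Eventually.of_forall fun _ => abs_nonneg _)).trans (integral_abs_condExp_le V)
  have h2 := ENNReal.toReal_mono ENNReal.ofReal_ne_top (h.trans (ENNReal.ofReal_le_ofReal h1))
  rw [ENNReal.toReal_ofReal (integral_nonneg fun _ => abs_nonneg _), ENNReal.toReal_mul] at h2
  exact h2

/-- Sums of compensated bounded variables are orthogonal. -/
lemma integral_sq_sum_compensated_le [IsProbabilityMeasure P] {b : ℕ → Ω → ℝ} {K : ℝ}
    (hb : ∀ i, StronglyMeasurable[𝓖 (i + 1)] (b i)) (hK : ∀ i, ∀ᵐ ω ∂P, |b i ω| ≤ K) (n : ℕ) :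
    Integrable (fun ω => (∑ i ∈ Finset.range n, (b i ω - (P[b i | 𝓖 i]) ω)) ^ 2) P ∧
    ∫ ω, (∑ i ∈ Finset.range n, (b i ω - (P[b i | 𝓖 i]) ω)) ^ 2 ∂P ≤
      ∑ i ∈ Finset.range n, ∫ ω, b i ω ^ 2 ∂P := by
  have hbi : ∀ i, Integrable (b i) P := fun i =>
    (integrable_const K).mono' ((hb i).mono (𝓖.le _)).aestronglyMeasurable (hK i)
  have hg : ∀ i, ∀ᵐ ω ∂P, |(P[b i | 𝓖 i]) ω| ≤ K := fun i => by
    exact ae_bdd_abs_condExp_of_ae_bdd_abs (hK i)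
  set B : ℕ → Ω → ℝ := fun n ω => ∑ i ∈ Finset.range n, (b i ω - (P[b i | 𝓖 i]) ω) with hB
  have hBm : ∀ n, StronglyMeasurable[𝓖 n] (B n) := fun n =>
    Finset.stronglyMeasurable_fun_sum _ fun i hi => by
      have hi : i + 1 ≤ n := Finset.mem_range.1 hi
      exact ((hb i).mono (𝓖.mono hi)).sub
        (stronglyMeasurable_condExp.mono (𝓖.mono ((Nat.le_succ i).trans hi)))
  have hBb : ∀ n : ℕ, ∀ᵐ ω ∂P, ‖B n ω‖ ≤ n * (2 * K) := fun n => by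
    filter_upwards [ae_all_iff.2 hK, ae_all_iff.2 hg] with ω h1 h2
    calc ‖B n ω‖ ≤ ∑ i ∈ Finset.range n, ‖b i ω - (P[b i | 𝓖 i]) ω‖ := norm_sum_le _ _
      _ ≤ ∑ i ∈ Finset.range n, 2 * K := Finset.sum_le_sum fun i _ => by
          have := abs_sub (b i ω) ((P[b i | 𝓖 i]) ω)
          rw [Real.norm_eq_abs]
          linarith [h1 i, h2 i]
      _ = n * (2 * K) := by simp
  have hBm' := fun n => ((hBm n).mono (𝓖.le n)).aestronglyMeasurable (μ := P)
  have hBi : ∀ n, Integrable (B n) P := fun n =>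
    (integrable_const _).mono' (hBm' n) (hBb n)
  induction n with
  | zero => simp
  | succ n ih =>
    obtain ⟨ih1, ih2⟩ := ih
    have hgm := ((stronglyMeasurable_condExp (f := b n) (m := 𝓖 n) (μ := P)).mono
      (𝓖.le n)).aestronglyMeasurable (μ := P)
    have i1 : Integrable (fun ω => B n ω * b n ω) P := (hbi n).bdd_mul (hBm' n) (hBb n)
    have i2 : Integrable (fun ω => B n ω * (P[b n | 𝓖 n]) ω) P :=
      integrable_condExp.bdd_mul (hBm' n) (hBb n)
    have i3 : Integrable (fun ω => b n ω * b n ω) P :=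
      (hbi n).bdd_mul (hbi n).aestronglyMeasurable (hK n)
    have i4 : Integrable (fun ω => (P[b n | 𝓖 n]) ω * b n ω) P := (hbi n).bdd_mul hgm (hg n)
    have i5 : Integrable (fun ω => (P[b n | 𝓖 n]) ω * (P[b n | 𝓖 n]) ω) P :=
      integrable_condExp.bdd_mul hgm (hg n)
    -- With `g = E[b n | 𝓖 n]`, the first identity kills the cross term with `B n`, and the second
    -- reduces `E[(b n - g)²]` to `E[(b n)²] - E[g²]`.
    have e1 := integral_mul_condExp_of_bound (P := P) (𝓖.le n) (hBm n) (hbi n) _ (hBb n)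
    have e2 := integral_mul_condExp_of_bound (P := P) (𝓖.le n)
      stronglyMeasurable_condExp (hbi n) _ (hg n)
    have e : (fun ω => (∑ i ∈ Finset.range (n + 1), (b i ω - (P[b i | 𝓖 i]) ω)) ^ 2) = fun ω =>
        B n ω ^ 2 + ((2 * (B n ω * b n ω) - 2 * (B n ω * (P[b n | 𝓖 n]) ω)) +
          ((b n ω * b n ω - 2 * ((P[b n | 𝓖 n]) ω * b n ω)) +
            (P[b n | 𝓖 n]) ω * (P[b n | 𝓖 n]) ω)) := by
      funext ω
      rw [Finset.sum_range_succ]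
      change (B n ω + _) ^ 2 = _
      ring
    have j1 : Integrable (fun ω => 2 * (B n ω * b n ω) - 2 * (B n ω * (P[b n | 𝓖 n]) ω)) P :=
      (i1.const_mul 2).sub (i2.const_mul 2)
    have j0 : Integrable (fun ω => b n ω * b n ω - 2 * ((P[b n | 𝓖 n]) ω * b n ω)) P :=
      i3.sub (i4.const_mul 2)
    have j2 : Integrable (fun ω => (b n ω * b n ω - 2 * ((P[b n | 𝓖 n]) ω * b n ω)) +
        (P[b n | 𝓖 n]) ω * (P[b n | 𝓖 n]) ω) P := j0.add i5
    have j3 : Integrable (fun ω => (2 * (B n ω * b n ω) - 2 * (B n ω * (P[b n | 𝓖 n]) ω)) +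
        ((b n ω * b n ω - 2 * ((P[b n | 𝓖 n]) ω * b n ω)) +
          (P[b n | 𝓖 n]) ω * (P[b n | 𝓖 n]) ω)) P := j1.add j2
    change Integrable (fun ω => B n ω ^ 2) P at ih1
    rw [e]
    refine ⟨ih1.add j3, ?_⟩
    rw [integral_add ih1 j3, integral_add j1 j2,
      integral_sub (i1.const_mul 2) (i2.const_mul 2), integral_add j0 i5,
      integral_sub i3 (i4.const_mul 2), integral_const_mul, integral_const_mul,
      integral_const_mul, e1, ← e2, Finset.sum_range_succ]
    have e3 : 0 ≤ ∫ ω, (P[b n | 𝓖 n]) ω * (P[b n | 𝓖 n]) ω ∂P :=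
      integral_nonneg fun _ => mul_self_nonneg _
    have e4 : ∫ ω, b n ω ^ 2 ∂P = ∫ ω, b n ω * b n ω ∂P :=
      integral_congr_ae (Filter.Eventually.of_forall fun ω => sq _)
    rw [e4]
    change ∫ ω, B n ω ^ 2 ∂P ≤ _ at ih2
    linarith

/-- `E[w ΔM ΔN] = E[w ΔM U] - E[w N_i ΔM]`: the first term vanishes by orthogonality, after
conditioning on the later σ-algebra, and the second because `w N_i` is bounded and known at time
`i`. It makes the weighted products martingale differences. -/
lemma integral_mul_increments_eq_zero [IsProbabilityMeasure P] {M : ℕ → Ω → ℝ}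
    (hM : Martingale M 𝓖 P) {c : ℝ} (hMc : ∀ᵐ ω ∂P, ∀ i, |M i ω| ≤ c) {U : Ω → ℝ}
    (hU : Integrable U P) {i : ℕ} {w : Ω → ℝ} (hw : StronglyMeasurable[𝓖 i] w)
    (hw1 : ∀ ω, ‖w ω‖ ≤ 1)
    (hort : ∫ ω, w ω * (U ω * (M (i + 1) ω - M i ω)) ∂P = 0) {R : ℝ}
    (hR : ∀ ω, ‖w ω * (P[U | 𝓖 i]) ω‖ ≤ R) :
    Integrable (fun ω => w ω * ((M (i + 1) ω - M i ω) *
      ((P[U | 𝓖 (i + 1)]) ω - (P[U | 𝓖 i]) ω))) P ∧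
    ∫ ω, w ω * ((M (i + 1) ω - M i ω) * ((P[U | 𝓖 (i + 1)]) ω - (P[U | 𝓖 i]) ω)) ∂P = 0 := by
  have hΔm : StronglyMeasurable[𝓖 (i + 1)] fun ω => M (i + 1) ω - M i ω :=
    (hM.stronglyMeasurable (i + 1)).sub ((hM.stronglyMeasurable i).mono (𝓖.mono (Nat.le_succ i)))
  have hwΔ : StronglyMeasurable[𝓖 (i + 1)] fun ω => w ω * (M (i + 1) ω - M i ω) :=
    (hw.mono (𝓖.mono (Nat.le_succ i))).mul hΔm
  have hwΔ1 : ∀ᵐ ω ∂P, ‖w ω * (M (i + 1) ω - M i ω)‖ ≤ 2 * c := by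
    filter_upwards [hMc] with ω h
    have h1 : |M (i + 1) ω - M i ω| ≤ 2 * c := by
      have := abs_sub (M (i + 1) ω) (M i ω)
      linarith [h i, h (i + 1)]
    rw [norm_mul]
    calc _ ≤ 1 * (2 * c) := mul_le_mul (hw1 ω) h1 (abs_nonneg _) zero_le_one
      _ = _ := one_mul _
  have hb := fun j => (integrable_condExp (m := 𝓖 j) (μ := P) (f := U)).bdd_mul
    (hwΔ.mono (𝓖.le _)).aestronglyMeasurable hwΔ1
  have e : (fun ω => w ω * ((M (i + 1) ω - M i ω) *
      ((P[U | 𝓖 (i + 1)]) ω - (P[U | 𝓖 i]) ω))) = fun ω =>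
      w ω * (M (i + 1) ω - M i ω) * (P[U | 𝓖 (i + 1)]) ω -
        w ω * (M (i + 1) ω - M i ω) * (P[U | 𝓖 i]) ω := by
    funext ω; ring
  rw [e]
  refine ⟨(hb (i + 1)).sub (hb i), ?_⟩
  rw [integral_sub (hb (i + 1)) (hb i)]
  have h1 := integral_mul_condExp_of_bound (P := P) (𝓖.le (i + 1)) hwΔ hU (2 * c) hwΔ1
  have h2 := integral_mul_increment_eq_zero (P := P) hM (i := i)
    (w := fun ω => w ω * (P[U | 𝓖 i]) ω) (K := R)
    (hw.mul stronglyMeasurable_condExp) (Filter.Eventually.of_forall hR)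
  have h3 : ∫ ω, w ω * (M (i + 1) ω - M i ω) * U ω ∂P = 0 := by
    rw [← hort]
    exact integral_congr_ae (Filter.Eventually.of_forall fun ω => by ring)
  have h4 : ∫ ω, w ω * (M (i + 1) ω - M i ω) * (P[U | 𝓖 i]) ω ∂P = 0 := by
    rw [← h2]
    exact integral_congr_ae (Filter.Eventually.of_forall fun ω => by ring)
  rw [h1, h3, h4, sub_zero]

/-- The quadratic variation of a closed martingale, stopped before it exceeds `R`. -/
lemma integral_sum_alive_sq_le [IsProbabilityMeasure P] {Q : ℕ → Set Ω}
    (hQ : ∀ i, MeasurableSet[𝓖 i] (Q i)) {U : Ω → ℝ} (hU : Integrable U P) {R : ℝ} (hR : 0 ≤ R)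
    (hQR : ∀ i, ∀ ω ∈ Q i, |(P[U | 𝓖 i]) ω| ≤ R) (n : ℕ) :
    Integrable (fun ω => ∑ i ∈ Finset.range n,
      alive Q (i + 1) ω * ((P[U | 𝓖 (i + 1)]) ω - (P[U | 𝓖 i]) ω) ^ 2) P ∧
    ∫ ω, ∑ i ∈ Finset.range n,
      alive Q (i + 1) ω * ((P[U | 𝓖 (i + 1)]) ω - (P[U | 𝓖 i]) ω) ^ 2 ∂P
      ≤ 4 * R ^ 2 + 2 * R * ∫ ω, excess U 0 ω ∂P := by
  set N : ℕ → Ω → ℝ := fun i => P[U | 𝓖 i] with hN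
  have hHm := fun i => stronglyMeasurable_alive hQ i
  have hNm : ∀ i, StronglyMeasurable[𝓖 i] (N i) := fun i => stronglyMeasurable_condExp
  have hHN : ∀ i ω, ‖alive Q i ω * N i ω‖ ≤ R := fun i ω => by
    by_cases h : ∀ j ≤ i, ω ∈ Q j
    · rw [alive_eq_one Q h, one_mul]
      exact hQR i ω (h i le_rfl)
    · rw [alive_eq_zero Q h]; simpa using hR
  -- Overshoot bound with `D = 1` and `L = 0`. A finite bound suffices here; no smallness is
  -- required.
  obtain ⟨ho1, ho2⟩ := integral_overshoot_le (P := P) hQ hU n (D := fun _ => 1)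
    aestronglyMeasurable_const (fun _ => zero_le_one)
    (Filter.Eventually.of_forall fun _ => le_refl (1 : ℝ)) hR le_rfl
  simp only [one_mul, add_zero, integral_const, probReal_univ, smul_eq_mul, mul_one] at ho1 ho2
  set O : Ω → ℝ := fun ω => ∑ i ∈ Finset.range n, exits Q i ω * (R + |N (i + 1) ω|) with hO
  set Z : Ω → ℝ := fun ω => ∑ i ∈ Finset.range n,
    alive Q i ω * N i ω * (N (i + 1) ω - N i ω) with hZ
  have hmN : Martingale N 𝓖 P := martingale_condExp U 𝓖 P
  have hZt : ∀ i, Integrable (fun ω => alive Q i ω * N i ω * (N (i + 1) ω - N i ω)) P := fun i =>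
    ((hmN.integrable (i + 1)).sub (hmN.integrable i)).bdd_mul
      (((hHm i).mul (hNm i)).mono (𝓖.le i)).aestronglyMeasurable
      (Filter.Eventually.of_forall (hHN i))
  have hZi : Integrable Z P := integrable_finsetSum _ fun i _ => hZt i
  have hZ0 : ∫ ω, Z ω ∂P = 0 := by
    rw [integral_finsetSum _ fun i _ => hZt i]
    exact Finset.sum_eq_zero fun i _ => integral_mul_increment_eq_zero hmN
      ((hHm i).mul (hNm i)) (Filter.Eventually.of_forall (hHN i))
  have hpt : ∀ ω, ∑ i ∈ Finset.range n, alive Q (i + 1) ω * (N (i + 1) ω - N i ω) ^ 2 ≤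
      2 * R ^ 2 + 2 * R * O ω - 2 * Z ω := by
    intro ω
    have hJN : ∀ i, exits Q i ω * |N i ω| ≤ exits Q i ω * R := fun i => by
      by_cases h : ∀ j ≤ i, ω ∈ Q j
      · exact mul_le_mul_of_nonneg_left (hQR i ω (h i le_rfl)) (exits_nonneg Q i ω)
      · have h' : ¬ ∀ j ≤ i + 1, ω ∈ Q j := fun h' => h fun j hj => h' j (by omega)
        rw [exits, alive_eq_zero Q h, alive_eq_zero Q h']; simp
    -- Expand `(N' - N)² = N'² - N² - 2 N (N' - N)` and write `alive (i + 1) = alive i - exits i`.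
    -- The squares telescope, the products weighted by `alive i` sum to `Z`, and the exit terms are
    -- bounded by `R` since `|N i| ≤ R` still holds just before the exit. The weight `alive (i + 1)`
    -- leaves out the exit jump, whose square need not be integrable.
    have hterm : ∀ i, alive Q (i + 1) ω * (N (i + 1) ω - N i ω) ^ 2 ≤
        (alive Q (i + 1) ω * N (i + 1) ω ^ 2 - alive Q i ω * N i ω ^ 2) + exits Q i ω * R ^ 2
          + 2 * R * (exits Q i ω * (R + |N (i + 1) ω|))
          - 2 * (alive Q i ω * N i ω * (N (i + 1) ω - N i ω)) := by
      intro i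
      have hJ0 := exits_nonneg Q i ω
      have e1 : exits Q i ω * N i ω ^ 2 ≤ exits Q i ω * R ^ 2 := by
        have h1 := mul_le_mul_of_nonneg_right (hJN i) (abs_nonneg (N i ω))
        have h2 := mul_le_mul_of_nonneg_right (hJN i) hR
        rw [← sq_abs]
        nlinarith
      have e2 : exits Q i ω * (N i ω * (N (i + 1) ω - N i ω)) ≤
          R * (exits Q i ω * (R + |N (i + 1) ω|)) := by
        have h0 : N i ω * (N (i + 1) ω - N i ω) ≤ |N i ω| * (|N (i + 1) ω| + |N i ω|) := by
          refine (le_abs_self _).trans ?_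
          rw [abs_mul]
          exact mul_le_mul_of_nonneg_left (abs_sub _ _) (abs_nonneg _)
        have h1 := mul_le_mul_of_nonneg_left h0 hJ0
        have h2 := mul_le_mul_of_nonneg_right (hJN i)
          (add_nonneg (abs_nonneg (N (i + 1) ω)) (abs_nonneg (N i ω)))
        have h3 := mul_le_mul_of_nonneg_right (hJN i) hR
        nlinarith
      have e3 : alive Q (i + 1) ω = alive Q i ω - exits Q i ω := by rw [exits]; ring
      rw [e3]
      nlinarith
    calc _ ≤ _ := Finset.sum_le_sum fun i _ => hterm i
      _ ≤ _ := by
        rw [Finset.sum_sub_distrib, Finset.sum_add_distrib, Finset.sum_add_distrib,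
          Finset.sum_range_sub (fun i => alive Q i ω * N i ω ^ 2), ← Finset.sum_mul,
          ← Finset.mul_sum, ← Finset.mul_sum]
        have h1 : alive Q n ω * N n ω ^ 2 ≤ R ^ 2 := by
          by_cases h : ∀ j ≤ n, ω ∈ Q j
          · rw [alive_eq_one Q h, one_mul, ← sq_abs]
            exact pow_le_pow_left₀ (abs_nonneg _) (hQR n ω (h n le_rfl)) 2
          · rw [alive_eq_zero Q h, zero_mul]; positivity
        have h2 : 0 ≤ alive Q 0 ω * N 0 ω ^ 2 := mul_nonneg (alive_nonneg Q 0 ω) (sq_nonneg _)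
        have h3 := mul_le_mul_of_nonneg_right (sum_exits_le_one Q n ω) (sq_nonneg R)
        simp only [hO, hZ]
        linarith
  have hr1 : Integrable (fun ω => 2 * R ^ 2 + 2 * R * O ω) P :=
    (integrable_const _).add (ho1.const_mul _)
  have hri : Integrable (fun ω => 2 * R ^ 2 + 2 * R * O ω - 2 * Z ω) P := hr1.sub (hZi.const_mul 2)
  have hnn : ∀ ω, 0 ≤ ∑ i ∈ Finset.range n, alive Q (i + 1) ω * (N (i + 1) ω - N i ω) ^ 2 := fun ω =>
    Finset.sum_nonneg fun i _ => mul_nonneg (alive_nonneg Q _ ω) (sq_nonneg _)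
  refine ⟨hri.mono' ?_ (Filter.Eventually.of_forall fun ω => ?_), ?_⟩
  · refine (Finset.stronglyMeasurable_fun_sum _ fun i _ => ?_).aestronglyMeasurable
    exact ((hHm (i + 1)).mono (𝓖.le _)).mul
      ((((hNm (i + 1)).mono (𝓖.le _)).sub ((hNm i).mono (𝓖.le _))).pow 2)
  · rw [Real.norm_of_nonneg (hnn ω)]
    exact hpt ω
  · calc _ ≤ ∫ ω, (2 * R ^ 2 + 2 * R * O ω - 2 * Z ω) ∂P :=
          integral_mono_of_nonneg (Filter.Eventually.of_forall hnn) hri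
            (Filter.Eventually.of_forall hpt)
      _ ≤ _ := by
        rw [integral_sub hr1 (hZi.const_mul 2), integral_add (integrable_const _)
          (ho1.const_mul _), integral_const_mul _ O, integral_const_mul _ Z, hZ0, integral_const,
          probReal_univ, one_smul]
        have := mul_le_mul_of_nonneg_left ho2 (show (0 : ℝ) ≤ 2 * R by linarith)
        linarith

end Discrete

/-! ### Discrete time: orthogonality implies small sums of products. -/

section Discrete

variable {Ω : Type*} {mΩ : MeasurableSpace Ω} {P : Measure Ω} {𝓖 : Filtration ℕ mΩ}

/-- If `U` is orthogonal to the increments of a bounded martingale `M`, the sums of products of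
increments of `M` and `E[U | 𝓖]` are uniformly small with large probability when the increments of
`M` are small. -/
lemma measureReal_le_abs_incSum_le [IsProbabilityMeasure P] {M : ℕ → Ω → ℝ}
    (hM : Martingale M 𝓖 P) {c : ℝ} (hMc : ∀ᵐ ω ∂P, ∀ i, |M i ω| ≤ c) {U : Ω → ℝ}
    (hU : Integrable U P)
    (hort : ∀ i w, StronglyMeasurable[𝓖 i] w → (∀ ω, ‖w ω‖ ≤ 1) →
      ∫ ω, w ω * (U ω * (M (i + 1) ω - M i ω)) ∂P = 0)
    (n : ℕ) {D : Ω → ℝ} (hD : AEStronglyMeasurable D P) (hD0 : ∀ ω, 0 ≤ D ω)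
    (hDc : ∀ᵐ ω ∂P, D ω ≤ 2 * c)
    (hMD : ∀ᵐ ω ∂P, ∀ i < n, |M (i + 1) ω - M i ω| ≤ D ω) {ε R L η : ℝ} (hε : 0 < ε)
    (hR : 1 ≤ R) (hL : 0 ≤ L) (hη : 0 < η) :
    P.real {ω | ∃ j ≤ n, ε ≤ |incSum M (fun i => P[U | 𝓖 i]) j ω|} ≤
      P.real {ω | ∃ j ≤ n, R ≤ |(P[U | 𝓖 j]) ω|} + P.real {ω | η ≤ D ω} +
      (η * (4 * R ^ 2 + 2 * R * ∫ ω, excess U 0 ω ∂P + 1) +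
        2 * ((R + L) * ∫ ω, D ω ∂P + 2 * c * ∫ ω, excess U L ω ∂P)) / ε := by
  have hR0 : 0 ≤ R := zero_le_one.trans hR
  set N : ℕ → Ω → ℝ := fun i => P[U | 𝓖 i] with hN
  have hNm : ∀ i, StronglyMeasurable[𝓖 i] (N i) := fun i => stronglyMeasurable_condExp
  have hMm := fun i => hM.stronglyMeasurable i
  -- The increment into time `j` is known at time `j`. For `j = 0` the truncated subtraction gives
  -- `M 0 - M 0 = 0`, so only the bound on `N` is tested there.
  set Q : ℕ → Set Ω := fun j => {ω | |N j ω| < R ∧ |M j ω - M (j - 1) ω| < η} with hQ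
  have hQm : ∀ i, MeasurableSet[𝓖 i] (Q i) := fun i =>
    (@measurableSet_lt _ _ _ _ _ (𝓖 i) _ _ _ _ _ (measurable_norm.comp (hNm i).measurable)
      measurable_const).inter
      (@measurableSet_lt _ _ _ _ _ (𝓖 i) _ _ _ _ _ (measurable_norm.comp
        ((hMm i).measurable.sub ((hMm (i - 1)).mono (𝓖.mono (Nat.sub_le i 1))).measurable))
        measurable_const)
  have hQR : ∀ i, ∀ ω ∈ Q i, |(P[U | 𝓖 i]) ω| ≤ R := fun i ω h => h.1.le
  have hHm := fun i => stronglyMeasurable_alive hQm i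
  have hΔ : ∀ᵐ ω ∂P, ∀ i, |M (i + 1) ω - M i ω| ≤ 2 * c := by
    filter_upwards [hMc] with ω h i
    have := abs_sub (M (i + 1) ω) (M i ω)
    linarith [h i, h (i + 1)]
  have hΔm : ∀ i, StronglyMeasurable[𝓖 (i + 1)] fun ω => M (i + 1) ω - M i ω := fun i =>
    (hMm (i + 1)).sub ((hMm i).mono (𝓖.mono (Nat.le_succ i)))
  have hΔNm : ∀ i, StronglyMeasurable[𝓖 (i + 1)] fun ω => N (i + 1) ω - N i ω := fun i =>
    (hNm (i + 1)).sub ((hNm i).mono (𝓖.mono (Nat.le_succ i)))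
  have hΔN : ∀ i, Integrable (fun ω => N (i + 1) ω - N i ω) P := fun i =>
    integrable_condExp.sub integrable_condExp
  -- the stopped sum is a martingale
  set t : ℕ → Ω → ℝ := fun i ω =>
    alive Q i ω * ((M (i + 1) ω - M i ω) * (N (i + 1) ω - N i ω)) with ht
  have htm : ∀ i, StronglyMeasurable[𝓖 (i + 1)] (t i) := fun i =>
    ((hHm i).mono (𝓖.mono (Nat.le_succ i))).mul ((hΔm i).mul (hΔNm i))
  have hHN : ∀ i ω, ‖alive Q i ω * N i ω‖ ≤ R := fun i ω => by
    by_cases h : ∀ j ≤ i, ω ∈ Q j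
    · rw [alive_eq_one Q h, one_mul]
      exact hQR i ω (h i le_rfl)
    · rw [alive_eq_zero Q h]; simpa using hR0
  -- Orthogonality is applied with the test variable `w * alive Q i`; indicators `w` then show that
  -- the `t i` are martingale differences.
  have hw0 : ∀ i w, StronglyMeasurable[𝓖 i] w → (∀ ω, ‖w ω‖ ≤ 1) →
      Integrable (fun ω => w ω * t i ω) P ∧ ∫ ω, w ω * t i ω ∂P = 0 := by
    intro i w hw hw1
    have hwa1 : ∀ ω, ‖w ω * alive Q i ω‖ ≤ 1 := fun ω => by
      rw [norm_mul]
      exact mul_le_one₀ (hw1 ω) (norm_nonneg _) (norm_alive_le_one Q i ω)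
    have := integral_mul_increments_eq_zero (P := P) hM hMc hU (i := i)
      (w := fun ω => w ω * alive Q i ω) (hw.mul (hHm i)) hwa1
      (hort i _ (hw.mul (hHm i)) hwa1) (R := R) fun ω => by
        rw [mul_assoc, norm_mul]
        calc _ ≤ 1 * R := mul_le_mul (hw1 ω) (hHN i ω) (norm_nonneg _) zero_le_one
          _ = R := one_mul R
    simpa only [ht, mul_assoc] using this
  have hti : ∀ i, Integrable (t i) P := fun i => by
    have := (hw0 i (fun _ => 1) stronglyMeasurable_const (fun _ => by simp)).1
    simpa using this
  have hts : ∀ i s, MeasurableSet[𝓖 i] s → ∫ ω in s, t i ω ∂P = 0 := fun i s hs => by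
    have := (hw0 i (s.indicator 1) (stronglyMeasurable_one.indicator hs) (fun ω => by
      by_cases h : ω ∈ s <;> simp [h])).2
    rw [← this, ← integral_indicator (𝓖.le i _ hs)]
    refine integral_congr_ae (Filter.Eventually.of_forall fun ω => ?_)
    by_cases h : ω ∈ s <;> simp [h]
  set S' : ℕ → Ω → ℝ := fun j ω => ∑ i ∈ Finset.range j, t i ω with hS'
  have hSi : ∀ j, Integrable (S' j) P := fun j => integrable_finsetSum _ fun i _ => hti i
  have hmS : Martingale S' 𝓖 P := by
    refine martingale_of_setIntegral_eq_succ (fun j => ?_) hSi fun j s hs => ?_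
    · exact Finset.stronglyMeasurable_fun_sum _ fun i hi =>
        (htm i).mono (𝓖.mono (Finset.mem_range.1 hi))
    · simp_rw [hS', Finset.sum_range_succ]
      rw [integral_add (hSi j).integrableOn (hti j).integrableOn, hts j s hs, add_zero]
  -- splitting off the last jump
  set b : ℕ → Ω → ℝ := fun i ω =>
    alive Q (i + 1) ω * ((M (i + 1) ω - M i ω) * (N (i + 1) ω - N i ω)) with hb
  set l : ℕ → Ω → ℝ := fun i ω =>
    exits Q i ω * ((M (i + 1) ω - M i ω) * (N (i + 1) ω - N i ω)) with hl
  have hbm : ∀ i, StronglyMeasurable[𝓖 (i + 1)] (b i) := fun i =>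
    (hHm (i + 1)).mul ((hΔm i).mul (hΔNm i))
  have htbl : ∀ i, l i = t i - b i := fun i => by
    funext ω; simp only [ht, hb, hl, exits, Pi.sub_apply]; ring
  have hbη : ∀ i ω, |b i ω| ≤ η * (alive Q (i + 1) ω * |N (i + 1) ω - N i ω|) := fun i ω => by
    by_cases h : ∀ j ≤ i + 1, ω ∈ Q j
    · simp only [hb]
      rw [alive_eq_one Q h, one_mul, one_mul, abs_mul]
      exact mul_le_mul_of_nonneg_right (h (i + 1) le_rfl).2.le (abs_nonneg _)
    · simp only [hb]
      rw [alive_eq_zero Q h]; simp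
  have hbK : ∀ i, ∀ᵐ ω ∂P, |b i ω| ≤ η * (2 * R) := fun i => by
    refine Filter.Eventually.of_forall fun ω => (hbη i ω).trans
      (mul_le_mul_of_nonneg_left ?_ hη.le)
    by_cases h : ∀ j ≤ i + 1, ω ∈ Q j
    · rw [alive_eq_one Q h, one_mul]
      have := abs_sub (N (i + 1) ω) (N i ω)
      linarith [(h (i + 1) le_rfl).1, (h i (Nat.le_succ i)).1]
    · rw [alive_eq_zero Q h]; simpa using hR0
  have hbi : ∀ i, Integrable (b i) P := fun i =>
    (integrable_const _).mono' ((hbm i).mono (𝓖.le _)).aestronglyMeasurable (hbK i)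
  have hli : ∀ i, Integrable (l i) P := fun i => by rw [htbl i]; exact (hti i).sub (hbi i)
  -- `t i = b i + l i` has zero conditional expectation, so the compensators of `b` and `l` cancel.
  -- The stopped sum is therefore the compensated sum of `b`, treated in `L²`, plus the compensated
  -- sum of the exit jumps `l`, treated in `L¹`.
  have hlb : ∀ i, P[l i | 𝓖 i] =ᵐ[P] -P[b i | 𝓖 i] := fun i => by
    rw [htbl i]
    have h0 : (0 : Ω → ℝ) =ᵐ[P] P[t i | 𝓖 i] :=
      ae_eq_condExp_of_forall_setIntegral_eq (𝓖.le i) (hti i)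
        (fun s _ _ => integrableOn_zero)
        (fun s hs _ => by rw [hts i s hs]; simp)
        stronglyMeasurable_zero.aestronglyMeasurable
    filter_upwards [condExp_sub (hti i) (hbi i) (𝓖 i), h0] with ω h1 h2
    rw [h1, Pi.sub_apply, ← h2]
    simp
  obtain ⟨hsq, hsq'⟩ := integral_sq_sum_compensated_le (P := P) hbm hbK n
  obtain ⟨hq1, hq2⟩ := integral_sum_alive_sq_le (P := P) hQm hU hR0 hQR n
  obtain ⟨ho1, ho2⟩ := integral_overshoot_le (P := P) hQm hU n hD hD0 hDc hR0 hL
  set κ : ℝ := 4 * R ^ 2 + 2 * R * ∫ ω, excess U 0 ω ∂P with hκ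
  set O : Ω → ℝ := fun ω => D ω * ∑ i ∈ Finset.range n, exits Q i ω * (R + |N (i + 1) ω|) with hO
  set B : Ω → ℝ := fun ω => ∑ i ∈ Finset.range n, (b i ω - (P[b i | 𝓖 i]) ω) with hB
  have hb2 : ∑ i ∈ Finset.range n, ∫ ω, b i ω ^ 2 ∂P ≤ η ^ 2 * κ := by
    have hi2 : ∀ i, Integrable (fun ω => b i ω ^ 2) P := fun i => by
      simp_rw [sq]
      exact (hbi i).bdd_mul (hbi i).aestronglyMeasurable (hbK i)
    rw [← integral_finsetSum _ fun i _ => hi2 i]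
    calc _ ≤ ∫ ω, η ^ 2 * ∑ i ∈ Finset.range n,
            alive Q (i + 1) ω * (N (i + 1) ω - N i ω) ^ 2 ∂P := by
          refine integral_mono (integrable_finsetSum _ fun i _ => hi2 i) (hq1.const_mul _)
            fun ω => ?_
          simp only
          rw [Finset.mul_sum]
          refine Finset.sum_le_sum fun i _ => ?_
          by_cases h : ∀ j ≤ i + 1, ω ∈ Q j
          · have := pow_le_pow_left₀ (abs_nonneg _) (hbη i ω) 2
            rw [sq_abs] at this
            refine this.trans ?_
            rw [alive_eq_one Q h, one_mul, one_mul, mul_pow, sq_abs]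
          · simp only [hb]
            rw [alive_eq_zero Q h]; simp
      _ ≤ η ^ 2 * κ := by
          rw [integral_const_mul]
          exact mul_le_mul_of_nonneg_left hq2 (sq_nonneg η)
  have hBi : Integrable B P := integrable_finsetSum _ fun i _ => (hbi i).sub integrable_condExp
  have hBabs : ∫ ω, |B ω| ∂P ≤ η * (κ + 1) := by
    -- The arithmetic-geometric inequality with weight `η` turns the `L²` bound `η² κ` into an `L¹`
    -- bound of order `η`.
    have h1 : ∀ ω, |B ω| ≤ (B ω ^ 2 / η + η) / 2 := fun ω => by
      have e : (B ω ^ 2 / η + η) / 2 - |B ω| = (|B ω| - η) ^ 2 / (2 * η) := by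
        rw [← sq_abs (B ω)]
        field_simp
        ring
      have : 0 ≤ (|B ω| - η) ^ 2 / (2 * η) := by positivity
      linarith
    have hri : Integrable (fun ω => (B ω ^ 2 / η + η) / 2) P :=
      ((hsq.div_const η).add (integrable_const η)).div_const 2
    have h2 := integral_mono hBi.abs hri h1
    rw [integral_div, integral_add (hsq.div_const η) (integrable_const η), integral_div,
      integral_const, probReal_univ, one_smul] at h2
    have h3 : (∫ ω, B ω ^ 2 ∂P) / η ≤ η * κ := by
      rw [div_le_iff₀ hη]
      calc _ ≤ _ := hsq'.trans hb2
        _ = _ := by ring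
    have h4 : 0 ≤ κ := by
      have := integral_excess_nonneg (P := P) U 0
      positivity
    have h5 := mul_nonneg hη.le h4
    have h6 : (∫ a, (∑ i ∈ Finset.range n, (b i a - (P[b i | 𝓖 i]) a)) ^ 2 ∂P) / η ≤ η * κ := h3
    linarith
  have hlO : ∑ i ∈ Finset.range n, ∫ ω, |l i ω| ∂P ≤ ∫ ω, O ω ∂P := by
    rw [← integral_finsetSum _ fun i _ => (hli i).abs]
    refine integral_mono_ae (integrable_finsetSum _ fun i _ => (hli i).abs) ho1 ?_
    filter_upwards [hMD] with ω h
    simp only [hO]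
    rw [Finset.mul_sum]
    refine Finset.sum_le_sum fun i hi => ?_
    simp only [hl]
    rw [abs_mul, abs_mul, abs_of_nonneg (exits_nonneg Q i ω)]
    by_cases hal : ∀ j ≤ i, ω ∈ Q j
    · have h1 : |N (i + 1) ω - N i ω| ≤ R + |N (i + 1) ω| := by
        have := abs_sub (N (i + 1) ω) (N i ω)
        linarith [(hal i le_rfl).1]
      have h2 := mul_le_mul (h i (Finset.mem_range.1 hi)) h1 (abs_nonneg _) (hD0 ω)
      calc _ ≤ _ := mul_le_mul_of_nonneg_left h2 (exits_nonneg Q i ω)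
        _ = _ := by ring
    · have h' : ¬ ∀ j ≤ i + 1, ω ∈ Q j := fun h' => hal fun j hj => h' j (by omega)
      rw [exits, alive_eq_zero Q hal, alive_eq_zero Q h']; simp
  -- The factor `2` pays for the compensator of `l`, whose `L¹` norm is at most that of `l`.
  have hSabs : ∫ ω, |S' n ω| ∂P ≤ η * (κ + 1) +
      2 * ((R + L) * ∫ ω, D ω ∂P + 2 * c * ∫ ω, excess U L ω ∂P) := by
    have hpt : ∀ᵐ ω ∂P, |S' n ω| ≤ |B ω| +
        ∑ i ∈ Finset.range n, (|l i ω| + |(P[l i | 𝓖 i]) ω|) := by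
      filter_upwards [ae_all_iff.2 hlb] with ω h
      have e : S' n ω = B ω + ∑ i ∈ Finset.range n, (l i ω - (P[l i | 𝓖 i]) ω) := by
        simp only [hS', hB]
        rw [← Finset.sum_add_distrib]
        refine Finset.sum_congr rfl fun i _ => ?_
        rw [h i, htbl i, Pi.sub_apply, Pi.neg_apply]
        ring
      rw [e]
      refine (abs_add_le _ _).trans (add_le_add_right ((Finset.abs_sum_le_sum_abs _ _).trans
        (Finset.sum_le_sum fun i _ => abs_sub _ _)) _)
    have hi : Integrable (fun ω => ∑ i ∈ Finset.range n, (|l i ω| + |(P[l i | 𝓖 i]) ω|)) P :=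
      integrable_finsetSum _ fun i _ => (hli i).abs.add integrable_condExp.abs
    have hi' : ∀ i ∈ Finset.range n, Integrable (fun ω => |l i ω| + |(P[l i | 𝓖 i]) ω|) P :=
      fun i _ => (hli i).abs.add integrable_condExp.abs
    have h1 := integral_mono_ae (hSi n).abs (hBi.abs.add hi) hpt
    simp only [Pi.add_apply] at h1
    rw [integral_add hBi.abs hi, integral_finsetSum _ hi'] at h1
    have h2 : ∑ i ∈ Finset.range n, ∫ ω, (|l i ω| + |(P[l i | 𝓖 i]) ω|) ∂P ≤
        ∑ i ∈ Finset.range n, 2 * ∫ ω, |l i ω| ∂P := Finset.sum_le_sum fun i _ => by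
      rw [integral_add (hli i).abs integrable_condExp.abs]
      linarith [integral_abs_condExp_le (m := 𝓖 i) (μ := P) (l i)]
    rw [← Finset.mul_sum] at h2
    linarith
  -- conclusion
  have hSm : P.real {ω | ∃ j ≤ n, ε ≤ |(P[S' n | 𝓖 j]) ω|} ≤ (∫ ω, |S' n ω| ∂P) / ε :=
    measureReal_exists_le_abs_condExp_le 𝓖 (S' n) n hε
  -- If `N` stays below `R` and `D < η`, no exit occurs up to `n`, so the stopped sum agrees with
  -- `incSum` at every index; the maximal inequality applies to it as a closed martingale.
  have hsub : ({ω | ∃ j ≤ n, ε ≤ |incSum M N j ω|} : Set Ω) ≤ᵐ[P]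
      (({ω | ∃ j ≤ n, R ≤ |N j ω|} ∪ {ω | η ≤ D ω}) ∪
        {ω | ∃ j ≤ n, ε ≤ |(P[S' n | 𝓖 j]) ω|} : Set Ω) := by
    have hall : ∀ᵐ ω ∂P, ∀ j ∈ Set.Iic n, (P[S' n | 𝓖 j]) ω = S' j ω :=
      (ae_ball_iff (Set.to_countable _)).2 fun j hj => hmS.condExp_ae_eq hj
    filter_upwards [hall, hMD] with ω h1 h2
    rintro ⟨j, hj, h3⟩
    by_contra hcon
    have hcon' : ¬ (((∃ j ≤ n, R ≤ |N j ω|) ∨ η ≤ D ω) ∨ ∃ j ≤ n, ε ≤ |(P[S' n | 𝓖 j]) ω|) := hcon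
    push Not at hcon'
    obtain ⟨⟨k1, k2⟩, k3⟩ := hcon'
    have hal : ∀ m ≤ n, ω ∈ Q m := fun m hm => by
      refine ⟨k1 m hm, ?_⟩
      rcases m with _ | m
      · simpa using hη
      · exact (h2 m (by omega)).trans_lt k2
    have e : S' j ω = incSum M N j ω := Finset.sum_congr rfl fun i hi => by
      have : i < j := Finset.mem_range.1 hi
      simp only [ht]
      rw [alive_eq_one Q fun m hm => hal m (by omega), one_mul]
    have := k3 j hj
    rw [h1 j hj, e] at this
    linarith
  have h1 : P.real {ω | ∃ j ≤ n, ε ≤ |incSum M N j ω|} ≤ _ :=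
    ENNReal.toReal_mono (measure_ne_top P _) (measure_mono_ae hsub)
  have h2 := measureReal_union_le (μ := P) ({ω | ∃ j ≤ n, R ≤ |N j ω|} ∪ {ω | η ≤ D ω})
    {ω | ∃ j ≤ n, ε ≤ |(P[S' n | 𝓖 j]) ω|}
  have h3 := measureReal_union_le (μ := P) {ω | ∃ j ≤ n, R ≤ |N j ω|} {ω | η ≤ D ω}
  have h4 := div_le_div_of_nonneg_right hSabs hε.le
  have h5 : (P (({ω | ∃ j ≤ n, R ≤ |N j ω|} ∪ {ω | η ≤ D ω}) ∪
    {ω | ∃ j ≤ n, ε ≤ |(P[S' n | 𝓖 j]) ω|})).toReal = P.real _ := rfl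
  rw [h5] at h1
  linarith

end Discrete

/-! ### Partitions of `[0,T]` and increments along them. -/

section Partitions

variable {Ω : Type*} {mΩ : MeasurableSpace Ω} {P : Measure Ω} {T : ℝ}

/-- The filtration sampled along a sequence of times. -/
def sampled (ℱ : Filtration (Time T) mΩ) {π : ℕ → Time T} (hπ : Monotone π) : Filtration ℕ mΩ where
  seq i := ℱ (π i)
  mono' _ _ h := ℱ.mono (hπ h)
  le' i := ℱ.le (π i)

lemma martingale_sampled {ℱ : Filtration (Time T) mΩ} {M : Time T → Ω → ℝ}
    (hM : Martingale M ℱ P) {π : ℕ → Time T} (hπ : Monotone π) :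
    Martingale (fun i => M (π i)) (sampled ℱ hπ) P :=
  ⟨fun i => hM.stronglyMeasurable (π i), fun _ _ h => hM.condExp_ae_eq (hπ h)⟩

/-- The largest increment of `M` along a partition. -/
def maxInc (M : Time T → Ω → ℝ) (π : ℕ → Time T) (n : ℕ) (ω : Ω) : ℝ :=
  -- Taken in `NNReal`, the supremum over the empty range is `0`.
  ((Finset.range n).sup fun i => ‖M (π (i + 1)) ω - M (π i) ω‖₊ : NNReal)

lemma maxInc_nonneg (M : Time T → Ω → ℝ) (π : ℕ → Time T) (n : ℕ) (ω : Ω) :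
    0 ≤ maxInc M π n ω := NNReal.coe_nonneg _

lemma abs_le_maxInc (M : Time T → Ω → ℝ) (π : ℕ → Time T) {n i : ℕ} (hi : i < n) (ω : Ω) :
    |M (π (i + 1)) ω - M (π i) ω| ≤ maxInc M π n ω := by
  have := Finset.le_sup (f := fun i => ‖M (π (i + 1)) ω - M (π i) ω‖₊) (Finset.mem_range.2 hi)
  exact NNReal.coe_le_coe.2 this

lemma maxInc_le {M : Time T → Ω → ℝ} {π : ℕ → Time T} {n : ℕ} {ω : Ω} {b : ℝ} (hb : 0 ≤ b)
    (h : ∀ i < n, |M (π (i + 1)) ω - M (π i) ω| ≤ b) : maxInc M π n ω ≤ b := by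
  lift b to NNReal using hb
  refine NNReal.coe_le_coe.2 (Finset.sup_le fun i hi => ?_)
  exact NNReal.coe_le_coe.1 (h i (Finset.mem_range.1 hi))

lemma aestronglyMeasurable_maxInc {M : Time T → Ω → ℝ} (hM : ∀ t, AEStronglyMeasurable (M t) P)
    (π : ℕ → Time T) (n : ℕ) : AEStronglyMeasurable (maxInc M π n) P := by
  have : AEMeasurable (fun ω => (Finset.range n).sup
      fun i => ‖M (π (i + 1)) ω - M (π i) ω‖₊) P := by
    induction n with
    | zero => simp
    | succ n ih =>
      simp only [Finset.range_add_one, Finset.sup_insert]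
      exact ((hM _).sub (hM _)).nnnorm.aemeasurable.sup ih
  exact this.coe_nnreal_real.aestronglyMeasurable

lemma maxInc_le_two_mul {M : Time T → Ω → ℝ} {c : ℝ} (hc0 : 0 ≤ c)
    (hMc : ∀ᵐ ω ∂P, ∀ t, |M t ω| ≤ c) (π : ℕ → Time T) (n : ℕ) :
    ∀ᵐ ω ∂P, maxInc M π n ω ≤ 2 * c := by
  filter_upwards [hMc] with ω h
  refine maxInc_le (by linarith) fun i _ => ?_
  have := abs_sub (M (π (i + 1)) ω) (M (π i) ω)
  linarith [h (π i), h (π (i + 1))]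

/-- Otherwise there are partitions of mesh below `1 / (k + 1)` with mean maximal increment above
`ε`. Paths are uniformly continuous on the compact interval, so these maximal increments tend to
`0`, dominated by `2 * c`: a contradiction. The resulting `δ` serves all partitions at once. -/
lemma exists_mesh_integral_maxInc_le [IsProbabilityMeasure P] {M : Time T → Ω → ℝ}
    (hM : ∀ t, AEStronglyMeasurable (M t) P) (hcont : ∀ᵐ ω ∂P, Continuous fun t => M t ω) {c : ℝ}
    (hc0 : 0 ≤ c) (hMc : ∀ᵐ ω ∂P, ∀ t, |M t ω| ≤ c) {ε : ℝ} (hε : 0 < ε) :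
    ∃ δ : ℝ, 0 < δ ∧ ∀ (n : ℕ) (π : ℕ → Time T), Monotone π →
      (∀ i < n, (π (i + 1) : ℝ) - π i < δ) → ∫ ω, maxInc M π n ω ∂P ≤ ε := by
  by_contra! hcon
  choose n π hmono hmesh hbig using fun k : ℕ => hcon (1 / ((k : ℝ) + 1)) (by positivity)
  have hlim : Filter.Tendsto (fun k => ∫ ω, maxInc M (π k) (n k) ω ∂P) Filter.atTop
      (nhds (∫ _, (0 : ℝ) ∂P)) := by
    refine tendsto_integral_of_dominated_convergence (fun _ => 2 * c)
      (fun k => aestronglyMeasurable_maxInc hM _ _) (integrable_const _) (fun k => ?_) ?_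
    · filter_upwards [maxInc_le_two_mul hc0 hMc (π k) (n k)] with ω h
      rwa [Real.norm_of_nonneg (maxInc_nonneg _ _ _ _)]
    · filter_upwards [hcont] with ω hω
      have huc := CompactSpace.uniformContinuous_of_continuous hω
      rw [Metric.uniformContinuous_iff] at huc
      rw [Metric.tendsto_atTop]
      intro e he
      obtain ⟨δ, hδ, hu⟩ := huc (e / 2) (by linarith)
      obtain ⟨K, hK⟩ := exists_nat_one_div_lt hδ
      refine ⟨K, fun k hk => ?_⟩
      rw [Real.dist_eq, sub_zero, abs_of_nonneg (maxInc_nonneg _ _ _ _)]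
      refine (maxInc_le (b := e / 2) (by linarith) fun i hi => ?_).trans_lt (by linarith)
      refine (hu ?_).le
      have h1 := hmesh k i hi
      have h2 : (π k i : ℝ) ≤ π k (i + 1) := hmono k (Nat.le_succ i)
      rw [Subtype.dist_eq, Real.dist_eq, abs_of_nonneg (by linarith)]
      have h3 : 1 / ((k : ℝ) + 1) ≤ 1 / ((K : ℝ) + 1) := by
        have : (K : ℝ) ≤ k := Nat.cast_le.2 hk
        gcongr
      linarith
  rw [integral_zero] at hlim
  exact absurd (le_of_tendsto_of_tendsto' tendsto_const_nhds hlim fun k => (hbig k).le)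
    (not_le.2 hε)

/-- Fine partitions of `[0,T]` containing two given times. -/
lemma exists_partition (hT : 0 < T) {s t : Time T} (hst : s ≤ t) {δ : ℝ} (hδ : 0 < δ) :
    ∃ (N : ℕ) (π : ℕ → Time T), Monotone π ∧ (π 0 : ℝ) = 0 ∧ π N = s ∧ π (N + N) = t ∧
      (π (N + N + N) : ℝ) = T ∧ ∀ i, (π (i + 1) : ℝ) - π i < δ := by
  obtain ⟨N, hN⟩ := exists_nat_gt (T / δ)
  have hN0 : (0 : ℝ) < N := (div_pos hT hδ).trans hN
  set e : ℝ → ℝ := fun x => max 0 (min 1 (x / N)) with he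
  have he0 : ∀ x, 0 ≤ e x := fun x => le_max_left _ _
  have he1 : ∀ x, e x ≤ 1 := fun x => max_le zero_le_one (min_le_left _ _)
  have hmono : Monotone e := fun x y h =>
    max_le_max le_rfl (min_le_min le_rfl (by gcongr))
  have hstep : ∀ x, e (x + 1) ≤ e x + 1 / N := fun x => by
    have h0 : (0 : ℝ) < 1 / N := by positivity
    refine max_le (by linarith [he0 x]) ?_
    have h1 : min 1 (x / N) ≤ e x := le_max_right _ _
    have h2 : min 1 ((x + 1) / N) ≤ min 1 (x / N) + 1 / N := by
      rw [add_div]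
      rcases le_total 1 (x / N) with h | h
      · rw [min_eq_left h]
        exact (min_le_left _ _).trans (by linarith)
      · rw [min_eq_right h]
        exact min_le_right _ _
    linarith
  have hneg : ∀ x ≤ 0, e x = 0 := fun x hx =>
    max_eq_left ((min_le_right _ _).trans (div_nonpos_of_nonpos_of_nonneg hx hN0.le))
  have hbig : ∀ x, (N : ℝ) ≤ x → e x = 1 := fun x hx => by
    have : 1 ≤ x / N := (one_le_div hN0).2 hx
    simp [he, min_eq_left this]
  have hs0 : (0 : ℝ) ≤ s := s.2.1
  have hst' : (s : ℝ) ≤ t := hst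
  have htT : (t : ℝ) ≤ T := t.2.2
  -- `e` ramps from `0` to `1` on `[0, N]`, and `p` concatenates three such ramps, `0 → s → t → T`,
  -- with `N` steps each. A step is at most `(s + (t - s) + (T - t)) / N = T / N`, also when some of
  -- the pieces are degenerate.
  set p : ℕ → ℝ := fun i => s * e i + (t - s) * e (i - N) + (T - t) * e (i - (N + N)) with hp
  have hpm : Monotone p := fun i j h => by
    have h' : (i : ℝ) ≤ j := Nat.cast_le.2 h
    have a1 := mul_le_mul_of_nonneg_left (hmono h') hs0
    have a2 := mul_le_mul_of_nonneg_left (hmono (sub_le_sub_right h' (N : ℝ)))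
      (sub_nonneg.2 hst')
    have a3 := mul_le_mul_of_nonneg_left (hmono (sub_le_sub_right h' ((N : ℝ) + N)))
      (sub_nonneg.2 htT)
    simp only [hp]
    linarith
  have hp0 : p 0 = 0 := by
    simp only [hp, Nat.cast_zero]
    rw [hneg 0 le_rfl, hneg (0 - N) (by linarith), hneg (0 - (N + N)) (by linarith)]
    ring
  have hpT : ∀ i, p i ≤ T := fun i => by
    have a1 := mul_le_mul_of_nonneg_left (he1 i) hs0
    have a2 := mul_le_mul_of_nonneg_left (he1 (i - N)) (sub_nonneg.2 hst')
    have a3 := mul_le_mul_of_nonneg_left (he1 (i - (N + N))) (sub_nonneg.2 htT)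
    simp only [hp]
    linarith
  refine ⟨N, fun i => ⟨p i, hp0 ▸ hpm (Nat.zero_le i), hpT i⟩, fun i j h => hpm h, hp0,
    Subtype.ext ?_, Subtype.ext ?_, ?_, fun i => ?_⟩
  · change s * e N + (t - s) * e (N - N) + (T - t) * e (N - (N + N)) = s
    rw [hbig N le_rfl, hneg (N - N) (by linarith), hneg (N - (N + N)) (by linarith)]
    ring
  · change s * e ((N + N : ℕ) : ℝ) + (t - s) * e ((N + N : ℕ) - N)
      + (T - t) * e ((N + N : ℕ) - (N + N)) = t
    push_cast
    rw [hbig (N + N) (by linarith), hbig (N + N - N) (by linarith),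
      hneg (N + N - (N + N)) (by linarith)]
    ring
  · change s * e ((N + N + N : ℕ) : ℝ) + (t - s) * e ((N + N + N : ℕ) - N)
      + (T - t) * e ((N + N + N : ℕ) - (N + N)) = T
    push_cast
    rw [hbig (N + N + N) (by linarith), hbig (N + N + N - N) (by linarith),
      hbig (N + N + N - (N + N)) (by linarith)]
    ring
  · change p (i + 1) - p i < δ
    have b1 := hstep i
    have b2 := hstep (i - N)
    have b3 := hstep (i - (N + N))
    have a1 := mul_le_mul_of_nonneg_left b1 hs0
    have a2 := mul_le_mul_of_nonneg_left b2 (sub_nonneg.2 hst')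
    have a3 := mul_le_mul_of_nonneg_left b3 (sub_nonneg.2 htT)
    have e1 : p (i + 1) = s * e (i + 1) + (t - s) * e (i - N + 1)
        + (T - t) * e (i - (N + N) + 1) := by
      simp only [hp]
      push_cast
      congr 3 <;> congr 1 <;> ring
    have h4 : T * (1 / N) < δ := by
      rw [div_lt_iff₀ hδ] at hN
      rw [mul_one_div, div_lt_iff₀ hN0]
      linarith
    rw [e1]
    simp only [hp]
    nlinarith

end Partitions

/-! ### Continuous time: vanishing covariation and orthogonality of `U`. -/

section Orthogonality

variable {Ω : Type*} {mΩ : MeasurableSpace Ω} {P : Measure Ω} {T : ℝ}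

lemma measureReal_le_of_measure_le {s : Set Ω} {ε : ℝ} (hε : 0 ≤ ε)
    (h : P s ≤ ENNReal.ofReal ε) : P.real s ≤ ε := by
  have := ENNReal.toReal_mono ENNReal.ofReal_ne_top h
  rwa [ENNReal.toReal_ofReal hε] at this

lemma measure_le_of_measureReal_le [IsFiniteMeasure P] {s : Set Ω} {ε : ℝ}
    (h : P.real s ≤ ε) : P s ≤ ENNReal.ofReal ε := by
  rw [← ofReal_measureReal]
  exact ENNReal.ofReal_le_ofReal h

lemma exists_integral_excess_le [IsProbabilityMeasure P] {U : Ω → ℝ} (hU : Integrable U P) {ε : ℝ}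
    (hε : 0 < ε) : ∃ L : ℝ, 0 ≤ L ∧ ∫ ω, excess U L ω ∂P ≤ ε := by
  obtain ⟨n, hn⟩ := ((tendsto_integral_excess hU).eventually (ge_mem_nhds hε)).exists
  exact ⟨n, Nat.cast_nonneg n, hn⟩

/-- Vanishing quadratic covariation of a bounded continuous martingale `M` with `E[U | ℱ]` makes
`U` orthogonal to the increments of `M`. -/
lemma integral_mul_increment_eq_zero_of_isQuadCovariation [IsProbabilityMeasure P]
    (hT : 0 < T) {ℱ : Filtration (Time T) mΩ} {M : Time T → Ω → ℝ} (hM : Martingale M ℱ P)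
    (hcont : ∀ᵐ ω ∂P, Continuous fun t => M t ω) {c : ℝ} (hc0 : 0 ≤ c)
    (hMc : ∀ᵐ ω ∂P, ∀ t, |M t ω| ≤ c) {U : Ω → ℝ} (hU : Integrable U P)
    (hQ : IsQuadCovariation P M (fun t => P[U | ℱ t]) (fun _ _ => 0))
    {s t : Time T} (hst : s ≤ t) {a : Ω → ℝ} (ha : StronglyMeasurable[ℱ s] a)
    (ha1 : ∀ ω, |a ω| ≤ 1) :
    ∫ ω, a ω * (U ω * (M t ω - M s ω)) ∂P = 0 := by
  suffices h : ∀ η : ℝ, 0 < η → |∫ ω, a ω * (U ω * (M t ω - M s ω)) ∂P| ≤ 7 * η by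
    refine abs_eq_zero.1 (le_antisymm (le_of_forall_pos_le_add fun η hη => ?_) (abs_nonneg _))
    have := h (η / 7) (by linarith)
    linarith
  intro η hη
  -- The constants are chosen in the order `L`, `R`, `ε`, mesh. `L` handles the excess of `U`, which
  -- enters with total factor `4 * c`; `κ = 2 * c * L` multiplies the probability of the bad event,
  -- at most `u / R + ε`, so `R` and `ε` are adapted to `κ`. The mesh handles `(R + L)` times the
  -- mean of the largest increment. The sum of the errors is at most `6 * η`.
  obtain ⟨L, hL, hEL⟩ := exists_integral_excess_le hU (ε := η / (4 * c + 1)) (by positivity)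
  set u : ℝ := ∫ ω, |U ω| ∂P with hu
  have hu0 : 0 ≤ u := integral_nonneg fun _ => abs_nonneg _
  set κ : ℝ := 2 * c * L with hκ
  have hκ0 : 0 ≤ κ := by positivity
  set R : ℝ := 1 + κ * u / η with hR
  have hR1 : 0 < R := by positivity
  set ε : ℝ := η / (κ + 1) with hε
  have hε0 : 0 < ε := by positivity
  obtain ⟨δ₁, hδ₁, hQ⟩ := hQ ε hε0
  obtain ⟨δ₂, hδ₂, hD⟩ := exists_mesh_integral_maxInc_le
    (fun t => (hM.integrable t).aestronglyMeasurable) hcont hc0 hMc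
    (ε := η / (R + L + 1)) (by positivity)
  -- The covariation hypothesis concerns partitions of all of `[0,T]`, so `[s,t]` is taken as the
  -- middle block of such a partition, and the discrete estimate is applied to the shifted sequence.
  obtain ⟨N, π, hπ, h0, hs, ht, hTT, hmesh⟩ := exists_partition hT hst (lt_min hδ₁ hδ₂)
  have hS := measureReal_le_of_measure_le hε0.le (hQ (N + N + N) π hπ h0 hTT fun i _ =>
    (hmesh i).trans_le (min_le_left _ _))
  have hπ' : Monotone fun i => π (N + i) := fun i j h => hπ (Nat.add_le_add_left h N)
  have hD := hD N (fun i => π (N + i)) hπ' fun i _ => (hmesh (N + i)).trans_le (min_le_right _ _)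
  have ha' : StronglyMeasurable[sampled ℱ hπ' 0] a := by
    change StronglyMeasurable[ℱ (π (N + 0))] a
    rw [add_zero, hs]
    exact ha
  have key := abs_integral_mul_increment_le (P := P) (martingale_sampled hM hπ') hc0
    (by filter_upwards [hMc] with ω h i using h _) hU ha' ha1 N
    (aestronglyMeasurable_maxInc (fun t => (hM.integrable t).aestronglyMeasurable)
      (fun i => π (N + i)) N) (maxInc_nonneg _ _ _)
    (maxInc_le_two_mul hc0 hMc _ _)
    (Filter.Eventually.of_forall fun ω i hi => abs_le_maxInc M (fun i => π (N + i)) hi ω)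
    (ε := 2 * ε) (R := R) (L := L) (by linarith) hR1.le hL
  simp only [add_zero, hs, ht] at key
  -- A sum over the block starting at `s` is a difference of two sums started at `0`. If it is at
  -- least `2 * ε`, one of these is at least `ε`; hence the doubled threshold.
  have hbad : P.real {ω | ∃ j ≤ N, R ≤ |(P[U | sampled ℱ hπ' j]) ω| ∨
      2 * ε ≤ |incSum (fun i => M (π (N + i))) (fun i => P[U | sampled ℱ hπ' i]) j ω|} ≤
      u / R + ε := by
    refine (measureReal_mono (s₂ := {ω | ∃ j ≤ N, R ≤ |(P[U | sampled ℱ hπ' j]) ω|} ∪ _) ?_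
      (measure_ne_top P _)).trans ((measureReal_union_le _ _).trans
      (add_le_add (measureReal_exists_le_abs_condExp_le (sampled ℱ hπ') U N hR1) hS))
    rintro ω ⟨j, hj, h1 | h2⟩
    · exact Or.inl ⟨j, hj, h1⟩
    · right
      set S : ℕ → ℝ := fun j => ∑ i ∈ Finset.range j, (M (π (i + 1)) ω - M (π i) ω) *
        ((P[U | ℱ (π (i + 1))]) ω - (P[U | ℱ (π i)]) ω) with hS
      have e : incSum (fun i => M (π (N + i))) (fun i => P[U | sampled ℱ hπ' i]) j ω
          = S (N + j) - S N := by
        simp only [hS, Finset.sum_range_add, add_sub_cancel_left]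
        rfl
      rw [e] at h2
      have h3 := abs_sub (S (N + j)) (S N)
      change ∃ j ≤ N + N + N, ε ≤ |S j - 0|
      by_cases h4 : ε ≤ |S N|
      · exact ⟨N, by omega, by rwa [sub_zero]⟩
      · refine ⟨N + j, by omega, ?_⟩
        rw [sub_zero]
        push Not at h4
        linarith
  refine key.trans ?_
  have b1 : (R + L) * ∫ ω, maxInc M (fun i => π (N + i)) N ω ∂P ≤ η := by
    have h1 := mul_le_mul_of_nonneg_left hD (show 0 ≤ R + L by linarith)
    refine h1.trans ?_
    rw [mul_div_assoc', div_le_iff₀ (by linarith)]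
    nlinarith
  have b2 : 4 * c * ∫ ω, excess U L ω ∂P ≤ η := by
    have h1 := mul_le_mul_of_nonneg_left hEL (show 0 ≤ 4 * c by linarith)
    refine h1.trans ?_
    rw [mul_div_assoc', div_le_iff₀ (by linarith)]
    nlinarith
  have b3 : κ * (u / R) ≤ η := by
    rw [mul_div_assoc', div_le_iff₀ hR1, hR, mul_add, mul_div_assoc', mul_div_cancel_left₀ _ hη.ne']
    linarith
  have b4 : κ * ε ≤ η := by
    rw [hε, mul_div_assoc', div_le_iff₀ (by linarith)]
    nlinarith
  have b5 : ε ≤ η := div_le_self hη.le (by linarith)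
  have b6 := mul_le_mul_of_nonneg_left hbad hκ0
  have b7 : 2 * c * (L * P.real {ω | ∃ j ≤ N, R ≤ |(P[U | sampled ℱ hπ' j]) ω| ∨
      2 * ε ≤ |incSum (fun i => M (π (N + i))) (fun i => P[U | sampled ℱ hπ' i]) j ω|}
      + ∫ ω, excess U L ω ∂P) = κ * P.real {ω | ∃ j ≤ N, R ≤ |(P[U | sampled ℱ hπ' j]) ω| ∨
      2 * ε ≤ |incSum (fun i => M (π (N + i))) (fun i => P[U | sampled ℱ hπ' i]) j ω|}
      + 2 * c * ∫ ω, excess U L ω ∂P := by rw [hκ]; ring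
  rw [b7]
  linarith

/-- Converse of `integral_mul_increment_eq_zero_of_isQuadCovariation`. -/
lemma isQuadCovariation_zero_of_integral_mul_increment_eq_zero [IsProbabilityMeasure P]
    {ℱ : Filtration (Time T) mΩ} {M : Time T → Ω → ℝ} (hM : Martingale M ℱ P)
    (hcont : ∀ᵐ ω ∂P, Continuous fun t => M t ω) {c : ℝ} (hc0 : 0 ≤ c)
    (hMc : ∀ᵐ ω ∂P, ∀ t, |M t ω| ≤ c) {U : Ω → ℝ} (hU : Integrable U P)
    (hort : ∀ s t, s ≤ t → ∀ a, StronglyMeasurable[ℱ s] a → (∀ ω, |a ω| ≤ 1) →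
      ∫ ω, a ω * (U ω * (M t ω - M s ω)) ∂P = 0) :
    IsQuadCovariation P M (fun t => P[U | ℱ t]) (fun _ _ => 0) := by
  intro ε hε
  set u : ℝ := ∫ ω, |U ω| ∂P with hu
  have hu0 : 0 ≤ u := integral_nonneg fun _ => abs_nonneg _
  set R : ℝ := 1 + 4 * u / ε with hR
  have hR1 : 1 ≤ R := by
    have : 0 ≤ 4 * u / ε := by positivity
    linarith
  obtain ⟨L, hL, hEL⟩ := exists_integral_excess_le hU (ε := ε ^ 2 / 8 / (4 * c + 1)) (by positivity)
  set κ : ℝ := 4 * R ^ 2 + 2 * R * ∫ ω, excess U 0 ω ∂P + 1 with hκ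
  have hκ0 : 0 < κ := by
    have := integral_excess_nonneg (P := P) U 0
    have : 0 ≤ R := by linarith
    positivity
  set η : ℝ := ε ^ 2 / 8 / κ with hη
  have hη0 : 0 < η := by positivity
  -- The first entry gives `P(D ≥ η) ≤ ε / 4` by Markov's inequality, the second controls the
  -- overshoot term. With `ε / 4` for `N` reaching `R` and `3 * (ε² / 8) / ε` for the rest, the
  -- total stays below `ε`.
  set ν : ℝ := min (η * ε / 4) (ε ^ 2 / 8 / (2 * (R + L) + 1)) with hν
  have hν0 : 0 < ν := lt_min (by positivity) (div_pos (by positivity) (by linarith))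
  obtain ⟨δ, hδ, hD⟩ := exists_mesh_integral_maxInc_le
    (fun t => (hM.integrable t).aestronglyMeasurable) hcont hc0 hMc hν0
  refine ⟨δ, hδ, fun n π hπ _ _ hmesh => measure_le_of_measureReal_le ?_⟩
  have hD := hD n π hπ hmesh
  have hDm := aestronglyMeasurable_maxInc (P := P)
    (fun t => (hM.integrable t).aestronglyMeasurable) π n
  have key := measureReal_le_abs_incSum_le (P := P) (martingale_sampled hM hπ)
    (by filter_upwards [hMc] with ω h i using h _) hU
    (fun i w hw hw1 => hort (π i) (π (i + 1)) (hπ (Nat.le_succ i)) w hw hw1) n hDm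
    (maxInc_nonneg _ _ _) (maxInc_le_two_mul hc0 hMc _ _)
    (Filter.Eventually.of_forall fun ω i hi => abs_le_maxInc M π hi ω)
    (ε := ε) (R := R) (L := L) (η := η) hε hR1 hL hη0
  have hset : {ω | ∃ j ≤ n, ε ≤ |(∑ i ∈ Finset.range j,
      (M (π (i + 1)) ω - M (π i) ω) * ((P[U | ℱ (π (i + 1))]) ω - (P[U | ℱ (π i)]) ω)) - 0|} =
      {ω | ∃ j ≤ n, ε ≤ |incSum (fun i => M (π i)) (fun i => P[U | sampled ℱ hπ i]) j ω|} := by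
    simp only [sub_zero]
    rfl
  rw [hset]
  refine key.trans ?_
  have b1 : P.real {ω | ∃ j ≤ n, R ≤ |(P[U | sampled ℱ hπ j]) ω|} ≤ ε / 4 := by
    refine (measureReal_exists_le_abs_condExp_le (sampled ℱ hπ) U n (by linarith)).trans ?_
    rw [div_le_iff₀ (by linarith), hR]
    have : ε / 4 * (1 + 4 * u / ε) = ε / 4 + u := by field_simp
    rw [this]
    linarith
  have hDi : Integrable (maxInc M π n) P := by
    refine (integrable_const (2 * c)).mono' hDm ?_
    filter_upwards [maxInc_le_two_mul hc0 hMc π n] with ω h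
    rwa [Real.norm_of_nonneg (maxInc_nonneg _ _ _ _)]
  have b2 : P.real {ω | η ≤ maxInc M π n ω} ≤ ε / 4 := by
    have h1 := mul_meas_ge_le_integral_of_nonneg
      (Filter.Eventually.of_forall (maxInc_nonneg M π n)) hDi η
    have h2 : η * P.real {ω | η ≤ maxInc M π n ω} ≤ η * (ε / 4) := by
      calc _ ≤ _ := h1
        _ ≤ ν := hD
        _ ≤ η * ε / 4 := min_le_left _ _
        _ = _ := by ring
    exact le_of_mul_le_mul_left h2 hη0
  have b3 : η * κ = ε ^ 2 / 8 := div_mul_cancel₀ _ hκ0.ne'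
  have b4 : 2 * (R + L) * ∫ ω, maxInc M π n ω ∂P ≤ ε ^ 2 / 8 := by
    have h1 := mul_le_mul_of_nonneg_left (hD.trans (min_le_right _ _))
      (show 0 ≤ 2 * (R + L) by linarith)
    refine h1.trans ?_
    rw [mul_div_assoc', div_le_iff₀ (by linarith)]
    nlinarith [sq_nonneg ε]
  have b5 : 4 * c * ∫ ω, excess U L ω ∂P ≤ ε ^ 2 / 8 := by
    have h1 := mul_le_mul_of_nonneg_left hEL (show 0 ≤ 4 * c by linarith)
    refine h1.trans ?_
    rw [mul_div_assoc', div_le_iff₀ (by linarith)]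
    nlinarith [sq_nonneg ε]
  have b6 : (η * κ + 2 * ((R + L) * ∫ ω, maxInc M π n ω ∂P + 2 * c * ∫ ω, excess U L ω ∂P)) / ε
      ≤ ε / 2 := by
    rw [div_le_iff₀ hε]
    nlinarith
  linarith

/-- Stopping preserves vanishing quadratic covariation with a closed martingale. -/
lemma IsQuadCovariation.stopped [IsProbabilityMeasure P] {ℱ : Filtration (Time T) mΩ}
    {M : Time T → Ω → ℝ} {U : Ω → ℝ}
    (hQ : IsQuadCovariation P M (fun t => P[U | ℱ t]) (fun _ _ => 0)) (τ : Ω → Time T)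
    (hMτ : ∀ t, AEStronglyMeasurable (fun ω => M (min t (τ ω)) ω) P)
    (hcont : ∀ᵐ ω ∂P, Continuous fun t => M (min t (τ ω)) ω) {c : ℝ} (hc0 : 0 ≤ c)
    (hMc : ∀ᵐ ω ∂P, ∀ t, |M (min t (τ ω)) ω| ≤ c) :
    IsQuadCovariation P (fun t ω => M (min t (τ ω)) ω) (fun t => P[U | ℱ t]) (fun _ _ => 0) := by
  intro ε hε
  set u : ℝ := ∫ ω, |U ω| ∂P with hu
  have hu0 : 0 ≤ u := integral_nonneg fun _ => abs_nonneg _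
  set R : ℝ := 1 + 3 * u / ε with hR
  have hR1 : 0 < R := by positivity
  set η : ℝ := ε / (4 * R) with hη
  have hη0 : 0 < η := by positivity
  obtain ⟨δ₁, hδ₁, hQ⟩ := hQ (ε / 3) (by positivity)
  obtain ⟨δ₂, hδ₂, hD⟩ := exists_mesh_integral_maxInc_le (M := fun t ω => M (min t (τ ω)) ω)
    hMτ hcont hc0 hMc (ε := η * ε / 3) (by positivity)
  refine ⟨min δ₁ δ₂, lt_min hδ₁ hδ₂, fun n π hπ h0 hn hmesh => measure_le_of_measureReal_le ?_⟩
  have hQ := measureReal_le_of_measure_le (by positivity) (hQ n π hπ h0 hn fun i hi =>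
    (hmesh i hi).trans_le (min_le_left _ _))
  have hD := hD n π hπ fun i hi => (hmesh i hi).trans_le (min_le_right _ _)
  have hDm := aestronglyMeasurable_maxInc (P := P) hMτ π n
  have hDi : Integrable (maxInc (fun t ω => M (min t (τ ω)) ω) π n) P := by
    refine (integrable_const (2 * c)).mono' hDm ?_
    filter_upwards [maxInc_le_two_mul (M := fun t ω => M (min t (τ ω)) ω) hc0 hMc π n] with ω h
    rwa [Real.norm_of_nonneg (maxInc_nonneg _ _ _ _)]
  have b1 : P.real {ω | ∃ j ≤ n, R ≤ |(P[U | sampled ℱ hπ j]) ω|} ≤ ε / 3 := by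
    refine (measureReal_exists_le_abs_condExp_le (sampled ℱ hπ) U n hR1).trans ?_
    rw [div_le_iff₀ hR1, hR]
    have : ε / 3 * (1 + 3 * u / ε) = ε / 3 + u := by field_simp
    rw [this]
    linarith
  have b2 : P.real {ω | η ≤ maxInc (fun t ω => M (min t (τ ω)) ω) π n ω} ≤ ε / 3 := by
    have h1 := mul_meas_ge_le_integral_of_nonneg
      (Filter.Eventually.of_forall (maxInc_nonneg (fun t ω => M (min t (τ ω)) ω) π n)) hDi η
    have h2 : η * P.real {ω | η ≤ maxInc (fun t ω => M (min t (τ ω)) ω) π n ω} ≤ η * (ε / 3) := by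
      calc _ ≤ _ := h1
        _ ≤ η * ε / 3 := hD
        _ = _ := by ring
    exact le_of_mul_le_mul_left h2 hη0
  refine (measureReal_mono (s₂ := ({ω | ∃ j ≤ n, R ≤ |(P[U | sampled ℱ hπ j]) ω|} ∪
    {ω | η ≤ maxInc (fun t ω => M (min t (τ ω)) ω) π n ω}) ∪ _) ?_
      (measure_ne_top P _)).trans ((measureReal_union_le _ _).trans
      (add_le_add ((measureReal_union_le _ _).trans (add_le_add b1 b2)) hQ)) |>.trans (by linarith)
  intro ω hω
  by_contra hcon
  have hcon' : ¬ (((∃ j ≤ n, R ≤ |(P[U | ℱ (π j)]) ω|) ∨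
    η ≤ maxInc (fun t ω => M (min t (τ ω)) ω) π n ω) ∨ ∃ j ≤ n, ε / 3 ≤ |(∑ i ∈ Finset.range j,
      (M (π (i + 1)) ω - M (π i) ω) * ((P[U | ℱ (π (i + 1))]) ω - (P[U | ℱ (π i)]) ω)) - 0|) := hcon
  push Not at hcon'
  obtain ⟨⟨k1, k2⟩, k3⟩ := hcon'
  -- Pathwise: up to `τ` the stopped sums are the original ones, beyond `τ` the increments vanish,
  -- and the single interval straddling `τ` contributes at most `η * (2 * R) = ε / 2`. Thus the
  -- bound is `ε / 3 + ε / 2 < ε`.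
  have claim : ∀ j ≤ n,
      (π j ≤ τ ω → ∑ i ∈ Finset.range j, (M (min (π (i + 1)) (τ ω)) ω - M (min (π i) (τ ω)) ω) *
        ((P[U | ℱ (π (i + 1))]) ω - (P[U | ℱ (π i)]) ω) = ∑ i ∈ Finset.range j,
        (M (π (i + 1)) ω - M (π i) ω) * ((P[U | ℱ (π (i + 1))]) ω - (P[U | ℱ (π i)]) ω)) ∧
      |∑ i ∈ Finset.range j, (M (min (π (i + 1)) (τ ω)) ω - M (min (π i) (τ ω)) ω) *
        ((P[U | ℱ (π (i + 1))]) ω - (P[U | ℱ (π i)]) ω)| ≤ ε / 3 + η * (2 * R) := by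
    intro j
    induction j with
    | zero => intro _; simp; positivity
    | succ j ih =>
      intro hj
      obtain ⟨ih1, ih2⟩ := ih (by omega)
      by_cases h1 : π j ≤ τ ω
      · by_cases h2 : π (j + 1) ≤ τ ω
        · have e : ∑ i ∈ Finset.range (j + 1), (M (min (π (i + 1)) (τ ω)) ω -
              M (min (π i) (τ ω)) ω) * ((P[U | ℱ (π (i + 1))]) ω - (P[U | ℱ (π i)]) ω) =
              ∑ i ∈ Finset.range (j + 1), (M (π (i + 1)) ω - M (π i) ω) *
                ((P[U | ℱ (π (i + 1))]) ω - (P[U | ℱ (π i)]) ω) := by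
            rw [Finset.sum_range_succ, ih1 h1, min_eq_left h1, min_eq_left h2,
              ← Finset.sum_range_succ]
          refine ⟨fun _ => e, ?_⟩
          rw [e]
          have h3 := k3 (j + 1) hj
          rw [sub_zero] at h3
          have : 0 ≤ η * (2 * R) := by positivity
          linarith
        · refine ⟨fun h => absurd h h2, ?_⟩
          rw [Finset.sum_range_succ, ih1 h1]
          refine (abs_add_le _ _).trans (add_le_add ?_ ?_)
          · have h3 := k3 j (by omega)
            rw [sub_zero] at h3
            exact h3.le
          · rw [abs_mul]
            refine mul_le_mul ?_ ?_ (abs_nonneg _) hη0.le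
            · exact (abs_le_maxInc (fun t ω => M (min t (τ ω)) ω) π
                (show j < n by omega) ω).trans k2.le
            · have := abs_sub ((P[U | ℱ (π (j + 1))]) ω) ((P[U | ℱ (π j)]) ω)
              linarith [k1 j (by omega), k1 (j + 1) hj]
      · have h2 : ¬ π (j + 1) ≤ τ ω := fun h => h1 ((hπ (Nat.le_succ j)).trans h)
        refine ⟨fun h => absurd h h2, ?_⟩
        rw [Finset.sum_range_succ, min_eq_right (not_le.1 h1).le, min_eq_right (not_le.1 h2).le,
          sub_self, zero_mul, add_zero]
        exact ih2
  obtain ⟨j, hj, hω⟩ := hω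
  rw [sub_zero] at hω
  have h1 := (claim j hj).2
  have h2 : η * (2 * R) = ε / 2 := by rw [hη]; field_simp; norm_num
  rw [h2] at h1
  linarith

/-- Vanishing quadratic covariation can be checked on localisations. -/
lemma isQuadCovariation_zero_of_localized [IsProbabilityMeasure P] {M N : Time T → Ω → ℝ}
    (h : ∀ ε : ℝ, 0 < ε → ∃ M' : Time T → Ω → ℝ, IsQuadCovariation P M' N (fun _ _ => 0) ∧
      P {ω | ∃ t, M' t ω ≠ M t ω} ≤ ENNReal.ofReal ε) :
    IsQuadCovariation P M N (fun _ _ => 0) := by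
  intro ε hε
  obtain ⟨M', hQ, hM'⟩ := h (ε / 2) (by linarith)
  obtain ⟨δ, hδ, hQ⟩ := hQ (ε / 2) (by linarith)
  refine ⟨δ, hδ, fun n π hπ h0 hn hmesh => ?_⟩
  have e : ENNReal.ofReal ε = ENNReal.ofReal (ε / 2) + ENNReal.ofReal (ε / 2) := by
    rw [← ENNReal.ofReal_add (by linarith) (by linarith), add_halves]
  rw [e]
  refine (measure_mono ?_).trans ((measure_union_le _ _).trans
    (add_le_add (hQ n π hπ h0 hn hmesh) hM'))
  rintro ω ⟨j, hj, hω⟩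
  by_cases hne : ∃ t, M' t ω ≠ M t ω
  · exact Or.inr hne
  · left
    push Not at hne
    refine ⟨j, hj, ?_⟩
    simp only [hne]
    linarith

end Orthogonality

/-! ### Level times, optional stopping and passage to a smaller filtration. -/

section Stopping

variable {Ω : Type*} {mΩ : MeasurableSpace Ω} {P : Measure Ω} {T : ℝ}

/-- `τ` is the first time the increasing function `w` reaches the level `K`. -/
def IsLevelTime (w : Time T → ℝ≥0∞) (K : ℝ≥0∞) (τ : Time T) : Prop :=
  (∀ r < τ, w r < K) ∧ ∀ r, τ < r → K ≤ w r

/-- The least point of the closure of `{t | K ≤ w t}` works, and `T` if the level is never reached.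
Nothing is required of `w` at `τ` itself, so `w` may jump there. -/
lemma exists_isLevelTime [hT : Fact (0 < T)] {w : Time T → ℝ≥0∞} (hw : Monotone w) (K : ℝ≥0∞) :
    ∃ τ, IsLevelTime w K τ := by
  by_cases h : ∃ t, K ≤ w t
  · obtain ⟨τ, hτ, hmin⟩ := (isClosed_closure (s := {t | K ≤ w t})).isCompact.exists_isLeast
      (Set.Nonempty.closure h)
    refine ⟨τ, fun r hr => ?_, fun r hr => ?_⟩
    · by_contra hcon
      exact absurd (hmin (subset_closure (not_lt.1 hcon))) (not_le.2 hr)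
    · obtain ⟨s, hs, hs'⟩ := mem_closure_iff.1 hτ (Set.Iio r) isOpen_Iio hr
      exact hs'.trans (hw (le_of_lt hs))
  · push Not at h
    exact ⟨tT T, fun r _ => h r, fun r hr => absurd hr (not_lt.2 r.2.2)⟩

/-- For `s ≤ t`, the event `τ < s` is the union of the events `K ≤ W r` over a countable dense set
of `r < s`, all decided by time `t`. No right-continuity of a filtration enters. -/
lemma measurable_min_levelTime {𝒢 : MeasurableSpace Ω} {W : Time T → Ω → ℝ≥0∞} {K : ℝ≥0∞} {τ : Ω → Time T}
    (hτ : ∀ ω, IsLevelTime (fun t => W t ω) K (τ ω)) {t : Time T}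
    (hm : ∀ s ≤ t, Measurable[𝒢] (W s)) : Measurable[𝒢] fun ω => min t (τ ω) := by
  refine measurable_of_Iio fun s => ?_
  by_cases hst : t < s
  · have : (fun ω => min t (τ ω)) ⁻¹' Set.Iio s = Set.univ := by
      ext ω
      simpa using Or.inl hst
    rw [this]
    exact MeasurableSet.univ
  · obtain ⟨S, hSc, hSd⟩ := TopologicalSpace.exists_countable_dense (Time T)
    have : (fun ω => min t (τ ω)) ⁻¹' Set.Iio s = ⋃ r ∈ S ∩ Set.Iio s, {ω | K ≤ W r ω} := by
      ext ω
      simp only [Set.mem_preimage, Set.mem_Iio, min_lt_iff, hst, false_or, Set.mem_iUnion,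
        Set.mem_inter_iff, Set.mem_ofPred_eq, exists_prop]
      constructor
      · intro h
        obtain ⟨r, hr, h1, h2⟩ := hSd.exists_between h
        exact ⟨r, ⟨hr, h2⟩, (hτ ω).2 r h1⟩
      · rintro ⟨r, ⟨_, h2⟩, h3⟩
        refine lt_of_le_of_lt (not_lt.1 fun h => ?_) h2
        exact absurd h3 (not_le.2 ((hτ ω).1 r h))
    rw [this]
    refine MeasurableSet.biUnion (hSc.mono Set.inter_subset_left) fun r hr => ?_
    exact @measurableSet_le _ _ _ _ _ 𝒢 _ _ _ _ _ measurable_const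
      (hm r ((le_of_lt hr.2).trans (not_lt.1 hst)))

lemma measurable_stopped {𝒢 : MeasurableSpace Ω} {M : Time T → Ω → ℝ} {W : Time T → Ω → ℝ≥0∞}
    {K : ℝ≥0∞} {τ : Ω → Time T}
    (hτ : ∀ ω, IsLevelTime (fun t => W t ω) K (τ ω)) {t : Time T}
    (hm : ∀ s ≤ t, Measurable[𝒢] (W s))
    (hprog : Measurable fun p : Time T × Ω => M (min p.1 t) p.2) :
    Measurable[𝒢] fun ω => M (min t (τ ω)) ω := by
  have h := hprog.comp ((measurable_min_levelTime hτ hm).prodMk (@measurable_id _ 𝒢))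
  have e : (fun ω => M (min t (τ ω)) ω) = (fun p : Time T × Ω => M (min p.1 t) p.2) ∘
      fun ω => (min t (τ ω), id ω) := by
    funext ω
    simp only [Function.comp, id, min_eq_left (min_le_left t (τ ω))]
  rw [e]
  exact h

/-- The value at `τ` is a limit of values before `τ`, except when `τ` is the initial time; that case
needs `h0`. -/
lemma abs_le_of_lt_levelTime {f : Time T → ℝ} [hT : Fact (0 < T)] (hf : Continuous f) {c : ℝ}
    {τ : Time T} (h0 : |f (t0 T)| ≤ c) (h : ∀ r < τ, |f r| ≤ c) {r : Time T} (hr : r ≤ τ) :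
    |f r| ≤ c := by
  rcases hr.lt_or_eq with hr | rfl
  · exact h r hr
  · by_cases hr0 : r = t0 T
    · rwa [hr0]
    · have hlt : t0 T < r := lt_of_le_of_ne r.2.1 (Ne.symm hr0)
      have hcl : r ∈ closure (Set.Iio r) := by
        rw [closure_Iio' (a := r) ⟨t0 T, hlt⟩]
        exact Set.mem_Iic.2 le_rfl
      have hsub : closure (Set.Iio r) ⊆ {s | |f s| ≤ c} :=
        closure_minimal (fun s hs => h s hs) (isClosed_le hf.abs continuous_const)
      exact hsub hcl

/-- Optional stopping of a continuous martingale at the first time an increasing adapted process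
reaches a level. -/
lemma martingale_stopped_levelTime [IsProbabilityMeasure P] [hT : Fact (0 < T)]
    {ℱ : Filtration (Time T) mΩ} {M : Time T → Ω → ℝ} (hM : Martingale M ℱ P)
    (hcont : ∀ᵐ ω ∂P, Continuous fun t => M t ω) {W : Time T → Ω → ℝ≥0∞}
    (hWm : ∀ t, Measurable[ℱ t] (W t))
    {K : ℝ≥0∞} {τ : Ω → Time T} (hτ : ∀ ω, IsLevelTime (fun t => W t ω) K (τ ω))
    (hMτ : ∀ t, Measurable[ℱ t] fun ω => M (min t (τ ω)) ω)
    {c : ℝ} (hMc : ∀ᵐ ω ∂P, ∀ t, |M (min t (τ ω)) ω| ≤ c) :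
    Martingale (fun t ω => M (min t (τ ω)) ω) ℱ P := by
  have hint : ∀ t, Integrable (fun ω => M (min t (τ ω)) ω) P := fun t =>
    (integrable_const c).mono' ((hMτ t).mono (ℱ.le t) le_rfl).aestronglyMeasurable
      (by filter_upwards [hMc] with ω h using h t)
  refine ⟨fun t => (hMτ t).stronglyMeasurable, fun s t hst => ?_⟩
  refine (ae_eq_condExp_of_forall_setIntegral_eq (ℱ.le s) (hint t)
    (fun _ _ _ => (hint s).integrableOn) (fun A hA _ => ?_)
    (hMτ s).stronglyMeasurable.aestronglyMeasurable).symm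
  -- Off `B` one has `τ ≤ s`, so the stopped process takes the same value at `s` and at `t`. On `B`
  -- one has `s ≤ τ`, and `min t τ` is approximated by hitting times on grids of `[s,t]`.
  set B : Set Ω := {ω | W s ω < K} with hB
  have hBm : MeasurableSet[ℱ s] B := @measurableSet_lt _ _ _ _ _ (ℱ s) _ _ _ _ _ (hWm s)
    measurable_const
  have hBm' : MeasurableSet B := ℱ.le s _ hBm
  -- grids on `[s,t]`
  have hgrid : ∀ k : ℕ, ∃ (N : ℕ) (π : ℕ → Time T), Monotone π ∧ π 0 = s ∧ π N = t ∧
      ∀ i, (π (i + 1) : ℝ) - π i < 1 / ((k : ℝ) + 1) := fun k => by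
    obtain ⟨N, π, h1, _, h3, h4, _, h6⟩ := exists_partition hT.out hst
      (show (0 : ℝ) < 1 / ((k : ℝ) + 1) by positivity)
    exact ⟨N, fun i => π (N + i), fun i j h => h1 (Nat.add_le_add_left h N), h3, h4,
      fun i => h6 (N + i)⟩
  choose N π hπ hπ0 hπN hmesh using hgrid
  set σ : ℕ → Ω → ℕ := fun k => hittingBtwn (fun i => W (π k i)) (Set.Ici K) 0 (N k) with hσ
  have hσst : ∀ k, IsStoppingTime (sampled ℱ (hπ k)) fun ω => ((σ k ω : ℕ) : WithTop ℕ) := fun k =>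
    Adapted.isStoppingTime_hittingBtwn (fun i => hWm (π k i)) measurableSet_Ici
  have hσN : ∀ k ω, σ k ω ≤ N k := fun k ω => hittingBtwn_le ω
  set X : ℕ → Ω → ℝ := fun k ω => M (π k (σ k ω)) ω with hX
  have hXc : ∀ k, X k =ᵐ[P] P[M t | (hσst k).measurableSpace] := fun k => by
    have := (martingale_sampled hM (hπ k)).stoppedValue_ae_eq_condExp_of_le_const (hσst k)
      (n := N k) (fun ω => WithTop.coe_le_coe.2 (hσN k ω))
    rw [hπN k] at this
    exact this
  have hXi : ∀ k, Integrable (X k) P := fun k => integrable_condExp.congr (hXc k).symm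
  have hXs : ∀ k, P[X k | ℱ s] =ᵐ[P] M s := fun k => by
    refine (condExp_congr_ae (hXc k)).trans ?_
    refine (condExp_condExp_of_le ?_ (hσst k).measurableSpace_le).trans (hM.condExp_ae_eq hst)
    have h1 := (hσst k).le_measurableSpace_of_const_le (i := 0) (fun ω => by simp)
    have h2 : sampled ℱ (hπ k) 0 = ℱ s := by
      change ℱ (π k 0) = ℱ s
      rw [hπ0 k]
    rwa [h2] at h1
  have hlim : ∀ᵐ ω ∂P, Filter.Tendsto (fun k => B.indicator (X k) ω) Filter.atTop
      (nhds (B.indicator (fun ω => M (min t (τ ω)) ω) ω)) := by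
    filter_upwards [hcont] with ω hω
    by_cases hωB : ω ∈ B
    · simp only [Set.indicator_of_mem hωB]
      refine (hω.tendsto (min t (τ ω))).comp ?_
      have hsτ : s ≤ τ ω := not_lt.1 fun h => absurd ((hτ ω).2 s h) (not_le.2 hωB)
      rw [tendsto_iff_dist_tendsto_zero]
      refine squeeze_zero (fun _ => dist_nonneg) (fun k => ?_) tendsto_one_div_add_atTop_nhds_zero_nat
      have lower : min t (τ ω) ≤ π k (σ k ω) := by
        rcases (hσN k ω).lt_or_eq with h | h
        · have h1 : K ≤ W (π k (σ k ω)) ω := hittingBtwn_mem_set_of_hittingBtwn_lt h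
          exact (min_le_right _ _).trans (not_lt.1 fun h' => absurd h1 (not_le.2 ((hτ ω).1 _ h')))
        · rw [h, hπN k]
          exact min_le_left _ _
      have upper : (π k (σ k ω) : ℝ) ≤ (min t (τ ω) : Time T) + 1 / ((k : ℝ) + 1) := by
        have hpos : (0 : ℝ) < 1 / ((k : ℝ) + 1) := by positivity
        rcases hj : σ k ω with _ | j
        · rw [hπ0 k]
          have : (s : ℝ) ≤ (min t (τ ω) : Time T) := le_min hst hsτ
          linarith
        · have h1 : ¬ K ≤ W (π k j) ω := notMem_of_lt_hittingBtwn (u := fun i => W (π k i))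
            (s := Set.Ici K) (n := 0) (m := N k) (show j < σ k ω by omega) (Nat.zero_le j)
          have h2 : π k j ≤ τ ω := not_lt.1 fun h => h1 ((hτ ω).2 _ h)
          have h3 : π k j ≤ t := by
            rw [← hπN k]
            exact hπ k (by have := hσN k ω; omega)
          have h4 : (π k j : ℝ) ≤ (min t (τ ω) : Time T) := le_min h3 h2
          linarith [hmesh k j]
      rw [Subtype.dist_eq, Real.dist_eq, abs_of_nonneg
        (sub_nonneg.2 (show ((min t (τ ω) : Time T) : ℝ) ≤ π k (σ k ω) from lower))]
      linarith
    · simp only [Set.indicator_of_notMem hωB]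
      exact tendsto_const_nhds
  -- The grid times may lie beyond `τ`, where `c` is no bound for `M`. Uniform integrability comes
  -- instead from the `X k` being conditional expectations of the one variable `M t`.
  have hui : UnifIntegrable (fun k => B.indicator (X k)) 1 P :=
    (((hM.integrable t).uniformIntegrable_condExp
      (fun k => (hσst k).measurableSpace_le)).unifIntegrable.ae_eq
        fun k => (hXc k).symm).indicator B
  have hL1 := tendsto_Lp_finite_of_tendsto_ae le_rfl ENNReal.one_ne_top
    (fun k => ((hXi k).indicator hBm').aestronglyMeasurable)
    (memLp_one_iff_integrable.2 ((hint t).indicator hBm')) hui hlim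
  have hconv := tendsto_setIntegral_of_L1' _ ((hint t).indicator hBm').aestronglyMeasurable
    (Filter.Eventually.of_forall fun k => (hXi k).indicator hBm') hL1 A
  have hconst : ∀ k, ∫ ω in A, B.indicator (X k) ω ∂P =
      ∫ ω in A, B.indicator (fun ω => M (min s (τ ω)) ω) ω ∂P := fun k => by
    rw [setIntegral_indicator hBm', setIntegral_indicator hBm',
      ← setIntegral_condExp (ℱ.le s) (hXi k) (hA.inter hBm)]
    have hAB : MeasurableSet (A ∩ B) := ℱ.le s _ (hA.inter hBm)
    rw [setIntegral_congr_ae hAB ((hXs k).mono fun ω h _ => h)]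
    refine setIntegral_congr_fun hAB fun ω hω => ?_
    have hsτ : s ≤ τ ω := not_lt.1 fun h => absurd ((hτ ω).2 s h) (not_le.2 hω.2)
    simp only [min_eq_left hsτ]
  simp_rw [hconst] at hconv
  have hBeq := tendsto_nhds_unique tendsto_const_nhds hconv
  have hsplit : ∀ r, ∫ ω in A, M (min r (τ ω)) ω ∂P =
      ∫ ω in A, B.indicator (fun ω => M (min r (τ ω)) ω) ω ∂P +
      ∫ ω in A, Bᶜ.indicator (fun ω => M (min r (τ ω)) ω) ω ∂P := fun r => by
    rw [← integral_add ((hint r).indicator hBm').integrableOn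
      ((hint r).indicator hBm'.compl).integrableOn]
    exact integral_congr_ae (Filter.Eventually.of_forall fun ω =>
      (congrFun (Set.indicator_self_add_compl B fun ω => M (min r (τ ω)) ω) ω).symm)
  rw [hsplit s, hsplit t, hBeq]
  congr 2
  funext ω
  by_cases hωB : ω ∈ B
  · simp [hωB]
  · have hωB' : ω ∈ Bᶜ := hωB
    have hτs : τ ω ≤ s := not_lt.1 fun h => hωB ((hτ ω).1 s h)
    simp only [Set.indicator_of_mem hωB', min_eq_right hτs, min_eq_right (hτs.trans hst)]

/-- A martingale adapted to a smaller filtration is a martingale for it. -/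
lemma martingale_of_le [IsFiniteMeasure P] {ℱ 𝒢 : Filtration (Time T) mΩ} (h : ∀ t, 𝒢 t ≤ ℱ t)
    {M : Time T → Ω → ℝ} (hM : Martingale M ℱ P) (hm : ∀ t, StronglyMeasurable[𝒢 t] (M t)) :
    Martingale M 𝒢 P := by
  refine ⟨hm, fun s t hst => ?_⟩
  have h1 := condExp_condExp_of_le (f := M t) (μ := P) (h s) (ℱ.le s)
  refine h1.symm.trans ((condExp_congr_ae (hM.condExp_ae_eq hst)).trans ?_)
  rw [condExp_of_stronglyMeasurable (𝒢.le s) (hm s) (hM.integrable s)]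

/-- Projecting `U` to a smaller filtration, to which `M` is adapted, preserves the vanishing of the
quadratic covariation. -/
theorem isQuadCovariation_of_le [IsProbabilityMeasure P] [hT : Fact (0 < T)]
    {ℱ 𝒢 : Filtration (Time T) mΩ} (h𝒢 : ∀ t, 𝒢 t ≤ ℱ t) {M : Time T → Ω → ℝ}
    (hM : Martingale M ℱ P) (hcont : ∀ᵐ ω ∂P, Continuous fun t => M t ω)
    {W : Time T → Ω → ℝ≥0∞} (hW : ∀ ω, Monotone fun t => W t ω)
    (hWm : ∀ t, Measurable[𝒢 t] (W t)) (hWT : ∀ᵐ ω ∂P, W (tT T) ω < ∞)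
    (hprog : ∀ t, Measurable[Prod.instMeasurableSpace (m₁ := inferInstance) (m₂ := 𝒢 t)]
      fun p : Time T × Ω => M (min p.1 t) p.2)
    {c : ℝ} (hc0 : 0 ≤ c) (hM0 : ∀ ω, |M (t0 T) ω| ≤ c)
    (hMW : ∀ ω t, W t ω < ∞ → |M t ω| ≤ c + (W t ω).toReal)
    {U : Ω → ℝ} (hU : Integrable U P)
    (hQ : IsQuadCovariation P M (fun t => P[U | ℱ t]) (fun _ _ => 0)) :
    IsQuadCovariation P M (fun t => P[U | 𝒢 t]) (fun _ _ => 0) := by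
  refine isQuadCovariation_zero_of_localized fun ε hε => ?_
  have hWT' : Measurable (W (tT T)) := (hWm (tT T)).mono (𝒢.le _) le_rfl
  -- a level which is reached with small probability
  obtain ⟨K, hK⟩ : ∃ K : ℕ, P {ω | (K : ℝ≥0∞) ≤ W (tT T) ω} ≤ ENNReal.ofReal ε := by
    have h1 : Filter.Tendsto (fun K : ℕ => P {ω | (K : ℝ≥0∞) ≤ W (tT T) ω}) Filter.atTop
        (nhds (P (⋂ K : ℕ, {ω | (K : ℝ≥0∞) ≤ W (tT T) ω}))) := by
      refine tendsto_measure_iInter_atTop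
        (fun K => (measurableSet_le measurable_const hWT').nullMeasurableSet) ?_
        ⟨0, measure_ne_top _ _⟩
      intro a b hab ω hω
      exact (Nat.cast_le.2 hab : (a : ℝ≥0∞) ≤ b).trans hω
    have h2 : P (⋂ K : ℕ, {ω | (K : ℝ≥0∞) ≤ W (tT T) ω}) = 0 := by
      refine measure_mono_null (fun ω hω => ?_) hWT
      intro hlt
      obtain ⟨n, hn⟩ := ENNReal.exists_nat_gt hlt.ne
      exact absurd (Set.mem_iInter.1 hω n) (not_le.2 hn)
    rw [h2] at h1
    exact (h1.eventually (ge_mem_nhds (ENNReal.ofReal_pos.2 hε))).exists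
  choose τ hτ using fun ω => exists_isLevelTime (hW ω) (K : ℝ≥0∞)
  set c' : ℝ := c + K with hc'
  have hc'0 : 0 ≤ c' := by positivity
  have hMτ : ∀ t, Measurable[𝒢 t] fun ω => M (min t (τ ω)) ω := fun t =>
    measurable_stopped hτ (fun s hs => (hWm s).mono (𝒢.mono hs) le_rfl) (hprog t)
  have hcont' : ∀ᵐ ω ∂P, Continuous fun t => M (min t (τ ω)) ω := by
    filter_upwards [hcont] with ω h
    exact h.comp (continuous_id.min continuous_const)
  have hMc : ∀ᵐ ω ∂P, ∀ t, |M (min t (τ ω)) ω| ≤ c' := by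
    filter_upwards [hcont] with ω h t
    refine abs_le_of_lt_levelTime h ((hM0 ω).trans (by simp [hc'])) (fun r hr => ?_)
      (min_le_right t (τ ω))
    have h1 : W r ω < K := (hτ ω).1 r hr
    have h2 : W r ω < ∞ := h1.trans (ENNReal.natCast_lt_top K)
    refine (hMW ω r h2).trans (add_le_add_right ?_ c)
    have := ENNReal.toReal_mono (ENNReal.natCast_ne_top K) h1.le
    simpa using this
  have hMartF : Martingale (fun t ω => M (min t (τ ω)) ω) ℱ P :=
    martingale_stopped_levelTime hM hcont (fun t => (hWm t).mono (h𝒢 t) le_rfl) hτ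
      (fun t => (hMτ t).mono (h𝒢 t) le_rfl) hMc
  have hMartG : Martingale (fun t ω => M (min t (τ ω)) ω) 𝒢 P :=
    martingale_of_le h𝒢 hMartF fun t => (hMτ t).stronglyMeasurable
  have hQτ := hQ.stopped τ (fun t => (hMartF.integrable t).aestronglyMeasurable) hcont' hc'0 hMc
  refine ⟨fun t ω => M (min t (τ ω)) ω, ?_, (measure_mono ?_).trans hK⟩
  -- The change of filtration: orthogonality obtained for `ℱ_s`-measurable test variables is used
  -- only for the `𝒢_s`-measurable ones.
  · refine isQuadCovariation_zero_of_integral_mul_increment_eq_zero hMartG hcont' hc'0 hMc hU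
      fun s t hst a ha ha1 => ?_
    exact integral_mul_increment_eq_zero_of_isQuadCovariation hT.out hMartF hcont' hc'0 hMc hU hQτ
      hst (ha.mono (h𝒢 s)) ha1
  · rintro ω ⟨t, ht⟩
    by_contra hcon
    refine ht ?_
    have h1 : ∀ r, ¬ (τ ω < r) := fun r hr =>
      hcon (((hτ ω).2 r hr).trans (hW ω r.2.2))
    simp only [min_eq_left (not_lt.1 (h1 t))]

end Stopping

/-! ### Measurability on path space -/

section PathSpace

variable {T : ℝ} {V : Type} [PseudoMetricSpace V]

lemma continuous_stopPath :
    Continuous fun p : Time T × Path T V => stopPath p.1 p.2 := by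
  refine ContinuousMap.continuous_of_continuous_uncurry _ ?_
  change Continuous fun q : (Time T × Path T V) × Time T => q.1.2 (min q.2 q.1.1)
  fun_prop

lemma stopPath_stopPath {s t : Time T} (hst : s ≤ t) (x : Path T V) :
    stopPath s (stopPath t x) = stopPath s x := by
  ext u
  change x (min (min u s) t) = x (min u s)
  rw [min_eq_left ((min_le_right u s).trans hst)]

lemma stopPath_apply {s t : Time T} (hst : s ≤ t) (x : Path T V) : stopPath t x s = x s := by
  change x (min s t) = x s
  rw [min_eq_left hst]

variable [SecondCountableTopology V] [MeasurableSpace V]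
  [BorelSpace V]

/-- The Borel σ-algebra of path space is generated by the evaluations. -/
lemma measurable_path_of_eval {Γ : Type*} {mΓ : MeasurableSpace Γ} {X : Γ → Path T V}
    (hX : ∀ s, Measurable fun γ => X γ s) : Measurable X := by
  set s : Set (Set (Path T V)) := {B | ∃ y r, B = Metric.ball y r} with hs
  have hbasis : TopologicalSpace.IsTopologicalBasis s := by
    refine TopologicalSpace.isTopologicalBasis_of_isOpen_of_nhds ?_ fun x U hx hU => ?_
    · rintro _ ⟨y, r, rfl⟩
      exact Metric.isOpen_ball
    · obtain ⟨r, hr, hsub⟩ := Metric.isOpen_iff.1 hU x hx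
      exact ⟨_, ⟨x, r, rfl⟩, Metric.mem_ball_self hr, hsub⟩
  have hgen : pathMeasurableSpace T V = MeasurableSpace.generateFrom s :=
    hbasis.borel_eq_generateFrom
  rw [hgen]
  refine measurable_generateFrom ?_
  rintro _ ⟨y, r, rfl⟩
  obtain ⟨S, hSc, hSd⟩ := TopologicalSpace.exists_countable_dense (Time T)
  have hd : Measurable fun γ => dist (X γ) y := by
    refine measurable_of_Iic fun C => ?_
    by_cases hC : 0 ≤ C
    · have : (fun γ => dist (X γ) y) ⁻¹' Set.Iic C = ⋂ u ∈ S, {γ | dist (X γ u) (y u) ≤ C} := by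
        ext γ
        simp only [Set.mem_preimage, Set.mem_Iic, ContinuousMap.dist_le hC, Set.mem_iInter,
          Set.mem_ofPred_eq]
        refine ⟨fun h u _ => h u, fun h u => ?_⟩
        have hcl : IsClosed {u | dist (X γ u) (y u) ≤ C} :=
          isClosed_le ((X γ).continuous.dist y.continuous) continuous_const
        have hsub : closure S ⊆ {u | dist (X γ u) (y u) ≤ C} := closure_minimal h hcl
        exact hsub (hSd.closure_eq ▸ Set.mem_univ u)
      rw [this]
      exact MeasurableSet.biInter hSc fun u _ =>
        measurableSet_le ((hX u).dist measurable_const) measurable_const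
    · have : (fun γ => dist (X γ) y) ⁻¹' Set.Iic C = ∅ := by
        ext γ
        simp only [Set.mem_preimage, Set.mem_Iic, Set.mem_empty_iff_false, iff_false]
        exact fun h => hC (dist_nonneg.trans h)
      rw [this]
      exact MeasurableSet.empty
  exact hd measurableSet_Iio

lemma measurable_stopPath_of_eval {Γ : Type*} {mΓ : MeasurableSpace Γ} {X : Γ → Path T V}
    {t : Time T} (hX : ∀ s ≤ t, Measurable fun γ => X γ s) :
    Measurable fun γ => stopPath t (X γ) :=
  measurable_path_of_eval fun s => hX (min s t) (min_le_right s t)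

lemma measurable_stopPath {V : Type} [PseudoMetricSpace V] [SecondCountableTopology V] :
    Measurable fun p : Time T × Path T V => stopPath p.1 p.2 :=
  continuous_stopPath.measurable

lemma measurable_eval : Measurable fun p : Time T × Path T V => p.2 p.1 := by
  have : Continuous fun p : Time T × Path T V => p.2 p.1 := by fun_prop
  exact this.measurable

end PathSpace

/-! ### Measurability and growth of the coefficients and of the generator. -/

section Coefficients

variable {T : ℝ} {d k : ℕ} {A I : Type*}

lemma zvolSq_nonneg (𝓜 : Model T d k A I) (t : Time T) (x : Path T (E d)) (z : E d) :
    0 ≤ 𝓜.zvolSq t x z := by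
  change 0 ≤ ∑ j, 𝓜.zvol t x z j * 𝓜.zvol t x z j
  exact Finset.sum_nonneg fun _ _ => mul_self_nonneg _

lemma continuous_grad {φ : E d × ℝ → ℝ} (hφ : ContDiff ℝ 2 φ) (i : Fin d ⊕ Unit) :
    Continuous fun p => grad φ p i :=
  (hφ.continuous_fderiv (by norm_num)).clm_apply continuous_const

lemma continuous_hess {φ : E d × ℝ → ℝ} (hφ : ContDiff ℝ 2 φ) (i j : Fin d ⊕ Unit) :
    Continuous fun p => hess φ p i j := by
  have h1 : ContDiff ℝ 1 fun p => fderiv ℝ φ p (stdVec d j) :=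
    (hφ.fderiv_right (m := 1) (by norm_num)).clm_apply contDiff_const
  exact (h1.continuous_fderiv (by norm_num)).clm_apply continuous_const

lemma exists_bound_grad_hess {φ : E d × ℝ → ℝ} (hφ : ContDiff ℝ 2 φ) (hc : HasCompactSupport φ) :
    ∃ G : ℝ, 0 ≤ G ∧ (∀ p i, |grad φ p i| ≤ G) ∧ (∀ p i j, |hess φ p i j| ≤ G) := by
  have h1 : ∀ i, ∃ C, ∀ p, ‖grad φ p i‖ ≤ C := fun i =>
    (continuous_grad hφ i).bounded_above_of_compact_support (hc.fderiv_apply ℝ _)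
  have h2 : ∀ i j, ∃ C, ∀ p, ‖hess φ p i j‖ ≤ C := fun i j =>
    (continuous_hess hφ i j).bounded_above_of_compact_support
      ((hc.fderiv_apply ℝ (stdVec d j)).fderiv_apply ℝ _)
  choose C1 hC1 using h1
  choose C2 hC2 using h2
  refine ⟨∑ i, |C1 i| + ∑ i, ∑ j, |C2 i j|, by positivity, fun p i => ?_, fun p i j => ?_⟩
  · have a1 : |C1 i| ≤ ∑ i, |C1 i| := Finset.single_le_sum (f := fun i => |C1 i|) (fun i _ => abs_nonneg _)
      (Finset.mem_univ i)
    have a2 : 0 ≤ ∑ i, ∑ j, |C2 i j| := by positivity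
    have a3 := (hC1 i p).trans (le_abs_self _)
    rw [Real.norm_eq_abs] at a3
    linarith
  · have a1 : ∑ j, |C2 i j| ≤ ∑ i, ∑ j, |C2 i j| := Finset.single_le_sum (f := fun i => ∑ j, |C2 i j|)
      (fun i _ => Finset.sum_nonneg fun j _ => abs_nonneg _) (Finset.mem_univ i)
    have a0 : |C2 i j| ≤ ∑ j, |C2 i j| := Finset.single_le_sum (f := fun j => |C2 i j|) (fun i _ => abs_nonneg _)
      (Finset.mem_univ j)
    have a2 : 0 ≤ ∑ i, |C1 i| := by positivity
    have a3 := (hC2 i j p).trans (le_abs_self _)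
    rw [Real.norm_eq_abs] at a3
    linarith

/-- The generator is non-anticipative; this is the source of all adaptedness of `M^φ` and of its
drift variation. -/
lemma gen_stopPath (𝓜 : Model T d k A I) (φ : E d × ℝ → ℝ) {s t : Time T} (hst : s ≤ t)
    (x : Path T (E d)) (y : Path T ℝ) (z : E d) :
    𝓜.gen φ s (stopPath t x) (stopPath t y) z = 𝓜.gen φ s x y z := by
  unfold Model.gen
  rw [stopPath_stopPath hst, stopPath_apply hst, stopPath_apply hst]

lemma norm_stopPath_le (t : Time T) (x : Path T (E d)) : ‖stopPath t x‖ ≤ ‖x‖ :=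
  (ContinuousMap.norm_le _ (norm_nonneg x)).2 fun _ => x.norm_coe_le_norm _

variable [Fact (0 < T)] [MeasurableSpace A] {𝓜 : Model T d k A I}

lemma measurable_discInt (h𝓜 : 𝓜.Standing) :
    Measurable fun p : Time T × Path T (E d) => 𝓜.discInt p.1 p.2 := by
  have h1 : Measurable fun q : (Time T × Path T (E d)) × Time T =>
      (Set.Iic q.1.1).indicator (fun u => 𝓜.disc u (stopPath u q.1.2)) q.2 := by
    have hs : MeasurableSet {q : (Time T × Path T (E d)) × Time T | q.2 ≤ q.1.1} :=
      measurableSet_le measurable_snd (measurable_fst.comp measurable_fst)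
    have hf : Measurable fun q : (Time T × Path T (E d)) × Time T =>
        𝓜.disc q.2 (stopPath q.2 q.1.2) :=
      h𝓜.disc_meas.comp (measurable_snd.prodMk
        (measurable_stopPath.comp (measurable_snd.prodMk (measurable_snd.comp measurable_fst))))
    exact hf.indicator hs
  have h2 := (h1.stronglyMeasurable.integral_prod_right' (ν := leb T)).measurable
  have e : (fun p : Time T × Path T (E d) => 𝓜.discInt p.1 p.2) = fun p =>
      ∫ u, (Set.Iic p.1).indicator (fun u => 𝓜.disc u (stopPath u p.2)) u ∂(leb T) := by
    funext p
    exact (integral_indicator measurableSet_Iic).symm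
  rw [e]
  exact h2

lemma measurable_zvol (h𝓜 : 𝓜.Standing) (j : Fin k) :
    Measurable fun p : (Time T × Path T (E d)) × E d => 𝓜.zvol p.1.1 p.1.2 p.2 j := by
  have e : (fun p : (Time T × Path T (E d)) × E d => 𝓜.zvol p.1.1 p.1.2 p.2 j) = fun p =>
      ∑ i, p.2 i * 𝓜.vol p.1.1 p.1.2 i j := rfl
  rw [e]
  refine Finset.measurable_fun_sum _ fun i _ => ?_
  exact Measurable.mul (by fun_prop) ((h𝓜.vol_meas i j).comp measurable_fst)

lemma measurable_zvolSq (h𝓜 : 𝓜.Standing) :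
    Measurable fun p : (Time T × Path T (E d)) × E d => 𝓜.zvolSq p.1.1 p.1.2 p.2 := by
  have e : (fun p : (Time T × Path T (E d)) × E d => 𝓜.zvolSq p.1.1 p.1.2 p.2) = fun p =>
      ∑ j, 𝓜.zvol p.1.1 p.1.2 p.2 j * 𝓜.zvol p.1.1 p.1.2 p.2 j := rfl
  rw [e]
  exact Finset.measurable_fun_sum _ fun j _ => (measurable_zvol h𝓜 j).mul (measurable_zvol h𝓜 j)

lemma measurable_exp_neg_discInt (h𝓜 : 𝓜.Standing) :
    Measurable fun p : (Time T × Path T (E d)) × E d => Real.exp (-𝓜.discInt p.1.1 p.1.2) :=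
  Real.measurable_exp.comp ((measurable_discInt h𝓜).comp measurable_fst).neg

lemma measurable_volBar (h𝓜 : 𝓜.Standing) (i : Fin d ⊕ Unit) (j : Fin k) :
    Measurable fun p : (Time T × Path T (E d)) × E d => 𝓜.volBar p.1.1 p.1.2 p.2 i j := by
  rcases i with i | i
  · exact (h𝓜.vol_meas i j).comp measurable_fst
  · exact (measurable_exp_neg_discInt h𝓜).mul (measurable_zvol h𝓜 j)

lemma measurable_diff (h𝓜 : 𝓜.Standing) (i j : Fin d ⊕ Unit) :
    Measurable fun p : (Time T × Path T (E d)) × E d => 𝓜.diff p.1.1 p.1.2 p.2 i j := by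
  have e : (fun p : (Time T × Path T (E d)) × E d => 𝓜.diff p.1.1 p.1.2 p.2 i j) = fun p =>
      ∑ l, 𝓜.volBar p.1.1 p.1.2 p.2 i l * 𝓜.volBar p.1.1 p.1.2 p.2 j l := rfl
  rw [e]
  exact Finset.measurable_fun_sum _ fun l _ =>
    (measurable_volBar h𝓜 i l).mul (measurable_volBar h𝓜 j l)

lemma measurable_drift (h𝓜 : 𝓜.Standing) (i : Fin d ⊕ Unit) :
    Measurable fun p : (Time T × Path T (E d)) × E d => 𝓜.drift p.1.1 p.1.2 p.2 i := by
  have hact : Measurable fun p : (Time T × Path T (E d)) × E d => 𝓜.act p.1.1 p.1.2 p.2 :=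
    h𝓜.act_meas.comp ((measurable_fst.comp measurable_fst).prodMk
      ((measurable_snd.comp measurable_fst).prodMk measurable_snd))
  have harg : Measurable fun p : (Time T × Path T (E d)) × E d =>
      (p.1.1, p.1.2, 𝓜.act p.1.1 p.1.2 p.2) :=
    (measurable_fst.comp measurable_fst).prodMk ((measurable_snd.comp measurable_fst).prodMk hact)
  rcases i with i | i
  · have e : (fun p : (Time T × Path T (E d)) × E d => 𝓜.drift p.1.1 p.1.2 p.2 (Sum.inl i)) =
        fun p => ∑ j, 𝓜.vol p.1.1 p.1.2 i j * 𝓜.lam p.1.1 p.1.2 (𝓜.act p.1.1 p.1.2 p.2) j := rfl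
    rw [e]
    exact Finset.measurable_fun_sum _ fun j _ =>
      ((h𝓜.vol_meas i j).comp measurable_fst).mul ((h𝓜.lam_meas j).comp harg)
  · exact (measurable_exp_neg_discInt h𝓜).mul (h𝓜.cost_meas.comp harg)

lemma measurable_gen (h𝓜 : 𝓜.Standing) {φ : E d × ℝ → ℝ} (hφ : ContDiff ℝ 2 φ) :
    Measurable fun q : (Path T (E d) × Path T ℝ) × (Time T × E d) =>
      𝓜.gen φ q.2.1 q.1.1 q.1.2 q.2.2 := by
  have hst : Measurable fun q : (Path T (E d) × Path T ℝ) × (Time T × E d) =>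
      ((q.2.1, stopPath q.2.1 q.1.1), q.2.2) :=
    ((measurable_fst.comp measurable_snd).prodMk (measurable_stopPath.comp
      ((measurable_fst.comp measurable_snd).prodMk (measurable_fst.comp measurable_fst)))).prodMk
      (measurable_snd.comp measurable_snd)
  have hev : Measurable fun q : (Path T (E d) × Path T ℝ) × (Time T × E d) =>
      (q.1.1 q.2.1, q.1.2 q.2.1) :=
    (measurable_eval.comp ((measurable_fst.comp measurable_snd).prodMk
      (measurable_fst.comp measurable_fst))).prodMk
    (measurable_eval.comp ((measurable_fst.comp measurable_snd).prodMk
      (measurable_snd.comp measurable_fst)))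
  have e : (fun q : (Path T (E d) × Path T ℝ) × (Time T × E d) =>
      𝓜.gen φ q.2.1 q.1.1 q.1.2 q.2.2) = fun q =>
      ∑ i, 𝓜.drift q.2.1 (stopPath q.2.1 q.1.1) q.2.2 i * grad φ (q.1.1 q.2.1, q.1.2 q.2.1) i +
      1 / 2 * ∑ i, ∑ j, 𝓜.diff q.2.1 (stopPath q.2.1 q.1.1) q.2.2 i j *
        hess φ (q.1.1 q.2.1, q.1.2 q.2.1) j i := rfl
  rw [e]
  refine Measurable.add ?_ (Measurable.const_mul ?_ _)
  · exact Finset.measurable_fun_sum _ fun i _ => ((measurable_drift h𝓜 i).comp hst).mul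
      ((continuous_grad hφ i).measurable.comp hev)
  · exact Finset.measurable_fun_sum _ fun i _ => Finset.measurable_fun_sum _ fun j _ =>
      ((measurable_diff h𝓜 i j).comp hst).mul ((continuous_hess hφ j i).measurable.comp hev)

/-- The generator has at most linear growth in the path and quadratic growth in the control. -/
lemma exists_abs_gen_le (h𝓜 : 𝓜.Standing) {φ : E d × ℝ → ℝ} (hφ : ContDiff ℝ 2 φ)
    (hc : HasCompactSupport φ) :
    ∃ C : ℝ, 0 ≤ C ∧ ∀ s x y z,
      |𝓜.gen φ s x y z| ≤ C * (1 + ‖x‖) + C * 𝓜.zvolSq s (stopPath s x) z := by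
  obtain ⟨C, hC, hgr⟩ := h𝓜.growth
  obtain ⟨G, hG, hg, hh⟩ := exists_bound_grad_hess hφ hc
  set n : ℝ := (((Finset.univ : Finset (Fin d ⊕ Unit)).card : ℕ) : ℝ) with hn
  have hn0 : 0 ≤ n := Nat.cast_nonneg _
  refine ⟨2 * (n * (C * G)) + n * (n * (C * G)), by positivity, fun s x y z => ?_⟩
  obtain ⟨ha, hb⟩ := hgr s (stopPath s x) z
  set ζ := 𝓜.zvolSq s (stopPath s x) z with hζ
  have hζ0 : 0 ≤ ζ := zvolSq_nonneg 𝓜 s _ z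
  -- Absorbs the growth of the drift, linear in `z^⊤ σ`, into the quadratic bound used for the
  -- diffusion.
  have hsq : Real.sqrt ζ ≤ 1 + ζ := by
    rw [Real.sqrt_le_left (by linarith)]
    nlinarith
  have hx := norm_stopPath_le s x
  have hx0 := norm_nonneg x
  set b : ℝ := 1 + ‖x‖ + ζ with hb'
  have hb0 : 0 ≤ b := by positivity
  have h1 : |𝓜.drift s (stopPath s x) z ⬝ᵥ grad φ (x s, y s)| ≤ n * (2 * (C * b) * G) := by
    refine (Finset.abs_sum_le_sum_abs _ _).trans ?_
    refine (Finset.sum_le_card_nsmul _ _ (2 * (C * b) * G) fun i _ => ?_).trans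
      (le_of_eq (nsmul_eq_mul _ _))
    rw [abs_mul]
    refine mul_le_mul ((hb i).trans ?_) (hg _ i) (abs_nonneg _) (by positivity)
    have : 1 + ‖stopPath s x‖ + √ζ ≤ 2 * b := by linarith
    nlinarith
  have h2 : |(𝓜.diff s (stopPath s x) z * hess φ (x s, y s)).trace| ≤ n * (n * (C * b * G)) := by
    change |∑ i, ∑ j, 𝓜.diff s (stopPath s x) z i j * hess φ (x s, y s) j i| ≤ _
    refine (Finset.abs_sum_le_sum_abs _ _).trans ?_
    refine (Finset.sum_le_card_nsmul _ _ (n * (C * b * G)) fun i _ => ?_).trans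
      (le_of_eq (nsmul_eq_mul _ _))
    refine (Finset.abs_sum_le_sum_abs _ _).trans ?_
    refine (Finset.sum_le_card_nsmul _ _ (C * b * G) fun j _ => ?_).trans
      (le_of_eq (nsmul_eq_mul _ _))
    rw [abs_mul]
    refine mul_le_mul ((ha i j).trans ?_) (hh _ j i) (abs_nonneg _) (by positivity)
    exact mul_le_mul_of_nonneg_left (by linarith) hC.le
  have h3 : |𝓜.gen φ s x y z| ≤ n * (2 * (C * b) * G) + 1 / 2 * (n * (n * (C * b * G))) := by
    unfold Model.gen
    refine (abs_add_le _ _).trans (add_le_add h1 ?_)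
    rw [abs_mul, abs_of_pos (by norm_num : (0 : ℝ) < 1 / 2)]
    exact mul_le_mul_of_nonneg_left h2 (by norm_num)
  have h4 : 0 ≤ n * (n * (C * b * G)) := by positivity
  have h5 : (2 * (n * (C * G)) + n * (n * (C * G))) * (1 + ‖x‖) +
      (2 * (n * (C * G)) + n * (n * (C * G))) * ζ =
      n * (2 * (C * b) * G) + n * (n * (C * b * G)) := by rw [hb']; ring
  rw [h5]
  linarith

end Coefficients

/-! ### Relaxed controls as measures on `[0,t] × ℝ^d` -/

section Relaxed

variable {T : ℝ} {d : ℕ}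

instance isMarkovKernel_ker (m : RelaxedControl T d) : IsMarkovKernel m.ker := m.markov

instance isFiniteMeasure_meas (m : RelaxedControl T d) (t : Time T) :
    IsFiniteMeasure (m.meas t) := by
  unfold RelaxedControl.meas
  infer_instance

instance nullSingletonClass_leb : NullSingletonClass (leb T) := by
  refine ⟨fun s => ?_⟩
  rw [leb, (MeasurableEmbedding.subtype_coe measurableSet_Icc).comap_apply, Set.image_singleton]
  exact Real.volume_singleton

lemma fst_meas (m : RelaxedControl T d) (t : Time T) :
    (m.meas t).fst = (leb T).restrict (Set.Iic t) :=
  Measure.fst_compProd _ _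

lemma meas_univ_le (m : RelaxedControl T d) (t : Time T) :
    m.meas t Set.univ ≤ leb T Set.univ := by
  rw [← Measure.fst_univ, fst_meas]
  exact Measure.restrict_apply_le _ _

lemma meas_time_eq (m : RelaxedControl T d) (t s : Time T) :
    m.meas t {p | p.1 = s} = 0 := by
  have h : (m.meas t).fst {s} = 0 := by
    rw [fst_meas]
    exact measure_singleton s
  rwa [Measure.fst_apply (measurableSet_singleton s)] at h

/-- Lets integrals up to different times be written as integrals of indicators against one fixed
measure, where they can be compared or taken to a limit. -/
lemma meas_eq_restrict (m : RelaxedControl T d) {s t : Time T} (hst : s ≤ t) :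
    m.meas s = (m.meas t).restrict {p | p.1 ≤ s} := by
  have hms : MeasurableSet {p : Time T × E d | p.1 ≤ s} :=
    measurableSet_le measurable_fst measurable_const
  ext B hB
  rw [Measure.restrict_apply hB, RelaxedControl.meas, RelaxedControl.meas,
    Measure.compProd_apply hB, Measure.compProd_apply (hB.inter hms)]
  have e : (leb T).restrict (Set.Iic s) = ((leb T).restrict (Set.Iic t)).restrict (Set.Iic s) := by
    rw [Measure.restrict_restrict measurableSet_Iic,
      Set.inter_eq_left.2 (Set.Iic_subset_Iic.2 hst)]
  rw [e, ← lintegral_indicator measurableSet_Iic]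
  refine lintegral_congr fun a => ?_
  by_cases ha : a ≤ s
  · rw [Set.indicator_of_mem (Set.mem_Iic.2 ha)]
    congr 1
    ext z
    simp [ha]
  · rw [Set.indicator_of_notMem (by simpa using ha)]
    have : Prod.mk a ⁻¹' (B ∩ {p : Time T × E d | p.1 ≤ s}) = ∅ := by
      ext z
      simp [ha]
    rw [this, measure_empty]

lemma meas_mono (m : RelaxedControl T d) {s t : Time T} (hst : s ≤ t) : m.meas s ≤ m.meas t := by
  rw [meas_eq_restrict m hst]
  exact Measure.restrict_le_self

lemma meas_initial [hT : Fact (0 < T)] (m : RelaxedControl T d) : m.meas (t0 T) = 0 := by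
  have h : Set.Iic (t0 T) = {t0 T} := by
    ext s
    exact ⟨fun hs => le_antisymm hs s.2.1, fun hs => le_of_eq hs⟩
  rw [RelaxedControl.meas, h, Measure.restrict_eq_zero.2 (measure_singleton _),
    Measure.compProd_zero_left]

/-- Indicators of measurable sets are among the test functions generating `relaxedSigma`. -/
lemma measurable_meas {s t : Time T} (hst : s ≤ t) :
    Measurable[relaxedSigma T d t] fun m : RelaxedControl T d => m.meas s := by
  refine @Measure.measurable_of_measurable_coe _ _ _ (relaxedSigma T d t) _ fun B hB => ?_
  have h1 : Measurable[relaxedSigma T d t] fun m : RelaxedControl T d =>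
      ∫ p, B.indicator (fun _ => (1 : ℝ)) p ∂(m.meas s) := by
    refine Measurable.of_comap_le (le_trans ?_ le_sup_left)
    refine le_iSup₂_of_le s hst (le_iSup₂_of_le (B.indicator fun _ => (1 : ℝ)) ⟨?_, 1, ?_⟩ le_rfl)
    · exact measurable_const.indicator hB
    · intro p
      by_cases hp : p ∈ B <;> simp [hp]
  have h2 := ENNReal.measurable_ofReal.comp h1
  have e : (fun m : RelaxedControl T d => m.meas s B) =
      ENNReal.ofReal ∘ fun m : RelaxedControl T d =>
        ∫ p, B.indicator (fun _ => (1 : ℝ)) p ∂(m.meas s) := by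
    funext m
    change _ = ENNReal.ofReal (∫ p, B.indicator (fun _ => (1 : ℝ)) p ∂(m.meas s))
    rw [integral_indicator_const _ hB, smul_eq_mul, mul_one, ofReal_measureReal]
  rw [e]
  exact h2

/-- A family of relaxed controls, measurable up to time `t`, as a finite kernel. -/
def controlKernel {Γ : Type*} {mΓ : MeasurableSpace Γ} {m : Γ → RelaxedControl T d} {t : Time T}
    (hm : Measurable[mΓ, relaxedSigma T d t] m) : Kernel Γ (Time T × E d) where
  toFun γ := (m γ).meas t
  measurable' := (measurable_meas le_rfl).comp hm

instance isFiniteKernel_controlKernel {Γ : Type*} {mΓ : MeasurableSpace Γ}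
    {m : Γ → RelaxedControl T d} {t : Time T} (hm : Measurable[mΓ, relaxedSigma T d t] m) :
    IsFiniteKernel (controlKernel hm) :=
  ⟨leb T Set.univ, measure_lt_top _ _, fun γ => meas_univ_le (m γ) t⟩

end Relaxed

/-! ### The processes `M^φ` -/

section MartFun

variable {T : ℝ} {d k : ℕ} {A I : Type*}

/-- Total variation of the drift part of `M^φ`. -/
def driftVar (𝓜 : Model T d k A I) (φ : E d × ℝ → ℝ) (t : Time T) (x : Path T (E d))
    (y : Path T ℝ) (m : RelaxedControl T d) : ℝ≥0∞ :=
  ∫⁻ p, ‖𝓜.gen φ p.1 x y p.2‖ₑ ∂(m.meas t)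

lemma driftVar_mono (𝓜 : Model T d k A I) (φ : E d × ℝ → ℝ) (x : Path T (E d))
    (y : Path T ℝ) (m : RelaxedControl T d) : Monotone fun t => driftVar 𝓜 φ t x y m :=
  fun _ _ hst => lintegral_mono' (meas_mono m hst) le_rfl

/-- Written with the paths stopped at `t`, the quantity visibly depends on information up to `t`
only; measurability at time `t` then follows from joint measurability of `gen`. -/
lemma driftVar_eq_stopPath (𝓜 : Model T d k A I) (φ : E d × ℝ → ℝ) (t : Time T)
    (x : Path T (E d)) (y : Path T ℝ) (m : RelaxedControl T d) :
    driftVar 𝓜 φ t x y m =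
      ∫⁻ p, ‖𝓜.gen φ p.1 (stopPath t x) (stopPath t y) p.2‖ₑ ∂(m.meas t) := by
  have hms : MeasurableSet {p : Time T × E d | p.1 ≤ t} :=
    measurableSet_le measurable_fst measurable_const
  unfold driftVar
  rw [meas_eq_restrict m (le_refl t)]
  refine setLIntegral_congr_fun hms fun p hp => ?_
  rw [gen_stopPath 𝓜 φ hp]

lemma martFun_eq_stopPath (𝓜 : Model T d k A I) (φ : E d × ℝ → ℝ) {s t : Time T} (hst : s ≤ t)
    (x : Path T (E d)) (y : Path T ℝ) (m : RelaxedControl T d) :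
    𝓜.martFun φ s x y m = φ (stopPath t x s, stopPath t y s) -
      ∫ p, {p : Time T × E d | p.1 ≤ s}.indicator
        (fun p => 𝓜.gen φ p.1 (stopPath t x) (stopPath t y) p.2) p ∂(m.meas t) := by
  have hms : MeasurableSet {p : Time T × E d | p.1 ≤ s} :=
    measurableSet_le measurable_fst measurable_const
  unfold Model.martFun
  rw [stopPath_apply hst, stopPath_apply hst, integral_indicator hms, meas_eq_restrict m hst]
  congr 1
  refine setIntegral_congr_fun hms fun p hp => ?_
  exact (gen_stopPath 𝓜 φ (le_trans hp hst) x y p.2).symm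

lemma martFun_eq_indicator [Fact (0 < T)] (𝓜 : Model T d k A I) (φ : E d × ℝ → ℝ) (s : Time T)
    (x : Path T (E d)) (y : Path T ℝ) (m : RelaxedControl T d) :
    𝓜.martFun φ s x y m = φ (x s, y s) -
      ∫ p, {p : Time T × E d | p.1 ≤ s}.indicator
        (fun p => 𝓜.gen φ p.1 x y p.2) p ∂(m.meas (tT T)) := by
  have hms : MeasurableSet {p : Time T × E d | p.1 ≤ s} :=
    measurableSet_le measurable_fst measurable_const
  have hst : s ≤ tT T := s.2.2
  unfold Model.martFun
  rw [integral_indicator hms, meas_eq_restrict m hst]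

lemma abs_martFun_initial_le [Fact (0 < T)] (𝓜 : Model T d k A I) {φ : E d × ℝ → ℝ} {c : ℝ}
    (hc : ∀ p, |φ p| ≤ c) (x : Path T (E d)) (y : Path T ℝ) (m : RelaxedControl T d) :
    |𝓜.martFun φ (t0 T) x y m| ≤ c := by
  unfold Model.martFun
  rw [meas_initial, integral_zero_measure, sub_zero]
  exact hc _

lemma abs_martFun_le (𝓜 : Model T d k A I) {φ : E d × ℝ → ℝ} {c : ℝ}
    (hc : ∀ p, |φ p| ≤ c) (t : Time T) (x : Path T (E d)) (y : Path T ℝ) (m : RelaxedControl T d)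
    (h : driftVar 𝓜 φ t x y m < ∞) :
    |𝓜.martFun φ t x y m| ≤ c + (driftVar 𝓜 φ t x y m).toReal := by
  unfold Model.martFun
  refine (abs_sub _ _).trans (add_le_add (hc _) ?_)
  have h1 := enorm_integral_le_lintegral_enorm (μ := m.meas t) fun p => 𝓜.gen φ p.1 x y p.2
  have h2 := ENNReal.toReal_mono h.ne h1
  rwa [toReal_enorm] at h2

variable [Fact (0 < T)] [MeasurableSpace A] {𝓜 : Model T d k A I}

lemma measurable_gen_path (h𝓜 : 𝓜.Standing) {φ : E d × ℝ → ℝ} (hφ : ContDiff ℝ 2 φ)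
    (x : Path T (E d)) (y : Path T ℝ) :
    Measurable fun p : Time T × E d => 𝓜.gen φ p.1 x y p.2 := by
  have hp : Measurable fun p : Time T × E d => ((x, y), p) := measurable_prodMk_left
  simpa only [Function.comp_def] using (measurable_gen h𝓜 hφ).comp hp

/-- Dominated convergence: as `s → t`, the indicator of `{p.1 ≤ s}` converges except on `{p.1 = t}`,
which is null because the time marginal is Lebesgue measure. -/
lemma continuous_martFun (h𝓜 : 𝓜.Standing) {φ : E d × ℝ → ℝ} (hφ : ContDiff ℝ 2 φ)
    (x : Path T (E d)) (y : Path T ℝ) (m : RelaxedControl T d)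
    (h : driftVar 𝓜 φ (tT T) x y m < ∞) : Continuous fun t => 𝓜.martFun φ t x y m := by
  have hint : Integrable (fun p => 𝓜.gen φ p.1 x y p.2) (m.meas (tT T)) :=
    ⟨(measurable_gen_path h𝓜 hφ x y).aestronglyMeasurable, h⟩
  have e : (fun t => 𝓜.martFun φ t x y m) = fun t => φ (x t, y t) -
      ∫ p, {p : Time T × E d | p.1 ≤ t}.indicator
        (fun p => 𝓜.gen φ p.1 x y p.2) p ∂(m.meas (tT T)) :=
    funext fun t => martFun_eq_indicator 𝓜 φ t x y m
  rw [e]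
  refine (hφ.continuous.comp (x.continuous.prodMk y.continuous)).sub ?_
  rw [continuous_iff_continuousAt]
  intro t
  refine continuousAt_of_dominated (bound := fun p => ‖𝓜.gen φ p.1 x y p.2‖) ?_ ?_ hint.norm ?_
  · exact Filter.Eventually.of_forall fun s =>
      ((measurable_gen_path h𝓜 hφ x y).indicator
        (measurableSet_le measurable_fst measurable_const)).aestronglyMeasurable
  · exact Filter.Eventually.of_forall fun s => Filter.Eventually.of_forall fun p =>
      norm_indicator_le_norm_self _ _
  · have h0 : ∀ᵐ p ∂(m.meas (tT T)), p.1 ≠ t := by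
      rw [ae_iff]
      simpa using meas_time_eq m (tT T) t
    filter_upwards [h0] with p hp
    rcases lt_or_gt_of_ne hp with hlt | hgt
    · refine (continuousAt_const (y := 𝓜.gen φ p.1 x y p.2)).congr ?_
      filter_upwards [lt_mem_nhds hlt] with s hs
      rw [Set.indicator_of_mem]
      exact le_of_lt hs
    · refine (continuousAt_const (y := (0 : ℝ))).congr ?_
      filter_upwards [gt_mem_nhds hgt] with s hs
      rw [Set.indicator_of_notMem]
      exact not_le.2 hs

section Adapted

variable {Γ : Type*} {mΓ : MeasurableSpace Γ} {X : Γ → Path T (E d)} {Y : Γ → Path T ℝ}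
  {m : Γ → RelaxedControl T d} {t : Time T}

lemma measurable_driftVar (h𝓜 : 𝓜.Standing) {φ : E d × ℝ → ℝ} (hφ : ContDiff ℝ 2 φ)
    (hX : ∀ s ≤ t, Measurable fun γ => X γ s) (hY : ∀ s ≤ t, Measurable fun γ => Y γ s)
    (hm : Measurable[mΓ, relaxedSigma T d t] m) :
    Measurable fun γ => driftVar 𝓜 φ t (X γ) (Y γ) (m γ) := by
  have hf : Measurable fun q : Γ × (Time T × E d) =>
      ‖𝓜.gen φ q.2.1 (stopPath t (X q.1)) (stopPath t (Y q.1)) q.2.2‖ₑ :=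
    ((measurable_gen h𝓜 hφ).comp ((((measurable_stopPath_of_eval hX).comp measurable_fst).prodMk
      ((measurable_stopPath_of_eval hY).comp measurable_fst)).prodMk measurable_snd)).enorm
  have h1 := Measurable.lintegral_kernel_prod_right' (κ := controlKernel hm) hf
  have e : (fun γ => driftVar 𝓜 φ t (X γ) (Y γ) (m γ)) = fun γ =>
      ∫⁻ p, ‖𝓜.gen φ p.1 (stopPath t (X γ)) (stopPath t (Y γ)) p.2‖ₑ ∂(controlKernel hm γ) :=
    funext fun γ => driftVar_eq_stopPath 𝓜 φ t _ _ _
  rw [e]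
  exact h1

/-- Progressive measurability, in the form that `measurable_stopped` takes: with time capped at `t`,
joint measurability holds with the σ-algebra of time `t` on `Γ`. -/
lemma measurable_martFun_min (h𝓜 : 𝓜.Standing) {φ : E d × ℝ → ℝ} (hφ : ContDiff ℝ 2 φ)
    (hX : ∀ s ≤ t, Measurable fun γ => X γ s) (hY : ∀ s ≤ t, Measurable fun γ => Y γ s)
    (hm : Measurable[mΓ, relaxedSigma T d t] m) :
    Measurable fun p : Time T × Γ => 𝓜.martFun φ (min p.1 t) (X p.2) (Y p.2) (m p.2) := by
  have hXs : Measurable fun p : Time T × Γ => stopPath t (X p.2) :=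
    (measurable_stopPath_of_eval hX).comp measurable_snd
  have hYs : Measurable fun p : Time T × Γ => stopPath t (Y p.2) :=
    (measurable_stopPath_of_eval hY).comp measurable_snd
  have hmin : Measurable fun p : Time T × Γ => min p.1 t := measurable_fst.min measurable_const
  have hf : Measurable fun q : (Time T × Γ) × (Time T × E d) =>
      {p : Time T × E d | p.1 ≤ min q.1.1 t}.indicator
        (fun p => 𝓜.gen φ p.1 (stopPath t (X q.1.2)) (stopPath t (Y q.1.2)) p.2) q.2 := by
    have h1 : Measurable fun q : (Time T × Γ) × (Time T × E d) =>
        𝓜.gen φ q.2.1 (stopPath t (X q.1.2)) (stopPath t (Y q.1.2)) q.2.2 := by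
      simpa only [Function.comp_def] using (measurable_gen h𝓜 hφ).comp
        (((hXs.comp measurable_fst).prodMk (hYs.comp measurable_fst)).prodMk measurable_snd)
    exact h1.indicator (measurableSet_le (measurable_fst.comp measurable_snd)
      (hmin.comp measurable_fst))
  have h2 := (hf.stronglyMeasurable.integral_kernel_prod_right'
    (κ := Kernel.prodMkLeft (Time T) (controlKernel hm))).measurable
  have h3 : Measurable fun p : Time T × Γ =>
      φ (stopPath t (X p.2) (min p.1 t), stopPath t (Y p.2) (min p.1 t)) :=
    hφ.continuous.measurable.comp ((measurable_eval.comp (hmin.prodMk hXs)).prodMk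
      (measurable_eval.comp (hmin.prodMk hYs)))
  have e : (fun p : Time T × Γ => 𝓜.martFun φ (min p.1 t) (X p.2) (Y p.2) (m p.2)) = fun p =>
      φ (stopPath t (X p.2) (min p.1 t), stopPath t (Y p.2) (min p.1 t)) -
      ∫ q, {p' : Time T × E d | p'.1 ≤ min p.1 t}.indicator
        (fun p' => 𝓜.gen φ p'.1 (stopPath t (X p.2)) (stopPath t (Y p.2)) p'.2) q
        ∂(Kernel.prodMkLeft (Time T) (controlKernel hm) p) :=
    funext fun p => martFun_eq_stopPath 𝓜 φ (min_le_right _ _) _ _ _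
  rw [e]
  exact h3.sub h2

lemma measurable_martFun (h𝓜 : 𝓜.Standing) {φ : E d × ℝ → ℝ} (hφ : ContDiff ℝ 2 φ)
    (hX : ∀ s ≤ t, Measurable fun γ => X γ s) (hY : ∀ s ≤ t, Measurable fun γ => Y γ s)
    (hm : Measurable[mΓ, relaxedSigma T d t] m) :
    Measurable fun γ => 𝓜.martFun φ t (X γ) (Y γ) (m γ) := by
  have h := (measurable_martFun_min h𝓜 hφ hX hY hm).comp
    (measurable_const.prodMk measurable_id : Measurable fun γ : Γ => (t, γ))
  simpa [Function.comp_def] using h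

lemma measurable_lintegral_zvolSq (h𝓜 : 𝓜.Standing) (hX : ∀ s, Measurable fun γ => X γ s)
    (hm : Measurable[mΓ, relaxedSigma T d t] m) :
    Measurable fun γ => ∫⁻ p, ENNReal.ofReal (𝓜.zvolSq p.1 (stopPath p.1 (X γ)) p.2)
      ∂((m γ).meas t) := by
  have hXm : Measurable X := measurable_path_of_eval hX
  have hf : Measurable fun q : Γ × (Time T × E d) =>
      ENNReal.ofReal (𝓜.zvolSq q.2.1 (stopPath q.2.1 (X q.1)) q.2.2) := by
    have h1 : Measurable fun q : Γ × (Time T × E d) => stopPath q.2.1 (X q.1) :=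
      measurable_stopPath.comp
        ((measurable_fst.comp measurable_snd).prodMk (hXm.comp measurable_fst))
    simpa only [Function.comp_def] using ENNReal.measurable_ofReal.comp
      ((measurable_zvolSq h𝓜).comp (((measurable_fst.comp measurable_snd).prodMk h1).prodMk
        (measurable_snd.comp measurable_snd)))
  exact Measurable.lintegral_kernel_prod_right' (κ := controlKernel hm) hf

end Adapted

lemma driftVar_lt_top (h𝓜 : 𝓜.Standing) {φ : E d × ℝ → ℝ} (hφ : ContDiff ℝ 2 φ)
    (hc : HasCompactSupport φ) (t : Time T) (x : Path T (E d)) (y : Path T ℝ)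
    (m : RelaxedControl T d)
    (h : ∫⁻ p, ENNReal.ofReal (𝓜.zvolSq p.1 (stopPath p.1 x) p.2) ∂(m.meas t) < ∞) :
    driftVar 𝓜 φ t x y m < ∞ := by
  obtain ⟨C, hC, hgen⟩ := exists_abs_gen_le h𝓜 hφ hc
  have hle : driftVar 𝓜 φ t x y m ≤ ∫⁻ p, (ENNReal.ofReal (C * (1 + ‖x‖)) +
      ENNReal.ofReal C * ENNReal.ofReal (𝓜.zvolSq p.1 (stopPath p.1 x) p.2)) ∂(m.meas t) := by
    refine lintegral_mono fun p => ?_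
    have h1 := hgen p.1 x y p.2
    rw [← ENNReal.ofReal_mul hC, ← ENNReal.ofReal_add (by positivity)
      (mul_nonneg hC (zvolSq_nonneg 𝓜 _ _ _)), Real.enorm_eq_ofReal_abs]
    exact ENNReal.ofReal_le_ofReal h1
  refine hle.trans_lt ?_
  rw [lintegral_add_left measurable_const, lintegral_const,
    lintegral_const_mul' _ _ ENNReal.ofReal_ne_top]
  exact ENNReal.add_lt_top.2 ⟨ENNReal.mul_lt_top ENNReal.ofReal_lt_top (measure_lt_top _ _),
    ENNReal.mul_lt_top ENNReal.ofReal_lt_top h⟩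

end MartFun

/-! ### Jensen's inequality for extended real convex functions -/

lemma enorm_le_ofReal_add_ofReal_neg (c : ℝ) :
    ‖c‖ₑ ≤ ENNReal.ofReal c + ENNReal.ofReal (-c) := by
  rw [Real.enorm_eq_ofReal_abs]
  rcases abs_cases c with ⟨h, _⟩ | ⟨h, _⟩ <;> rw [h]
  · exact le_self_add
  · exact le_add_self

/-- Jensen's inequality for the positive and negative parts of a convex function with values in
`ℝ ∪ {∞}` and at most linear decay. -/
lemma jensen_toENNReal {ν : Measure ℝ} [IsProbabilityMeasure ν] (hν : Integrable id ν)
    {φ : ℝ → EReal} (hφm : Measurable φ)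
    (hconv : Convex ℝ {p : ℝ × ℝ | φ p.1 ≤ (p.2 : EReal)})
    (hclosed : IsClosed {p : ℝ × ℝ | φ p.1 ≤ (p.2 : EReal)})
    {C : ℝ} (hgr : ∀ u, ((-(C * (1 + |u|)) : ℝ) : EReal) ≤ φ u) :
    (φ (∫ u, u ∂ν)).toENNReal ≤ ∫⁻ u, (φ u).toENNReal ∂ν ∧
    (φ (∫ u, u ∂ν)).toENNReal + ∫⁻ u, (-φ u).toENNReal ∂ν ≤
      ∫⁻ u, (φ u).toENNReal ∂ν + (-φ (∫ u, u ∂ν)).toENNReal := by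
  set b := ∫ u, u ∂ν with hb
  have hbot : ∀ u, φ u ≠ ⊥ := fun u h => by
    have := hgr u
    rw [h] at this
    exact EReal.coe_ne_bot _ (le_bot_iff.1 this)
  by_cases hp : ∫⁻ u, (φ u).toENNReal ∂ν = ∞
  · rw [hp]
    simp
  -- Linear decay together with the first moment of `ν` makes the negative part integrable; with a
  -- finite positive part, `φ` is then integrable.
  have hn : ∫⁻ u, (-φ u).toENNReal ∂ν ≠ ∞ := by
    have hI : Integrable (fun u : ℝ => C * (1 + |u|)) ν :=
      ((integrable_const 1).add hν.abs).const_mul C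
    refine (lt_of_le_of_lt (lintegral_mono fun u => ?_) hI.lintegral_lt_top).ne
    have h1 : -φ u ≤ ((C * (1 + |u|) : ℝ) : EReal) := by
      rw [EReal.neg_le, ← EReal.coe_neg]
      exact hgr u
    exact EReal.toENNReal_le_toENNReal h1
  have htop : ∀ᵐ u ∂ν, φ u ≠ ⊤ := by
    filter_upwards [ae_lt_top hφm.ereal_toENNReal hp] with u hu
    exact EReal.toENNReal_ne_top_iff.1 hu.ne
  have hcoe : ∀ᵐ u ∂ν, φ u = ((φ u).toReal : EReal) := by
    filter_upwards [htop] with u hu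
    exact (EReal.coe_toReal hu (hbot u)).symm
  have hpe : ∫⁻ u, ENNReal.ofReal (φ u).toReal ∂ν = ∫⁻ u, (φ u).toENNReal ∂ν := by
    refine lintegral_congr_ae ?_
    filter_upwards [hcoe] with u hu
    conv_rhs => rw [hu]
    rfl
  have hne : ∫⁻ u, ENNReal.ofReal (-(φ u).toReal) ∂ν = ∫⁻ u, (-φ u).toENNReal ∂ν := by
    refine lintegral_congr_ae ?_
    filter_upwards [hcoe] with u hu
    conv_rhs => rw [hu]
    rfl
  have hg : Integrable (fun u => (φ u).toReal) ν := by
    refine ⟨hφm.ereal_toReal.aestronglyMeasurable, ?_⟩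
    refine lt_of_le_of_lt (lintegral_mono fun u => enorm_le_ofReal_add_ofReal_neg _) ?_
    rw [lintegral_add_left hφm.ereal_toReal.ennreal_ofReal, hpe, hne]
    exact ENNReal.add_lt_top.2 ⟨lt_top_iff_ne_top.2 hp, lt_top_iff_ne_top.2 hn⟩
  -- The geometric form of Jensen: the mean of `(u, φ u)` stays in the closed convex epigraph.
  have hmem := hconv.integral_mem hclosed (f := fun u => (u, (φ u).toReal)) (μ := ν)
    (by filter_upwards [hcoe] with u hu using hu.le) (hν.prodMk hg)
  rw [integral_pair (f := fun u : ℝ => u) hν hg] at hmem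
  have hle : φ b ≤ ((∫ u, (φ u).toReal ∂ν : ℝ) : EReal) := hmem
  rw [integral_eq_lintegral_pos_part_sub_lintegral_neg_part hg, hpe, hne] at hle
  set p := ∫⁻ u, (φ u).toENNReal ∂ν
  set n := ∫⁻ u, (-φ u).toENNReal ∂ν
  have hbt : φ b ≠ ⊤ := ne_top_of_le_ne_top (EReal.coe_ne_top _) hle
  obtain ⟨c, hc⟩ : ∃ c : ℝ, φ b = (c : EReal) := ⟨_, (EReal.coe_toReal hbt (hbot b)).symm⟩
  rw [hc] at hle ⊢
  have hle' : c ≤ p.toReal - n.toReal := EReal.coe_le_coe_iff.1 hle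
  have hneg : (-(c : EReal)).toENNReal = ENNReal.ofReal (-c) := rfl
  rw [EReal.real_coe_toENNReal, hneg]
  have hn0 : 0 ≤ n.toReal := ENNReal.toReal_nonneg
  have hp0 : 0 ≤ p.toReal := ENNReal.toReal_nonneg
  constructor
  · rw [← ENNReal.ofReal_toReal hp]
    exact ENNReal.ofReal_le_ofReal (by linarith)
  · rw [← ENNReal.ofReal_toReal hp, ← ENNReal.ofReal_toReal hn]
    rcases le_total 0 c with h0 | h0
    · rw [ENNReal.ofReal_of_nonpos (by linarith : -c ≤ 0), add_zero, ← ENNReal.ofReal_add h0 hn0]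
      exact ENNReal.ofReal_le_ofReal (by linarith)
    · rw [ENNReal.ofReal_of_nonpos h0, zero_add, ← ENNReal.ofReal_add hp0 (by linarith)]
      exact ENNReal.ofReal_le_ofReal (by linarith)

/-- Jensen's inequality is kept free of subtraction, so that it can be integrated in `ℝ≥0∞`, and is
converted back here. If `p = ∞` the left side is `⊥` by convention; otherwise `h1` makes `a` finite
and the right side is not of the form `∞ - ∞`. -/
lemma ereal_sub_le_sub {a a' p n : ℝ≥0∞} (h1 : a ≤ p) (h2 : a + n ≤ p + a') :
    ((n : EReal) - (p : EReal)) ≤ ((a' : EReal) - (a : EReal)) := by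
  by_cases hp : p = ∞
  · rw [hp]
    simp
  have ha : a ≠ ∞ := ne_top_of_le_ne_top hp h1
  by_cases ha' : a' = ∞
  · rw [ha']
    lift a to NNReal using ha
    have : ((⊤ : ℝ≥0∞) : EReal) - ((a : ℝ≥0∞) : EReal) = ⊤ := EReal.top_sub_coe (a : ℝ)
    rw [this]
    exact le_top
  have hn : n ≠ ∞ := ne_top_of_le_ne_top (ENNReal.add_ne_top.2 ⟨hp, ha'⟩) (le_add_self.trans h2)
  lift a to NNReal using ha
  lift a' to NNReal using ha'
  lift p to NNReal using hp
  lift n to NNReal using hn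
  have h3 : (a : ℝ) + n ≤ p + a' := by exact_mod_cast h2
  change (((n : ℝ) : EReal) - ((p : ℝ) : EReal)) ≤ (((a' : ℝ) : EReal) - ((a : ℝ) : EReal))
  rw [← EReal.coe_sub, ← EReal.coe_sub, EReal.coe_le_coe_iff]
  linarith

/-- Jensen's inequality for regular conditional distributions and expectations with the convention
`∞ - ∞ = -∞`. -/
theorem lowerExp_neg_le_lowerExp_neg_condDistrib {Ω S : Type*} {mΩ : MeasurableSpace Ω}
    {mS : MeasurableSpace S} {P : Measure Ω} [IsProbabilityMeasure P] {Φ : Ω → S}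
    (hΦ : Measurable Φ) {U : Ω → ℝ} (hUm : Measurable U) (hU : Integrable U P)
    {H : S → ℝ → EReal} (hH : Measurable fun p : S × ℝ => H p.1 p.2)
    (hconv : ∀ s, Convex ℝ {p : ℝ × ℝ | H s p.1 ≤ (p.2 : EReal)})
    (hclosed : ∀ s, IsClosed {p : ℝ × ℝ | H s p.1 ≤ (p.2 : EReal)})
    (hgr : ∀ s, ∃ C : ℝ, ∀ u, ((-(C * (1 + |u|)) : ℝ) : EReal) ≤ H s u) :
    lowerExp P (fun ω => -H (Φ ω) (U ω)) ≤
      lowerExp P (fun ω => -H (Φ ω) (∫ u, u ∂(condDistrib U Φ P (Φ ω)))) := by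
  set κ := condDistrib U Φ P with hκ
  have hsplit : ∀ f : S × ℝ → ℝ≥0∞, Measurable f →
      ∫⁻ ω, f (Φ ω, U ω) ∂P = ∫⁻ ω, ∫⁻ u, f (Φ ω, u) ∂(κ (Φ ω)) ∂P := fun f hf => by
    rw [← lintegral_map (f := f) hf (hΦ.prodMk hUm), ← compProd_map_condDistrib hUm.aemeasurable,
      Measure.lintegral_compProd hf, lintegral_map hf.lintegral_kernel_prod_right' hΦ]
  have hint : ∀ᵐ ω ∂P, Integrable id (κ (Φ ω)) := by
    have h1 : Integrable (fun p : S × ℝ => p.2) (P.map fun ω => (Φ ω, U ω)) :=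
      (integrable_map_measure measurable_snd.aestronglyMeasurable
        (hΦ.prodMk hUm).aemeasurable).2 hU
    exact ae_of_ae_map hΦ.aemeasurable (h1.condDistrib_ae_map hUm.aemeasurable)
  -- Jensen for the conditional law, outcome by outcome; both inequalities are between elements of
  -- `ℝ≥0∞` and survive integration even when some parts are infinite.
  have hJ := hint.mono fun ω hω =>
    jensen_toENNReal hω (hH.comp measurable_prodMk_left : Measurable (H (Φ ω)))
      (hconv _) (hclosed _) (hgr (Φ ω)).choose_spec
  have hHp : Measurable fun p : S × ℝ => (H p.1 p.2).toENNReal := hH.ereal_toENNReal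
  have hHn : Measurable fun p : S × ℝ => (-H p.1 p.2).toENNReal := hH.neg.ereal_toENNReal
  have hbm : Measurable fun ω => ∫ u, u ∂(κ (Φ ω)) := by
    have h1 : StronglyMeasurable fun s => ∫ u, u ∂(κ s) :=
      StronglyMeasurable.integral_kernel_prod_right' (f := fun p : S × ℝ => p.2)
        measurable_snd.stronglyMeasurable
    exact h1.measurable.comp hΦ
  have hap : Measurable fun ω => (H (Φ ω) (∫ u, u ∂(κ (Φ ω)))).toENNReal :=
    hHp.comp (hΦ.prodMk hbm)
  have hpp : Measurable fun ω => ∫⁻ u, (H (Φ ω) u).toENNReal ∂(κ (Φ ω)) :=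
    hHp.lintegral_kernel_prod_right'.comp hΦ
  unfold lowerExp
  simp only [neg_neg]
  rw [hsplit _ hHp, hsplit _ hHn]
  refine ereal_sub_le_sub (lintegral_mono_ae (hJ.mono fun ω h => h.1)) ?_
  rw [← lintegral_add_left hap, ← lintegral_add_left hpp]
  exact lintegral_mono_ae (hJ.mono fun ω h => h.2)

/-! ### Images of filtered probability spaces -/

section Transport

/-- Conditional expectations under an image measure. -/
lemma condExp_map_comp_ae_eq {Ω S : Type*} {m' : MeasurableSpace S} {mΩ : MeasurableSpace Ω}
    {mS : MeasurableSpace S} {P : Measure Ω} [IsProbabilityMeasure P] {Ψ : Ω → S}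
    (hΨ : Measurable Ψ) (hm' : m' ≤ mS) {f : S → ℝ} (hf : Integrable f (P.map Ψ)) :
    (fun ω => ((P.map Ψ)[f | m']) (Ψ ω)) =ᵐ[P] P[fun ω => f (Ψ ω) | m'.comap Ψ] := by
  have : IsProbabilityMeasure (P.map Ψ) := Measure.isProbabilityMeasure_map hΨ.aemeasurable
  have hle : m'.comap Ψ ≤ mΩ := (MeasurableSpace.comap_mono hm').trans hΨ.comap_le
  have hfi : Integrable (fun ω => f (Ψ ω)) P := hf.comp_measurable hΨ
  have hgi : Integrable (fun ω => ((P.map Ψ)[f | m']) (Ψ ω)) P :=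
    integrable_condExp.comp_measurable hΨ
  refine ae_eq_condExp_of_forall_setIntegral_eq hle hfi (fun s _ _ => hgi.integrableOn) ?_ ?_
  · rintro _ ⟨B, hB, rfl⟩ -
    rw [← setIntegral_map (hm' B hB) integrable_condExp.aestronglyMeasurable hΨ.aemeasurable,
      ← setIntegral_map (hm' B hB) hf.aestronglyMeasurable hΨ.aemeasurable,
      setIntegral_condExp hm' hf hB]
  · exact (stronglyMeasurable_condExp.comp_measurable
      (comap_measurable Ψ)).aestronglyMeasurable

variable {Ω S : Type*} {mΩ : MeasurableSpace Ω} {mS : MeasurableSpace S} {P : Measure Ω}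
  {Ψ : Ω → S}

/-- As `𝒢` is the pull-back of `ℋ`, conditional expectations under the image measure, composed with
`Ψ`, are conditional expectations given `𝒢`. -/
lemma martingale_map [IsProbabilityMeasure P] {ι : Type*} [Preorder ι] (hΨ : Measurable Ψ) {ℋ : Filtration ι mS}
    {𝒢 : Filtration ι mΩ} (h𝒢 : ∀ t, 𝒢 t = (ℋ t).comap Ψ) {M : ι → S → ℝ}
    (hMm : ∀ t, Measurable[ℋ t] (M t)) (hM : Martingale (fun t ω => M t (Ψ ω)) 𝒢 P) :
    Martingale M ℋ (P.map Ψ) := by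
  have hi : ∀ t, Integrable (M t) (P.map Ψ) := fun t =>
    (integrable_map_measure ((hMm t).mono (ℋ.le t) le_rfl).aestronglyMeasurable
      hΨ.aemeasurable).2 (hM.integrable t)
  refine ⟨fun t => (hMm t).stronglyMeasurable, fun s t hst => ?_⟩
  refine (ae_map_iff hΨ.aemeasurable (measurableSet_eq_fun
    (stronglyMeasurable_condExp.mono (ℋ.le s)).measurable ((hMm s).mono (ℋ.le s) le_rfl))).2 ?_
  have h1 := condExp_map_comp_ae_eq hΨ (ℋ.le s) (hi t)
  have h2 := hM.condExp_ae_eq hst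
  rw [h𝒢 s] at h2
  exact h1.trans h2

/-- A version `N'` that agrees almost surely at each fixed time is enough, since each partition
involves countably many times. -/
lemma isQuadCovariation_map {T : ℝ} (hΨ : Measurable Ψ) {M N A : Time T → S → ℝ}
    {N' : Time T → Ω → ℝ} (hM : ∀ t, Measurable (M t)) (hN : ∀ t, Measurable (N t))
    (hA : ∀ t, Measurable (A t)) (hN' : ∀ t, (fun ω => N t (Ψ ω)) =ᵐ[P] N' t)
    (h : IsQuadCovariation P (fun t ω => M t (Ψ ω)) N' (fun t ω => A t (Ψ ω))) :
    IsQuadCovariation (P.map Ψ) M N A := by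
  intro ε hε
  obtain ⟨δ, hδ, hδ'⟩ := h ε hε
  refine ⟨δ, hδ, fun n π hπ h0 hn hmesh => ?_⟩
  have hms : MeasurableSet {s | ∃ j ≤ n, ε ≤ |(∑ i ∈ Finset.range j,
      (M (π (i + 1)) s - M (π i) s) * (N (π (i + 1)) s - N (π i) s)) - A (π j) s|} := by
    have e : {s | ∃ j ≤ n, ε ≤ |(∑ i ∈ Finset.range j,
      (M (π (i + 1)) s - M (π i) s) * (N (π (i + 1)) s - N (π i) s)) - A (π j) s|} =
      ⋃ j, ⋃ (_ : j ≤ n), {s | ε ≤ |(∑ i ∈ Finset.range j,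
      (M (π (i + 1)) s - M (π i) s) * (N (π (i + 1)) s - N (π i) s)) - A (π j) s|} := by
      ext s
      simp
    rw [e]
    refine MeasurableSet.iUnion fun j => MeasurableSet.iUnion fun _ =>
      measurableSet_le measurable_const (Measurable.abs (Measurable.sub ?_ (hA _)))
    exact Finset.measurable_fun_sum _ fun i _ =>
      ((hM _).sub (hM _)).mul ((hN _).sub (hN _))
  rw [Measure.map_apply hΨ hms]
  refine le_trans (measure_mono_ae ?_) (hδ' n π hπ h0 hn hmesh)
  have hall : ∀ᵐ ω ∂P, ∀ i : ℕ, N (π i) (Ψ ω) = N' (π i) ω := ae_all_iff.2 fun i => hN' (π i)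
  filter_upwards [hall] with ω hω
  rintro ⟨j, hj, hle⟩
  refine ⟨j, hj, ?_⟩
  simpa only [hω] using hle

lemma lowerExp_map (hΨ : Measurable Ψ) {f : S → EReal} (hf : Measurable f) :
    lowerExp (P.map Ψ) f = lowerExp P fun ω => f (Ψ ω) := by
  unfold lowerExp
  have hn : Measurable fun s => (-f s).toENNReal := hf.neg.ereal_toENNReal
  rw [lintegral_map hf.ereal_toENNReal hΨ, lintegral_map hn hΨ]

lemma upperExp_map (hΨ : Measurable Ψ) {f : S → EReal} (hf : Measurable f) :
    upperExp (P.map Ψ) f = upperExp P fun ω => f (Ψ ω) := by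
  unfold upperExp
  have hn : Measurable fun s => -f s := hf.neg
  rw [lowerExp_map hΨ hn]

end Transport

/-! ### Jensen's inequality for the objective and the constraints -/

section Functionals

variable {T : ℝ} [Fact (0 < T)] {d k : ℕ} {A I : Type*} [MeasurableSpace A]
  {𝓜 : Model T d k A I}

lemma measurable_F (h𝓜 : 𝓜.Standing) :
    Measurable fun p : Path T (E d) × ℝ × ℝ => 𝓜.F p.1 p.2.1 p.2.2 :=
  h𝓜.F_usc.measurable

lemma measurable_h (h𝓜 : 𝓜.Standing) (i : I) :
    Measurable fun p : Path T (E d) × ℝ × ℝ => 𝓜.h i p.1 p.2.1 p.2.2 :=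
  (h𝓜.h_lsc i).measurable

lemma isClosed_epigraph_real {φ : ℝ → EReal} (hφ : LowerSemicontinuous φ) :
    IsClosed {p : ℝ × ℝ | φ p.1 ≤ (p.2 : EReal)} :=
  hφ.isClosed_epigraph.preimage (f := fun p : ℝ × ℝ => (p.1, (p.2 : EReal)))
    (continuous_fst.prodMk (continuous_coe_real_ereal.comp continuous_snd))

lemma convex_epigraph_h (h𝓜 : 𝓜.Standing) (i : I) (x : Path T (E d)) (y : ℝ) :
    Convex ℝ {p : ℝ × ℝ | 𝓜.h i x y p.1 ≤ (p.2 : EReal)} := by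
  rw [convex_iff_forall_pos]
  intro p hp p' hp' α β hα hβ hαβ
  refine (h𝓜.h_convex i x y p.1 p'.1 α β hα hβ hαβ).trans ?_
  have h1 : (α : EReal) * 𝓜.h i x y p.1 ≤ (α : EReal) * (p.2 : EReal) :=
    mul_le_mul_of_nonneg_left hp (EReal.coe_nonneg.2 hα.le)
  have h2 : (β : EReal) * 𝓜.h i x y p'.1 ≤ (β : EReal) * (p'.2 : EReal) :=
    mul_le_mul_of_nonneg_left hp' (EReal.coe_nonneg.2 hβ.le)
  exact add_le_add h1 h2

/-- Membership is rewritten as a real lower bound for `F` before concavity is used, because negation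
in `EReal` does not distribute over sums with opposite infinities. -/
lemma convex_epigraph_neg_F (h𝓜 : 𝓜.Standing) (x : Path T (E d)) (y : ℝ) :
    Convex ℝ {p : ℝ × ℝ | -𝓜.F x y p.1 ≤ (p.2 : EReal)} := by
  rw [convex_iff_forall_pos]
  intro p hp p' hp' α β hα hβ hαβ
  have hp1 : ((-p.2 : ℝ) : EReal) ≤ 𝓜.F x y p.1 := by
    rw [EReal.coe_neg]
    exact EReal.neg_le.1 hp
  have hp2 : ((-p'.2 : ℝ) : EReal) ≤ 𝓜.F x y p'.1 := by
    rw [EReal.coe_neg]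
    exact EReal.neg_le.1 hp'
  have h1 : (α : EReal) * ((-p.2 : ℝ) : EReal) ≤ (α : EReal) * 𝓜.F x y p.1 :=
    mul_le_mul_of_nonneg_left hp1 (EReal.coe_nonneg.2 hα.le)
  have h2 : (β : EReal) * ((-p'.2 : ℝ) : EReal) ≤ (β : EReal) * 𝓜.F x y p'.1 :=
    mul_le_mul_of_nonneg_left hp2 (EReal.coe_nonneg.2 hβ.le)
  have h3 := (add_le_add h1 h2).trans (h𝓜.F_concave x y p.1 y p'.1 α β hα hβ hαβ)
  rw [← add_mul, hαβ, one_mul, ← EReal.coe_mul, ← EReal.coe_mul, ← EReal.coe_add] at h3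
  change -𝓜.F x y (α * p.1 + β * p'.1) ≤ ((α * p.2 + β * p'.2 : ℝ) : EReal)
  rw [EReal.neg_le, ← EReal.coe_neg]
  refine le_of_eq_of_le ?_ h3
  congr 1
  ring

lemma lowerSemicontinuous_neg_F (h𝓜 : 𝓜.Standing) (x : Path T (E d)) (y : ℝ) :
    LowerSemicontinuous fun u => -𝓜.F x y u := by
  intro u c hc
  have h1 : 𝓜.F x y u < -c := EReal.lt_neg_comm.1 hc
  have h2 : Continuous fun u : ℝ => (x, y, u) := by fun_prop
  filter_upwards [h2.continuousAt.eventually (h𝓜.F_usc (x, y, u) (-c) h1)] with v hv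
  exact EReal.lt_neg_comm.1 hv

variable {Ω S : Type*} {mΩ : MeasurableSpace Ω} {mS : MeasurableSpace S} {P : Measure Ω}
  [IsProbabilityMeasure P] {Φ : Ω → S} {U : Ω → ℝ} {x : S → Path T (E d)} {y : S → ℝ}

lemma lowerExp_F_le_condDistrib (h𝓜 : 𝓜.Standing) (hΦ : Measurable Φ) (hUm : Measurable U)
    (hU : Integrable U P) (hx : Measurable x) (hy : Measurable y) :
    lowerExp P (fun ω => 𝓜.F (x (Φ ω)) (y (Φ ω)) (U ω)) ≤
      lowerExp P fun ω => 𝓜.F (x (Φ ω)) (y (Φ ω)) (∫ u, u ∂(condDistrib U Φ P (Φ ω))) := by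
  obtain ⟨C, hC, hgr⟩ := h𝓜.F_growth
  have hH : Measurable fun p : S × ℝ => -𝓜.F (x p.1) (y p.1) p.2 :=
    ((measurable_F h𝓜).comp ((hx.comp measurable_fst).prodMk
      ((hy.comp measurable_fst).prodMk measurable_snd))).neg
  have h := lowerExp_neg_le_lowerExp_neg_condDistrib hΦ hUm hU
    (H := fun s u => -𝓜.F (x s) (y s) u) hH (fun s => convex_epigraph_neg_F h𝓜 _ _)
    (fun s => isClosed_epigraph_real (lowerSemicontinuous_neg_F h𝓜 _ _))
    -- The constant may depend on `s`: `1 + ‖x‖ + |y| + |u| ≤ (1 + ‖x‖ + |y|) * (1 + |u|)`.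
    (fun s => ⟨C * (1 + ‖x s‖ + |y s|), fun u => ?_⟩)
  · simpa only [neg_neg] using h
  · rw [EReal.coe_neg, EReal.neg_le_neg_iff]
    refine ((le_max_left _ _).trans (hgr (x s) (y s) u)).trans (EReal.coe_le_coe_iff.2 ?_)
    rw [mul_assoc]
    refine mul_le_mul_of_nonneg_left ?_ hC.le
    have : 0 ≤ (‖x s‖ + |y s|) * |u| := by positivity
    nlinarith

lemma upperExp_h_condDistrib_le (h𝓜 : 𝓜.Standing) (i : I) (hΦ : Measurable Φ)
    (hUm : Measurable U) (hU : Integrable U P) (hx : Measurable x) (hy : Measurable y) :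
    upperExp P (fun ω => 𝓜.h i (x (Φ ω)) (y (Φ ω)) (∫ u, u ∂(condDistrib U Φ P (Φ ω)))) ≤
      upperExp P fun ω => 𝓜.h i (x (Φ ω)) (y (Φ ω)) (U ω) := by
  obtain ⟨C, hC, hgr⟩ := h𝓜.h_growth i
  have hH : Measurable fun p : S × ℝ => 𝓜.h i (x p.1) (y p.1) p.2 :=
    (measurable_h h𝓜 i).comp ((hx.comp measurable_fst).prodMk
      ((hy.comp measurable_fst).prodMk measurable_snd))
  have hlsc : ∀ s, LowerSemicontinuous fun u => 𝓜.h i (x s) (y s) u := fun s =>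
    (h𝓜.h_lsc i).comp (by fun_prop : Continuous fun u : ℝ => (x s, y s, u))
  refine EReal.neg_le_neg_iff.2 (lowerExp_neg_le_lowerExp_neg_condDistrib hΦ hUm hU
    (H := fun s u => 𝓜.h i (x s) (y s) u) hH (fun s => convex_epigraph_h h𝓜 i _ _)
    (fun s => isClosed_epigraph_real (hlsc s))
    (fun s => ⟨C * (1 + ‖x s‖ + |y s|), fun u => ?_⟩))
  refine le_trans (EReal.coe_le_coe_iff.2 ?_) (hgr (x s) (y s) u)
  have : 0 ≤ C * ((‖x s‖ + |y s|) * |u|) := by positivity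
  nlinarith

end Functionals

/-! ### The canonical space -/

section Canonical

variable {T : ℝ} {d : ℕ}

lemma measurable_pathSigma {V : Type} [TopologicalSpace V] [MeasurableSpace V] {s t : Time T}
    (hst : s ≤ t) : Measurable[pathSigma T V t] fun x : Path T V => x s :=
  Measurable.of_comap_le (le_iSup₂_of_le s hst le_rfl)

lemma measurable_pathSigma_of_eval {V : Type} [TopologicalSpace V] [MeasurableSpace V]
    {Γ : Type*} {mΓ : MeasurableSpace Γ} {t : Time T} {X : Γ → Path T V}
    (hX : ∀ s ≤ t, Measurable fun γ => X γ s) : Measurable[mΓ, pathSigma T V t] X := by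
  rw [measurable_iff_comap_le, MeasurableSpace.comap_iSup]
  refine iSup_le fun s => ?_
  rw [MeasurableSpace.comap_iSup]
  refine iSup_le fun hs => ?_
  rw [MeasurableSpace.comap_comp]
  exact (hX s hs).comap_le

section Coordinates

variable {s t : Time T}

lemma measurable_canon_X (hst : s ≤ t) :
    Measurable[canonSigma T d t] fun c : Canon T d => c.1.1 s :=
  (measurable_pathSigma hst).comp
    ((@measurable_fst _ _ (pathSigma T (E d) t) (pathSigma T ℝ t)).comp
      (@measurable_fst _ _ ((pathSigma T (E d) t).prod (pathSigma T ℝ t)) (relaxedSigma T d t)))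

lemma measurable_canon_Y (hst : s ≤ t) :
    Measurable[canonSigma T d t] fun c : Canon T d => c.1.2 s :=
  (measurable_pathSigma hst).comp
    ((@measurable_snd _ _ (pathSigma T (E d) t) (pathSigma T ℝ t)).comp
      (@measurable_fst _ _ ((pathSigma T (E d) t).prod (pathSigma T ℝ t)) (relaxedSigma T d t)))

lemma measurable_canon_m :
    Measurable[canonSigma T d t, relaxedSigma T d t] fun c : Canon T d => c.2 :=
  @measurable_snd _ _ ((pathSigma T (E d) t).prod (pathSigma T ℝ t)) (relaxedSigma T d t)

lemma measurable_canonSigma {Γ : Type*} {mΓ : MeasurableSpace Γ} {X : Γ → Path T (E d)}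
    {Y : Γ → Path T ℝ} {m : Γ → RelaxedControl T d} (hX : ∀ s ≤ t, Measurable fun γ => X γ s)
    (hY : ∀ s ≤ t, Measurable fun γ => Y γ s) (hm : Measurable[mΓ, relaxedSigma T d t] m) :
    Measurable[mΓ, canonSigma T d t] fun γ => ((X γ, Y γ), m γ) :=
  ((measurable_pathSigma_of_eval hX).prodMk (measurable_pathSigma_of_eval hY)).prodMk hm

end Coordinates

variable [hT : Fact (0 < T)]

lemma le_tT (s : Time T) : s ≤ tT T := s.2.2

lemma pathMeasurableSpace_le {V : Type} [PseudoMetricSpace V] [SecondCountableTopology V]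
    [MeasurableSpace V] [BorelSpace V] :
    pathMeasurableSpace T V ≤ pathSigma T V (tT T) := by
  have h := (measurable_path_of_eval (mΓ := pathSigma T V (tT T)) (X := fun x : Path T V => x)
    fun s => measurable_pathSigma (le_tT s)).comap_le
  exact (MeasurableSpace.comap_id (m := pathMeasurableSpace T V)).symm.trans_le h

lemma relaxedMeasurableSpace_le : relaxedMeasurableSpace T d ≤ relaxedSigma T d (tT T) :=
  iSup_le fun t => relaxedSigma_mono T d (le_tT t)

/-- With `canonSigma_le`, the terminal `ℱ^c_T` is the whole σ-algebra, so a measurable function on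
the canonical space is automatically `ℱ^c_T`-measurable. -/
lemma le_canonSigma :
    (inferInstance : MeasurableSpace (Canon T d)) ≤ canonSigma T d (tT T) :=
  sup_le_sup
    (MeasurableSpace.comap_mono (sup_le_sup
      (MeasurableSpace.comap_mono pathMeasurableSpace_le)
      (MeasurableSpace.comap_mono pathMeasurableSpace_le)))
    (MeasurableSpace.comap_mono relaxedMeasurableSpace_le)

/-- Reduces `m_0 = δ_0` to the value of `m_0` on one measurable set, which makes the initial
condition an event. -/
lemma eq_dirac_iff {α : Type*} [MeasurableSpace α] [MeasurableSingletonClass α] (ν : Measure α)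
    [IsProbabilityMeasure ν] (a : α) : ν = Measure.dirac a ↔ ν {a}ᶜ = 0 := by
  refine ⟨fun h => ?_, fun h => ?_⟩
  · rw [h, Measure.dirac_apply' _ (measurableSet_singleton a).compl]
    simp
  · have h1 : ∀ᵐ z ∂ν, z = a := by
      rw [ae_iff]
      exact h
    have h2 : Measure.map id ν = Measure.map (fun _ => a) ν := Measure.map_congr h1
    rwa [Measure.map_id, Measure.map_const, measure_univ, one_smul] at h2

lemma measurable_ker_initial : Measurable fun m : RelaxedControl T d => m.ker (t0 T) := by
  have h1 : MeasurableSpace.comap (fun m : RelaxedControl T d => m.ker (t0 T)) inferInstance ≤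
      ⨆ (s : Time T) (_ : (s : ℝ) = 0),
        MeasurableSpace.comap (fun m : RelaxedControl T d => m.ker s) inferInstance :=
    le_iSup₂_of_le (f := fun (s : Time T) (_ : (s : ℝ) = 0) =>
      MeasurableSpace.comap (fun m : RelaxedControl T d => m.ker s) inferInstance)
      (t0 T) rfl le_rfl
  have h2 : MeasurableSpace.comap (fun m : RelaxedControl T d => m.ker (t0 T)) inferInstance ≤
      relaxedSigma T d (t0 T) := h1.trans le_sup_right
  exact Measurable.of_comap_le (h2.trans (relaxedSigma_le T d _))

lemma measurableSet_initial (x₀ : E d) :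
    MeasurableSet {c : Canon T d | c.1.1 (t0 T) = x₀ ∧ c.1.2 (t0 T) = 0 ∧
      c.2.ker (t0 T) = Measure.dirac 0} := by
  have h0 : t0 T ≤ tT T := le_tT _
  have hker : Measurable fun c : Canon T d => c.2.ker (t0 T) {0}ᶜ := by
    have h2 : Measurable fun m : RelaxedControl T d => m.ker (t0 T) := measurable_ker_initial
    exact (Measure.measurable_coe (measurableSet_singleton 0).compl).comp
      (h2.comp measurable_snd)
  have hX := (measurable_canon_X (d := d) h0).mono (canonSigma_le T d _) le_rfl
  have hY := (measurable_canon_Y (d := d) h0).mono (canonSigma_le T d _) le_rfl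
  have e : {c : Canon T d | c.1.1 (t0 T) = x₀ ∧ c.1.2 (t0 T) = 0 ∧
      c.2.ker (t0 T) = Measure.dirac 0} =
      {c : Canon T d | c.1.1 (t0 T) = x₀} ∩ ({c : Canon T d | c.1.2 (t0 T) = 0} ∩
        {c : Canon T d | c.2.ker (t0 T) {0}ᶜ = 0}) := by
    ext c
    simp only [Set.mem_ofPred_eq, Set.mem_inter_iff, eq_dirac_iff]
  rw [e]
  exact (hX (measurableSet_singleton x₀)).inter
    ((hY (measurableSet_singleton 0)).inter (hker (measurableSet_singleton 0)))

end Canonical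

/-! ### Moments of `U` and construction of the control rule. -/

lemma memLp_of_lintegral_rpow_lt_top {Ω : Type*} {mΩ : MeasurableSpace Ω} {P : Measure Ω}
    [IsFiniteMeasure P] {U : Ω → ℝ} (hU : Measurable U) {p : ℝ} (hp : 1 < p)
    (h : ∫⁻ ω, ENNReal.ofReal |U ω| ^ p ∂P < ∞) : MemLp U (ENNReal.ofReal p) P := by
  have hp0 : ENNReal.ofReal p ≠ 0 := by
    rw [Ne, ENNReal.ofReal_eq_zero, not_le]
    linarith
  refine ⟨hU.aestronglyMeasurable, ?_⟩
  rw [eLpNorm_lt_top_iff_lintegral_rpow_enorm_lt_top hp0 ENNReal.ofReal_ne_top,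
    ENNReal.toReal_ofReal (by linarith)]
  simpa only [Real.enorm_eq_ofReal_abs] using h

lemma lintegral_rpow_lt_top_of_memLp {Ω : Type*} {mΩ : MeasurableSpace Ω} {P : Measure Ω}
    {U : Ω → ℝ} {p : ℝ} (hp : 1 < p) (h : MemLp U (ENNReal.ofReal p) P) :
    ∫⁻ ω, ENNReal.ofReal |U ω| ^ p ∂P < ∞ := by
  have hp0 : ENNReal.ofReal p ≠ 0 := by
    rw [Ne, ENNReal.ofReal_eq_zero, not_le]
    linarith
  have h1 := h.2
  rw [eLpNorm_lt_top_iff_lintegral_rpow_enorm_lt_top hp0 ENNReal.ofReal_ne_top,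
    ENNReal.toReal_ofReal (by linarith)] at h1
  simpa only [Real.enorm_eq_ofReal_abs] using h1

/-- The filtration generated by a map into the canonical space. -/
def pullbackFiltration {T : ℝ} {d : ℕ} {Ω : Type*} {mΩ : MeasurableSpace Ω}
    {Φ : Ω → Canon T d} (hΦ : Measurable Φ) : Filtration (Time T) mΩ where
  seq t := (canonSigma T d t).comap Φ
  mono' _ _ h := MeasurableSpace.comap_mono (canonSigma_mono T d h)
  le' t := (MeasurableSpace.comap_mono (canonSigma_le T d t)).trans hΦ.comap_le

/-- Conditioning the random variable `U` on the canonical information preserves the control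
conditions and does not lower the objective. -/
theorem exists_controlRule_of_controlConditions {T : ℝ} [Fact (0 < T)] {d k : ℕ} {A I : Type*}
    [MeasurableSpace A]
    (𝓜 : Model T d k A I) (h𝓜 : 𝓜.Standing)
    {Ω : Type*} [mΩ : MeasurableSpace Ω]
    (ℱ : Filtration (Time T) mΩ) (P' : Measure Ω) [IsProbabilityMeasure P']
    (X : Ω → Path T (E d)) (Y : Ω → Path T ℝ)
    (m : Ω → RelaxedControl T d) (U : Ω → ℝ)
    (hX : ∀ t, Measurable[ℱ t] fun ω => X ω t)
    (hY : ∀ t, Measurable[ℱ t] fun ω => Y ω t)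
    (hm : ∀ t, Measurable[ℱ t, relaxedSigma T d t] m)
    (hU : Measurable[ℱ (tT T)] U)
    (q q' : ℝ) (hctrl : 𝓜.ControlConditions ℱ P' q q' X Y m U) :
    ∃ P ∈ 𝓜.controlRules q q',
      (∃ U' : Canon T d → ℝ,
        Measurable[canonSigma T d (tT T)] U' ∧
        ∀ᵐ ω ∂P, ω.2 = U' ω.1) ∧
      lowerExp P' (fun ω => 𝓜.F (X ω) (Y ω (tT T)) (U ω)) ≤
        lowerExp P
          (fun ω => 𝓜.F ω.1.1.1 (ω.1.1.2 (tT T)) ω.2) := by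
  set Φ : Ω → Canon T d := fun ω => ((X ω, Y ω), m ω) with hΦdef
  have hΦt : ∀ t, Measurable[ℱ t, canonSigma T d t] Φ := fun t =>
    measurable_canonSigma (fun s hs => (hX s).mono (ℱ.mono hs) le_rfl)
      (fun s hs => (hY s).mono (ℱ.mono hs) le_rfl) (hm t)
  have hΦ : Measurable Φ := (hΦt (tT T)).mono (ℱ.le _) le_canonSigma
  have hUm : Measurable U := hU.mono (ℱ.le _) le_rfl
  have hMem := memLp_of_lintegral_rpow_lt_top hUm hctrl.one_lt_q' hctrl.moment_U
  have hq1 : 1 ≤ ENNReal.ofReal q' := by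
    rw [← ENNReal.ofReal_one]
    exact ENNReal.ofReal_le_ofReal hctrl.one_lt_q'.le
  have hUi : Integrable U P' := hMem.integrable hq1
  set U' : Canon T d → ℝ := fun c => ∫ u, u ∂(condDistrib U Φ P' c) with hU'def
  have hU'm : Measurable U' :=
    (StronglyMeasurable.integral_kernel_prod_right' (κ := condDistrib U Φ P')
      (f := fun p : Canon T d × ℝ => p.2) measurable_snd.stronglyMeasurable).measurable
  set V : Ω → ℝ := fun ω => U' (Φ ω) with hVdef
  have hVm : Measurable V := hU'm.comp hΦ
  have hVc : P'[U | MeasurableSpace.comap Φ inferInstance] =ᵐ[P'] V :=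
    condExp_ae_eq_integral_condDistrib' hΦ hUi
  have hVi : Integrable V P' := integrable_condExp.congr hVc
  set Ψ : Ω → Canon T d × ℝ := fun ω => (Φ ω, V ω) with hΨdef
  have hΨ : Measurable Ψ := hΦ.prodMk hVm
  have hprob : IsProbabilityMeasure (P'.map Ψ) := Measure.isProbabilityMeasure_map hΨ.aemeasurable
  set 𝒢 : Filtration (Time T) mΩ := pullbackFiltration hΦ with h𝒢def
  have h𝒢ℱ : ∀ t, 𝒢 t ≤ ℱ t := fun t => (hΦt t).comap_le
  -- The canonical filtration ignores the last coordinate, so its pull-back by `Ψ = (Φ, V)` is its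
  -- pull-back by `Φ`.
  have h𝒢c : ∀ t, 𝒢 t = (canonFiltration T d t).comap Ψ := fun t =>
    (MeasurableSpace.comap_comp (m := canonSigma T d t) (f := Prod.fst) (g := Ψ)).symm
  have hΦ𝒢 : ∀ t, Measurable[𝒢 t, canonSigma T d t] Φ := fun t => comap_measurable Φ
  have hX𝒢 : ∀ t, ∀ s ≤ t, Measurable[𝒢 t] fun ω => X ω s := fun t s hs =>
    (measurable_canon_X hs).comp (hΦ𝒢 t)
  have hY𝒢 : ∀ t, ∀ s ≤ t, Measurable[𝒢 t] fun ω => Y ω s := fun t s hs =>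
    (measurable_canon_Y hs).comp (hΦ𝒢 t)
  have hm𝒢 : ∀ t, Measurable[𝒢 t, relaxedSigma T d t] m := fun t =>
    measurable_canon_m.comp (hΦ𝒢 t)
  have hfst : ∀ t, Measurable[canonFiltration T d t, canonSigma T d t]
      (Prod.fst : Canon T d × ℝ → Canon T d) := fun t => comap_measurable _
  have hMc : ∀ {φ : E d × ℝ → ℝ}, ContDiff ℝ 2 φ → ∀ t, Measurable[canonFiltration T d t]
      fun ω : Canon T d × ℝ => 𝓜.martFun φ t ω.1.1.1 ω.1.1.2 ω.1.2 := fun hφ t =>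
    (measurable_martFun h𝓜 hφ (fun s hs => measurable_canon_X hs)
      (fun s hs => measurable_canon_Y hs) measurable_canon_m).comp (hfst t)
  have hcX : Measurable fun c : Canon T d => c.1.1 := measurable_fst.comp measurable_fst
  have hcY : Measurable fun c : Canon T d => c.1.2 (tT T) :=
    (measurable_canon_Y le_rfl).mono (canonSigma_le T d _) le_rfl
  -- Tower property: `E[V | 𝒢_t] = E[U | 𝒢_t]`, because `𝒢_t` is contained in the σ-algebra of `Φ`.
  -- Hence the covariation can be computed with the original `U`.
  have hcond : ∀ t, (fun ω => ((P'.map Ψ)[fun ω => ω.2 | canonFiltration T d t]) (Ψ ω))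
      =ᵐ[P'] P'[U | 𝒢 t] := by
    intro t
    have hi : Integrable (fun ω : Canon T d × ℝ => ω.2) (P'.map Ψ) :=
      (integrable_map_measure measurable_snd.aestronglyMeasurable hΨ.aemeasurable).2 hVi
    have h1 := condExp_map_comp_ae_eq hΨ ((canonFiltration T d).le t) hi
    rw [← h𝒢c t] at h1
    have h2 : P'[V | 𝒢 t] =ᵐ[P'] P'[P'[U | MeasurableSpace.comap Φ inferInstance] | 𝒢 t] :=
      condExp_congr_ae hVc.symm
    have h3 : P'[P'[U | MeasurableSpace.comap Φ inferInstance] | 𝒢 t] =ᵐ[P'] P'[U | 𝒢 t] :=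
      condExp_condExp_of_le (MeasurableSpace.comap_mono (canonSigma_le T d t)) hΦ.comap_le
    exact h1.trans (h2.trans h3)
  refine ⟨P'.map Ψ, ⟨hprob, ?_⟩, ⟨U', hU'm.mono le_canonSigma le_rfl, ?_⟩, ?_⟩
  · refine ⟨hctrl.one_lt_q, hctrl.one_lt_q', ?_, ?_, ?_, ?_, ?_, ?_, ?_⟩
    -- An upper bound for the integral under the image measure suffices, and it holds without
    -- measurability of the integrand.
    · exact (lintegral_map_le _ _).trans_lt hctrl.moment_m
    · refine (lintegral_map_le _ _).trans_lt ?_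
      exact lintegral_rpow_lt_top_of_memLp hctrl.one_lt_q'
        ((memLp_congr_ae hVc).1 (hMem.condExp hq1))
    · intro φ hφ hc
      refine martingale_map hΨ h𝒢c (hMc hφ) ?_
      refine martingale_of_le h𝒢ℱ (hctrl.martingale φ hφ hc) fun t => ?_
      exact (measurable_martFun h𝓜 hφ (hX𝒢 t) (hY𝒢 t) (hm𝒢 t)).stronglyMeasurable
    · exact (ae_map_iff hΨ.aemeasurable (measurable_fst (measurableSet_initial 𝓜.x₀))).2
        hctrl.initial
    · intro i
      have hmeas : Measurable fun ω : Canon T d × ℝ => 𝓜.h i ω.1.1.1 (ω.1.1.2 (tT T)) ω.2 :=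
        (measurable_h h𝓜 i).comp ((hcX.comp measurable_fst).prodMk
          ((hcY.comp measurable_fst).prodMk measurable_snd))
      rw [upperExp_map hΨ hmeas]
      exact (upperExp_h_condDistrib_le h𝓜 i hΦ hUm hUi hcX hcY).trans (hctrl.constraint i)
    · intro φ hφ hc
      obtain ⟨c, hcb⟩ := hφ.continuous.bounded_above_of_compact_support hc
      -- The moment condition on the control makes the drift variation finite almost surely; this
      -- yields both the continuity of `M^φ` and the localisation.
      have hfin : ∀ᵐ ω ∂P', driftVar 𝓜 φ (tT T) (X ω) (Y ω) (m ω) < ∞ := by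
        have hq0 : 0 < q / 2 := by linarith [hctrl.one_lt_q]
        have hzm := measurable_lintegral_zvolSq h𝓜
          (fun s => (hX s).mono (ℱ.le s) le_rfl) ((hm (tT T)).mono (ℱ.le _) le_rfl)
        filter_upwards [ae_lt_top (hzm.pow_const (q / 2)) hctrl.moment_m.ne] with ω hω
        exact driftVar_lt_top h𝓜 hφ hc _ _ _ _ ((ENNReal.rpow_lt_top_iff_of_pos hq0).1 hω)
      have hQ := isQuadCovariation_of_le h𝒢ℱ (hctrl.martingale φ hφ hc)
        (hfin.mono fun ω hω => continuous_martFun h𝓜 hφ _ _ _ hω)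
        (W := fun t ω => driftVar 𝓜 φ t (X ω) (Y ω) (m ω))
        (fun ω => driftVar_mono 𝓜 φ _ _ _)
        (fun t => measurable_driftVar h𝓜 hφ (hX𝒢 t) (hY𝒢 t) (hm𝒢 t)) hfin
        (fun t => measurable_martFun_min h𝓜 hφ (hX𝒢 t) (hY𝒢 t) (hm𝒢 t))
        ((norm_nonneg _).trans (hcb 0)) (fun ω => abs_martFun_initial_le 𝓜 hcb _ _ _)
        (fun ω t h => abs_martFun_le 𝓜 hcb t _ _ _ h) hUi (hctrl.orthogonal φ hφ hc)
      have hMm : ∀ t, Measurable fun ω : Canon T d × ℝ =>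
          𝓜.martFun φ t ω.1.1.1 ω.1.1.2 ω.1.2 :=
        fun t => (hMc hφ t).mono ((canonFiltration T d).le t) le_rfl
      have hNm : ∀ t, Measurable ((P'.map Ψ)[fun ω => ω.2 | canonFiltration T d t]) :=
        fun t => (stronglyMeasurable_condExp.mono ((canonFiltration T d).le t)).measurable
      exact isQuadCovariation_map hΨ hMm hNm (fun _ => measurable_const) hcond hQ
    · have h1 : ∫ ω, ω.2 ∂(P'.map Ψ) = ∫ ω, U ω ∂P' := by
        rw [integral_map hΨ.aemeasurable measurable_snd.aestronglyMeasurable]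
        change ∫ ω, V ω ∂P' = _
        rw [← integral_congr_ae hVc, integral_condExp hΦ.comap_le]
      rw [h1]
      exact hctrl.participation
  · refine (ae_map_iff hΨ.aemeasurable (measurableSet_eq_fun measurable_snd
      (hU'm.comp measurable_fst))).2 ?_
    exact Filter.Eventually.of_forall fun ω => rfl
  · have hmeas : Measurable fun ω : Canon T d × ℝ => 𝓜.F ω.1.1.1 (ω.1.1.2 (tT T)) ω.2 :=
      (measurable_F h𝓜).comp ((hcX.comp measurable_fst).prodMk
        ((hcY.comp measurable_fst).prodMk measurable_snd))
    rw [lowerExp_map hΨ hmeas]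
    have hJ := lowerExp_F_le_condDistrib h𝓜 hΦ hUm hUi hcX hcY
    simp only [hΦdef] at hJ
    exact hJ

end PrincipalAgent

end

theorem lemma4p7 {T : ℝ} [Fact (0 < T)] {d k : ℕ} {A I : Type*}
    [TopologicalSpace A] [PolishSpace A] [MeasurableSpace A] [BorelSpace A]
    (𝓜 : PrincipalAgent.Model T d k A I) (h𝓜 : 𝓜.Standing)
    {Ω : Type*} [mΩ : MeasurableSpace Ω]
    (ℱ : Filtration (PrincipalAgent.Time T) mΩ) (P' : Measure Ω) [IsProbabilityMeasure P']
    (X : Ω → PrincipalAgent.Path T (PrincipalAgent.E d)) (Y : Ω → PrincipalAgent.Path T ℝ)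
    (m : Ω → PrincipalAgent.RelaxedControl T d) (U : Ω → ℝ)
    (hX : ∀ t, Measurable[ℱ t] fun ω => X ω t)
    (hY : ∀ t, Measurable[ℱ t] fun ω => Y ω t)
    (hm : ∀ t, Measurable[ℱ t, PrincipalAgent.relaxedSigma T d t] m)
    (hU : Measurable[ℱ (PrincipalAgent.tT T)] U)
    (q q' : ℝ) (hctrl : 𝓜.ControlConditions ℱ P' q q' X Y m U) :
    ∃ P ∈ 𝓜.controlRules q q',
      (∃ U' : PrincipalAgent.Canon T d → ℝ,
        Measurable[PrincipalAgent.canonSigma T d (PrincipalAgent.tT T)] U' ∧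
        ∀ᵐ ω ∂P, ω.2 = U' ω.1) ∧
      PrincipalAgent.lowerExp P' (fun ω => 𝓜.F (X ω) (Y ω (PrincipalAgent.tT T)) (U ω)) ≤
        PrincipalAgent.lowerExp P
          (fun ω => 𝓜.F ω.1.1.1 (ω.1.1.2 (PrincipalAgent.tT T)) ω.2) :=
  PrincipalAgent.exists_controlRule_of_controlConditions 𝓜 h𝓜 ℱ P' X Y m U hX hY hm hU q q' hctrl
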